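/- **Regret upper bound for FedQ-Hoeffding.** Let $(\mathcal S,\mathcal A,H,\mathbb P,r)$ be a tabular episodic MDP with $|\mathcal S|=S\ge 1$ states, $|\mathcal A|=A\ge 1$ actions, $H\ge 1$ steps per episode, transition kernels $\mathbb P_h(\cdot\mid x,a)$ and deterministic rewards $r_h(x,a)\in[0,1]$, $h\in[H]$. For a (possibly randomized, step-dependent) policy $\pi$ let $V_h^\pi(x)$ be the expected sum of the rewards at steps $h,\dots,H$ when $\pi$ is followed from $x_h=x$, and let $V_h^\star(x)=\sup_\pi V_h^\pi(x)$. There are $M\ge 1$ synchronized agents, each acting in an independent copy of the MDP; the initial states of the episodes are chosen by an adversary who may use everything observed in earlier episodes. *Algorithm (inputs $T_0,K_0\in\mathbb N_+$, $b_t\ge 0$).* Put $\alpha_t=\frac{H+1}{H+t}$, $\theta_t^i=\alpha_i\prod_{i'=i+1}^t(1-\alpha_{i'})$ for $1\le i\le t$, $i_0=2MH(H+1)$, and $0/0=0$. Initially $N_h^1=0$, $Q_h^1=V_h^1=H$ for $h\in[H]$, and $\pi^1$ is an arbitrary deterministic policy; $V_{H+1}^k=0$ for all $k$. Round $k$ is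 executed if $k\le K_0$ and $HM\sum_{k'<k}n^{k'}<T_0$; otherwise the algorithm has stopped. In round $k$ every agent follows $\pi^k$, episode after episode. The round ends after the first episode at whose end some agent has visited some $(x,a,h)$, within the round, at least $\max\{1,\lfloor N_h^k(x,a)/(MH(H+1))\rfloor\}$ times; $n^k$ is the number of episodes per agent in the round. Let $n_h^{m,k}(x,a)$ be the number of visits of $(x,a,h)$ by agent $m$ in round $k$, $n_h^k=\sum_m n_h^{m,k}$, $N_h^{k+1}=N_h^k+n_h^k$, and let $v_{h+1}^{m,k}(x,a)$ be the average of $V_{h+1}^k$ over the states that follow these visits of agent $m$. For $(x,a,h)$ with $a=\pi_h^k(x)$ and $n_h^k(x,a)>0$ put $t'=N_h^k(x,a)$, $t''=N_h^{k+1}(x,a)$, $\alpha_{agg}=1-\prod_{t=t'+1}^{t''}(1-\alpha_t)$, $\beta=2\sum_{t=t'+1}^{t''}\theta_{t''}^t b_t$. If $t'<i_0$, let $m_1<m_2<\dots$ be the agents with $n_h^{m,k}(x,a)>0$ and set $$Q_h^{k+1}(x,a)=(1-\alpha_{agg})Q_h^k(x,a)+\alpha_{agg}r_h(x,a)+\sum_{t=1}^{t''-t'}\theta_{t''}^{t'+t}\,v_{h+1}^{m_t,k}(x,a)+\beta/2;$$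 if $t'\ge i_0$, set $$Q_h^{k+1}(x,a)=(1-\alpha_{agg})Q_h^k(x,a)+\alpha_{agg}\Big(r_h(x,a)+\frac{1}{n_h^k(x,a)}\sum_{m=1}^M n_h^{m,k}(x,a)\,v_{h+1}^{m,k}(x,a)\Big)+\beta/2 .$$ All other values of $Q$ are kept. Then $V_h^{k+1}(x)=\min\{H,\max_a Q_h^{k+1}(x,a)\}$ and $\pi_h^{k+1}(x)\in\arg\max_a Q_h^{k+1}(x,a)$, with ties broken by any fixed rule. *Regret.* For $K\in[K_0]$ let $T=H\sum_{k=1}^K n^k$ be the number of steps of each agent in the first $K$ rounds (rounds that are not executed count as empty, $n^k=0$) and $$\mathrm{Regret}(T)=\sum_{m=1}^M\sum_{k=1}^K\sum_{j=1}^{n^k}\Big(V_1^\star(x_1^{m,k,j})-V_1^{\pi^k}(x_1^{m,k,j})\Big),$$ where $x_1^{m,k,j}$ is the initial state of agent $m$ in episode $j$ of round $k$. *Theorem.* There are universal constants $c,C>0$ such that the following holds for all such MDPs, all $M,T_0,K_0\ge1$, all first policies and tie-breaking rules, all adversaries, all $K\in[K_0]$ and all $p\in(0,1)$. Let $\tilde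 C=\frac1{H(H+1)}$ and $\iota=\max\{\iota_0,\iota_1\}$ with $$\iota_0=\log\frac{2SA(T_0+HM)(1+\tilde C)}{p},\qquad \iota_1=\log\frac{2K_0SAH(T_0/H+M)(1+\tilde C)}{p},$$ and run the algorithm with $b_t=c\sqrt{H^3\iota/t}$. Then, with probability at least $1-p$, $$\mathrm{Regret}(T)\le C\left(\sqrt{H^4\iota MTSA}+HSA(M-1)\sqrt{H^3\iota}+MH^2SA+H^4SA(M-1)\right).$$ -/

import Mathlib

open scoped BigOperators

namespace FedQ

noncomputable section

/-! Indices of steps, rounds, episodes and agents start at `0`; visit numbers `t` of a triple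
(step, state, action) start at `1`. -/

/-- A tabular episodic Markov decision process with deterministic rewards in `[0, 1]`. Only the
steps `h < H` matter: the states of an episode are `x 0, …, x H`, and the action taken in `x h`
(`h < H`) yields `r h (x h) a` and the next state `x (h + 1)` with law `P h (x h) a`. -/
structure MDP (S A : Type*) where
  H : ℕ
  H_pos : 0 < H
  P : ℕ → S → A → PMF S
  r : ℕ → S → A → ℝ
  r_nonneg : ∀ h x a, 0 ≤ r h x a
  r_le_one : ∀ h x a, r h x a ≤ 1

namespace MDP

variable {S A : Type*} (mdp : MDP S A)

/-- The law of the state at step `h + i`, for the policy `pol`, given that the state at step `h`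
is `x`. -/
def stateLaw (pol : ℕ → S → PMF A) (h : ℕ) (x : S) : ℕ → PMF S
  | 0 => PMF.pure x
  | i + 1 => (stateLaw pol h x i).bind fun y => (pol (h + i) y).bind fun a => mdp.P (h + i) y a

/-- The state value function of a (randomized, step-dependent) policy: the expected sum of the
rewards at the steps `h, …, H - 1`, given that the state at step `h` is `x`. -/
def value [Fintype S] [Fintype A] (pol : ℕ → S → PMF A) (h : ℕ) (x : S) : ℝ :=
  ∑ i ∈ Finset.range (mdp.H - h), ∑ y : S, ∑ a : A,
    (mdp.stateLaw pol h x i y).toReal * (pol (h + i) y a).toReal * mdp.r (h + i) y a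

/-- The optimal state value function. -/
def optValue [Fintype S] [Fintype A] (h : ℕ) (x : S) : ℝ :=
  ⨆ pol : ℕ → S → PMF A, mdp.value pol h x

end MDP

/-- A deterministic policy, seen as a randomized one. -/
def detPolicy {S A : Type*} (pol : ℕ → S → A) : ℕ → S → PMF A :=
  fun h x => PMF.pure (pol h x)

/-- The learning rate `α_t = (H + 1) / (H + t)`. -/
def lrate (H t : ℕ) : ℝ := ((H : ℝ) + 1) / ((H : ℝ) + (t : ℝ))

/-- The weight `θ_t^i = α_i ∏_{i < i' ≤ t} (1 - α_{i'})`, for `1 ≤ i ≤ t`. -/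
def weight (H t i : ℕ) : ℝ := lrate H i * ∏ i' ∈ Finset.Ioc i t, (1 - lrate H i')

/-- The inputs of the algorithm: the number `M` of agents, the termination parameters `T₀`, `K₀`,
the arbitrary first policy, and the rule that selects a maximizing action in round `k` at step `h`
in state `x` (that is, the way in which ties are broken). -/
structure Input (S A : Type*) where
  M : ℕ
  M_pos : 0 < M
  T₀ : ℕ
  T₀_pos : 0 < T₀
  K₀ : ℕ
  K₀_pos : 0 < K₀
  initPolicy : ℕ → S → A
  argmax : ℕ → ℕ → S → (A → ℝ) → A
  argmax_spec : ∀ k h x (q : A → ℝ) (a : A), q a ≤ q (argmax k h x q)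

/-- What the central server holds at the beginning of a round: the number of episodes that each
agent has run so far, the visit counts `N h x a`, the estimates `Q h x a` and `V h x`, and the
policy to be executed in the round. -/
structure Server (S A : Type*) where
  episodes : ℕ
  N : ℕ → S → A → ℕ
  Q : ℕ → S → A → ℝ
  V : ℕ → S → ℝ
  policy : ℕ → S → A

section Round

variable {S A : Type*} [Fintype S] [Fintype A] [DecidableEq S] [DecidableEq A]
variable (mdp : MDP S A) (inp : Input S A) (b : ℕ → ℝ)

/-- The server at the beginning of the first round. -/
def Server.init : Server S A where
  episodes := 0
  N := fun _ _ _ => 0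
  Q := fun _ _ _ => mdp.H
  V := fun h _ => if h < mdp.H then mdp.H else 0
  policy := inp.initPolicy

/- In what follows `w j m h` is the state of agent `m` at step `h` of the `j`-th episode of the
round, and `st` is the server at the beginning of the round. -/
variable (st : Server S A) (w : ℕ → Fin inp.M → ℕ → S)

/-- The number of visits of `(h, x, a)` by agent `m` during the first `j` episodes of the round. -/
def visits (j : ℕ) (m : Fin inp.M) (h : ℕ) (x : S) (a : A) : ℕ :=
  ((Finset.range j).filter fun j' => w j' m h = x ∧ st.policy h (w j' m h) = a).card

/-- The number of visits of `(h, x, a)` by one agent that ends the round. -/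
def threshold (h : ℕ) (x : S) (a : A) : ℕ :=
  max 1 (st.N h x a / (inp.M * mdp.H * (mdp.H + 1)))

/-- After `j` episodes of the round, some agent sends the abortion signal. -/
def Abort (j : ℕ) : Prop :=
  ∃ (m : Fin inp.M) (h : ℕ) (x : S) (a : A),
    h < mdp.H ∧ threshold mdp inp st h x a ≤ visits inp st w j m h x a

open Classical in
/-- The number of episodes that each agent runs in round `k`: all agents stop after the first
episode at which an abortion signal is sent. It is `0` if the server has terminated before. -/
def roundLength (k : ℕ) : ℕ :=
  if mdp.H * (inp.M * st.episodes) < inp.T₀ ∧ k < inp.K₀ then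
    sInf {j : ℕ | Abort mdp inp st w j}
  else 0

/- In what follows `n` is the number of episodes of the round. -/
variable (n : ℕ)

/-- The number of visits of `(h, x, a)` by all agents during the round. -/
def totalVisits (h : ℕ) (x : S) (a : A) : ℕ :=
  ∑ m : Fin inp.M, visits inp st w n m h x a

/-- The local estimate of agent `m` of the expected return from step `h + 1` on. -/
def localReturn (m : Fin inp.M) (h : ℕ) (x : S) (a : A) : ℝ :=
  (∑ j ∈ Finset.range n,
    if w j m h = x ∧ st.policy h (w j m h) = a then st.V (h + 1) (w j m (h + 1)) else 0) /
    (visits inp st w n m h x a : ℝ)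

/-- The global estimate of the expected return from step `h + 1` on. -/
def globalReturn (h : ℕ) (x : S) (a : A) : ℝ :=
  (∑ m : Fin inp.M, localReturn inp st w n m h x a * (visits inp st w n m h x a : ℝ)) /
    (totalVisits inp st w n h x a : ℝ)

/-- The position of agent `m`, counted from `1`, among the agents that visited `(h, x, a)` during
the round. -/
def agentRank (m : Fin inp.M) (h : ℕ) (x : S) (a : A) : ℕ :=
  ((Finset.univ : Finset (Fin inp.M)).filter fun m' =>
    m' ≤ m ∧ 0 < visits inp st w n m' h x a).card

/-- The visit counts after the round. -/
def newN (h : ℕ) (x : S) (a : A) : ℕ := st.N h x a + totalVisits inp st w n h x a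

/-- The aggregated learning rate of the round. -/
def aggRate (h : ℕ) (x : S) (a : A) : ℝ :=
  1 - ∏ t ∈ Finset.Ioc (st.N h x a) (newN inp st w n h x a), (1 - lrate mdp.H t)

/-- The aggregated bonus `β` of the round. -/
def aggBonus (h : ℕ) (x : S) (a : A) : ℝ :=
  2 * ∑ t ∈ Finset.Ioc (st.N h x a) (newN inp st w n h x a),
    weight mdp.H (newN inp st w n h x a) t * b t

/-- The estimates of the action values after the round. -/
def newQ (h : ℕ) (x : S) (a : A) : ℝ :=
  if a ≠ st.policy h x ∨ totalVisits inp st w n h x a = 0 then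
    st.Q h x a
  else if st.N h x a < 2 * inp.M * mdp.H * (mdp.H + 1) then
    (1 - aggRate mdp inp st w n h x a) * st.Q h x a
      + aggRate mdp inp st w n h x a * mdp.r h x a
      + (∑ m ∈ (Finset.univ : Finset (Fin inp.M)).filter
            (fun m => 0 < visits inp st w n m h x a),
          weight mdp.H (newN inp st w n h x a) (st.N h x a + agentRank inp st w n m h x a)
            * localReturn inp st w n m h x a)
      + aggBonus mdp inp b st w n h x a / 2
  else
    (1 - aggRate mdp inp st w n h x a) * st.Q h x a
      + aggRate mdp inp st w n h x a * (mdp.r h x a + globalReturn inp st w n h x a)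
      + aggBonus mdp inp b st w n h x a / 2

/-- The server after round `k`. -/
def Server.next (k : ℕ) : Server S A where
  episodes := st.episodes + n
  N := newN inp st w n
  Q := newQ mdp inp b st w n
  V := fun h x => if h < mdp.H then min (mdp.H : ℝ) (⨆ a : A, newQ mdp inp b st w n h x a) else 0
  policy := fun h x => inp.argmax (k + 1) h x (newQ mdp inp b st w n h x)

end Round

section Run

variable {S A : Type*} [Fintype S] [Fintype A] [DecidableEq S] [DecidableEq A]
variable (mdp : MDP S A) (inp : Input S A) (b : ℕ → ℝ)

/- In what follows `w k j m h` is the state of agent `m` at step `h` of the `j`-th episode of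
round `k`. Values of `w` at episodes that are not run (`j ≥ length mdp inp b w k`) have no
influence. -/
variable (w : ℕ → ℕ → Fin inp.M → ℕ → S)

/-- The server at the beginning of round `k`, for the observed states `w`. -/
def server : ℕ → Server S A
  | 0 => Server.init mdp inp
  | k + 1 =>
    Server.next mdp inp b (server k) (w k) (roundLength mdp inp (server k) (w k) k) k

/-- The number of episodes that each agent runs in round `k` (`0` if round `k` is not executed). -/
def length (k : ℕ) : ℕ := roundLength mdp inp (server mdp inp b w k) (w k) k

/-- The number `T` of steps of each agent in the first `K` rounds. -/
def steps (K : ℕ) : ℕ := mdp.H * ∑ k ∈ Finset.range K, length mdp inp b w k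

/-- The regret of all agents in the first `K` rounds. -/
def regret (K : ℕ) : ℝ :=
  ∑ m : Fin inp.M, ∑ k ∈ Finset.range K, ∑ j ∈ Finset.range (length mdp inp b w k),
    (mdp.optValue 0 (w k j m 0)
      - mdp.value (detPolicy (server mdp inp b w k).policy) 0 (w k j m 0))

/-- The event that what has been observed up to step `h` (included) of episode `j` of round `k`
is as in `w`. -/
def historyEvent {Ω : Type*} (X : Ω → ℕ → ℕ → Fin inp.M → ℕ → S) (k j h : ℕ) : Set Ω :=
  {ω | (∀ k' < k, ∀ j' < length mdp inp b w k', ∀ m, ∀ h' ≤ mdp.H, X ω k' j' m h' = w k' j' m h')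
    ∧ (∀ j' < j, ∀ m, ∀ h' ≤ mdp.H, X ω k j' m h' = w k j' m h')
    ∧ (∀ m, ∀ h' ≤ h, X ω k j m h' = w k j m h')}

end Run

/-- The random states `X` of the agents arise from running the algorithm, with the bonus `b`, on
independent copies of the MDP: in every episode that is run, given everything observed before,
the next states of the agents are independent with the laws prescribed by the transition kernel
and by the current policy. Nothing is assumed about the initial states of the episodes, so that an
adversary may choose them depending on the past, and at random. -/
structure IsRun {S A : Type*} [Fintype S] [Fintype A] [DecidableEq S] [DecidableEq A]
    (mdp : MDP S A) (inp : Input S A) (b : ℕ → ℝ)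
    {Ω : Type*} [MeasurableSpace Ω] (μ : MeasureTheory.Measure Ω)
    (X : Ω → ℕ → ℕ → Fin inp.M → ℕ → S) : Prop where
  measurable : ∀ k j m h s, MeasurableSet {ω | X ω k j m h = s}
  transition : ∀ (w : ℕ → ℕ → Fin inp.M → ℕ → S) (k j h : ℕ),
    j < length mdp inp b w k → h < mdp.H →
    μ (historyEvent mdp inp b w X k j (h + 1)) =
      μ (historyEvent mdp inp b w X k j h) *
        ∏ m : Fin inp.M,
          mdp.P h (w k j m h) ((server mdp inp b w k).policy h (w k j m h)) (w k j m (h + 1))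

/-- The constant `1 / (H (H + 1))`. -/
def Ctilde (H : ℕ) : ℝ := 1 / ((H : ℝ) * ((H : ℝ) + 1))

/-- The logarithmic factor `ι = max {ι₀, ι₁}`, where `s` and `a` are the numbers of states and of
actions. -/
def logFactor (s a H M T₀ K₀ : ℕ) (p : ℝ) : ℝ :=
  max
    (Real.log (2 * (s : ℝ) * (a : ℝ) * ((T₀ : ℝ) + (H : ℝ) * (M : ℝ)) * (1 + Ctilde H) / p))
    (Real.log (2 * (K₀ : ℝ) * (s : ℝ) * (a : ℝ) * (H : ℝ) * ((T₀ : ℝ) / (H : ℝ) + (M : ℝ))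
      * (1 + Ctilde H) / p))

/-- The bonus `b_t = c √(H³ ι / t)`, for `t ≥ 1`. -/
def hoeffdingBonus (c : ℝ) (H : ℕ) (ι : ℝ) (t : ℕ) : ℝ :=
  c * Real.sqrt ((H : ℝ) ^ 3 * ι / (t : ℝ))

end

end FedQ

/-! Unrolled over the rounds (`Q_eq`), the estimate of a triple is the initial value `H` (erased by
the first visit), plus a weighted average `aggregate` of the samples `r + V (h + 1)`, plus the bonus
`bonusSum`. Subtracting the optimal return (`Q_sub_eq`) leaves four terms: the initial error, the
aggregated excess of `V` over the optimal value at the next step, the aggregated `noise`, and the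
bonus.

Noise. The aggregation weights depend on the random ends of the rounds, so the aggregated noise is
not a martingale. But given the counts, the weights form a nondecreasing function of the visit
number, bounded by the last learning rate and of total mass at most one (`exists_aggregate_eq`).
Abel summation therefore reduces the noise to unweighted sums over windows `(i, n]` of visit numbers
(`abs_aggregate_le`, `abs_abel_sum_le`). Each window sum is a martingale with increments in an
interval of length `H`, and the windows are polynomially many, so a union bound suffices
(`measure_badEvent_le`). No filtration is set up: histories of bounded length take finitely many
values, and `lintegral_partialSum_succ_le` compares exponential moments on each of the corresponding
atoms. Off the bad event the bonus dominates the noise (`abs_aggregate_noise_le`), and induction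
over the rounds shows that `V` dominates the optimal value (`lookahead_le_Q`).

Regret. By optimism the regret is at most the summed `gap` between `V` and the value of the executed
policy. At one step, `gap_le` bounds the gap by the error of `Q`, a martingale difference `drift`,
and the gap minus the excess at the next step. Summed over the visits of a triple, the error of `Q`
costs at most `(1 + 1 / H) ^ 2` times the excess at the next step, plus boundary terms
(`sum_roundCount_mul_le`). For the excess, the potential "remaining total weight times current
aggregate" telescopes (`roundCount_mul_aggregate_le`); for the bonus, `1 / √N` telescopes against
`√N` (`div_sqrt_le_telescope`). Rounds that are large compared with the past occur only for several
agents and small counts, which is the origin of the terms with `M - 1`. As the excess is at most the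
gap, the gaps satisfy a recursion in the step with factor `(1 + 1 / H) ^ 2` (`runSum_gap_le`); over
`H` steps this factor stays below `9`. Cauchy–Schwarz over the triples gives the leading term. -/

set_option linter.unusedSectionVars false

namespace FedQ

noncomputable section

/-! ### Expectations under a law on a finite type. -/

section PMFSums

variable {S T : Type*} [Fintype S] [Fintype T]

theorem sum_comm_four {A B : Type*} [Fintype A] [Fintype B] (F : S → A → B → T → ℝ) :
    ∑ y, ∑ a, ∑ b, ∑ z, F y a b z = ∑ b, ∑ z, ∑ y, ∑ a, F y a b z := by
  calc ∑ y, ∑ a, ∑ b, ∑ z, F y a b z = ∑ y, ∑ b, ∑ a, ∑ z, F y a b z :=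
        Finset.sum_congr rfl fun y _ => Finset.sum_comm
    _ = ∑ b, ∑ y, ∑ a, ∑ z, F y a b z := Finset.sum_comm
    _ = ∑ b, ∑ y, ∑ z, ∑ a, F y a b z :=
        Finset.sum_congr rfl fun b _ => Finset.sum_congr rfl fun y _ => Finset.sum_comm
    _ = ∑ b, ∑ z, ∑ y, ∑ a, F y a b z :=
        Finset.sum_congr rfl fun b _ => Finset.sum_comm

theorem pmf_sum_toReal (p : PMF S) : ∑ s, (p s).toReal = 1 := by
  rw [← ENNReal.toReal_sum (fun s _ => p.apply_ne_top s), ← tsum_fintype (L := .unconditional _),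
    p.tsum_coe]
  rfl

theorem pmf_bind_toReal (p : PMF S) (f : S → PMF T) (t : T) :
    ((p.bind f) t).toReal = ∑ s, (p s).toReal * (f s t).toReal := by
  rw [PMF.bind_apply, tsum_fintype, ENNReal.toReal_sum
    (fun s _ => ENNReal.mul_ne_top (p.apply_ne_top s) ((f s).apply_ne_top t))]
  simp [ENNReal.toReal_mul]

theorem pmf_sum_mul_le (p : PMF S) {f : S → ℝ} {c : ℝ} (hf : ∀ s, f s ≤ c) :
    ∑ s, (p s).toReal * f s ≤ c := by
  calc ∑ s, (p s).toReal * f s ≤ ∑ s, (p s).toReal * c :=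
        Finset.sum_le_sum fun s _ => mul_le_mul_of_nonneg_left (hf s) ENNReal.toReal_nonneg
    _ = c := by rw [← Finset.sum_mul, pmf_sum_toReal, one_mul]

theorem pmf_sum_mul_mono (p : PMF S) {f g : S → ℝ} (hf : ∀ s, f s ≤ g s) :
    ∑ s, (p s).toReal * f s ≤ ∑ s, (p s).toReal * g s :=
  Finset.sum_le_sum fun s _ => mul_le_mul_of_nonneg_left (hf s) ENNReal.toReal_nonneg

theorem pmf_sum_mul_nonneg (p : PMF S) {f : S → ℝ} (hf : ∀ s, 0 ≤ f s) :
    0 ≤ ∑ s, (p s).toReal * f s :=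
  Finset.sum_nonneg fun s _ => mul_nonneg ENNReal.toReal_nonneg (hf s)

theorem pmf_sum_pure [DecidableEq S] (s₀ : S) (f : S → ℝ) :
    ∑ s, ((PMF.pure s₀) s).toReal * f s = f s₀ := by
  rw [Finset.sum_eq_single s₀]
  · simp
  · intro s _ hs; simp [PMF.pure_apply, hs]
  · simp

end PMFSums

/-! ### Bellman equations and the optimal value. -/

namespace MDP

variable {S A : Type*} (mdp : MDP S A)

/-- `stateLaw` is built by appending the last transition; the Bellman equation needs the first one
split off instead. -/
theorem stateLaw_succ' (pol : ℕ → S → PMF A) (i : ℕ) : ∀ (h : ℕ) (x : S),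
    mdp.stateLaw pol h x (i + 1) =
      (pol h x).bind fun a => (mdp.P h x a).bind fun y => mdp.stateLaw pol (h + 1) y i := by
  induction i with
  | zero => intro h x; simp [stateLaw]
  | succ i ih =>
    intro h x
    have e : h + (i + 1) = h + 1 + i := by omega
    conv_lhs => rw [stateLaw, ih]
    simp only [PMF.bind_bind, e]
    simp only [stateLaw]

variable [Fintype S] [Fintype A]

/-- The return of the action `a` when the values of the next states are given by `V`. -/
def lookahead (V : S → ℝ) (h : ℕ) (x : S) (a : A) : ℝ :=
  mdp.r h x a + ∑ y, (mdp.P h x a y).toReal * V y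

theorem value_of_le (pol : ℕ → S → PMF A) {h : ℕ} (hh : mdp.H ≤ h) (x : S) :
    mdp.value pol h x = 0 := by
  simp [value, Nat.sub_eq_zero_of_le hh]

theorem value_bellman (pol : ℕ → S → PMF A) {h : ℕ} (hh : h < mdp.H) (x : S) :
    mdp.value pol h x = ∑ a, (pol h x a).toReal * mdp.lookahead (mdp.value pol (h + 1)) h x a := by
  classical
  have e : mdp.H - h = (mdp.H - (h + 1)) + 1 := by omega
  have e2 : ∀ i, h + (i + 1) = h + 1 + i := fun i => by omega
  unfold value
  rw [e, Finset.sum_range_succ']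
  have h0 : ∑ y, ∑ a, (mdp.stateLaw pol h x 0 y).toReal * (pol (h + 0) y a).toReal
      * mdp.r (h + 0) y a = ∑ a, (pol h x a).toReal * mdp.r h x a := by
    have := pmf_sum_pure x (fun y => ∑ a, (pol h y a).toReal * mdp.r h y a)
    simp only [Finset.mul_sum, ← mul_assoc] at this
    simpa [stateLaw] using this
  rw [h0]
  have h1 : ∀ i, ∑ y, ∑ a, (mdp.stateLaw pol h x (i + 1) y).toReal
      * (pol (h + (i + 1)) y a).toReal * mdp.r (h + (i + 1)) y a
      = ∑ b, (pol h x b).toReal * ∑ z, (mdp.P h x b z).toReal *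
        ∑ y, ∑ a, (mdp.stateLaw pol (h + 1) z i y).toReal
      * (pol (h + 1 + i) y a).toReal * mdp.r (h + 1 + i) y a := by
    intro i
    rw [stateLaw_succ', e2 i]
    simp only [pmf_bind_toReal, Finset.sum_mul, Finset.mul_sum]
    rw [sum_comm_four]
    refine Finset.sum_congr rfl fun b _ => Finset.sum_congr rfl fun z _ =>
      Finset.sum_congr rfl fun y _ => Finset.sum_congr rfl fun a _ => ?_
    ring
  simp only [h1]
  rw [Finset.sum_comm, add_comm, ← Finset.sum_add_distrib]
  refine Finset.sum_congr rfl fun b _ => ?_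
  rw [← Finset.mul_sum, ← mul_add, lookahead, Finset.sum_comm]
  congr 2
  refine Finset.sum_congr rfl fun z _ => ?_
  rw [← Finset.mul_sum]

variable [Nonempty A]

/-- The optimal values with `n` steps to go. -/
def dp : ℕ → S → ℝ
  | 0 => fun _ => 0
  | n + 1 => fun x => ⨆ a, mdp.lookahead (dp n) (mdp.H - (n + 1)) x a

theorem exists_dp_succ (n : ℕ) (x : S) :
    ∃ a, mdp.dp (n + 1) x = mdp.lookahead (mdp.dp n) (mdp.H - (n + 1)) x a := by
  obtain ⟨a, ha⟩ := exists_eq_ciSup_of_finite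
    (f := fun a => mdp.lookahead (mdp.dp n) (mdp.H - (n + 1)) x a)
  exact ⟨a, ha.symm⟩

theorem lookahead_le_dp (n : ℕ) (x : S) (a : A) :
    mdp.lookahead (mdp.dp n) (mdp.H - (n + 1)) x a ≤ mdp.dp (n + 1) x :=
  le_ciSup (f := fun a => mdp.lookahead (mdp.dp n) (mdp.H - (n + 1)) x a)
    (Set.finite_range _).bddAbove a

theorem lookahead_mono {V W : S → ℝ} (hVW : ∀ y, V y ≤ W y) (h : ℕ) (x : S) (a : A) :
    mdp.lookahead V h x a ≤ mdp.lookahead W h x a :=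
  add_le_add_right (pmf_sum_mul_mono _ hVW) _

theorem dp_mem (n : ℕ) : ∀ x, 0 ≤ mdp.dp n x ∧ mdp.dp n x ≤ n := by
  induction n with
  | zero => intro x; simp [dp]
  | succ n ih =>
    intro x
    obtain ⟨a, ha⟩ := mdp.exists_dp_succ n x
    rw [ha, lookahead]
    have h1 := mdp.r_nonneg (mdp.H - (n + 1)) x a
    have h2 := mdp.r_le_one (mdp.H - (n + 1)) x a
    have h3 := pmf_sum_mul_nonneg (mdp.P (mdp.H - (n + 1)) x a) (fun s => (ih s).1)
    have h4 := pmf_sum_mul_le (mdp.P (mdp.H - (n + 1)) x a) (fun s => (ih s).2)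
    push_cast
    constructor <;> linarith

theorem value_le_dp (pol : ℕ → S → PMF A) (n : ℕ) (hn : n ≤ mdp.H) :
    ∀ x, mdp.value pol (mdp.H - n) x ≤ mdp.dp n x := by
  induction n with
  | zero => intro x; rw [value_of_le _ _ (by omega)]; simp [dp]
  | succ n ih =>
    intro x
    rw [value_bellman _ _ (by omega)]
    refine pmf_sum_mul_le _ fun a => le_trans (mdp.lookahead_mono (fun y => ?_) _ x a)
      (mdp.lookahead_le_dp n x a)
    have := ih (by omega) y
    rwa [show mdp.H - (n + 1) + 1 = mdp.H - n by omega]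

/-- The greedy policy of backward induction is optimal from all states and steps simultaneously. -/
theorem exists_value_eq_dp : ∃ pol : ℕ → S → PMF A, ∀ n ≤ mdp.H, ∀ x,
    mdp.value pol (mdp.H - n) x = mdp.dp n x := by
  classical
  choose act hact using mdp.exists_dp_succ
  -- `act n` is greedy with `n + 1` steps to go, and `H - h` steps remain at step `h`.
  refine ⟨detPolicy fun h x => act (mdp.H - (h + 1)) x, fun n => ?_⟩
  induction n with
  | zero => intro _ x; rw [value_of_le _ _ (by omega)]; simp [dp]
  | succ n ih =>
    intro hn x
    rw [value_bellman _ _ (by omega), detPolicy, pmf_sum_pure, hact,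
      show mdp.H - (mdp.H - (n + 1) + 1) = n by omega]
    unfold lookahead
    congr 1
    refine Finset.sum_congr rfl fun y _ => ?_
    rw [show mdp.H - (n + 1) + 1 = mdp.H - n by omega]
    exact congrArg _ (ih (by omega) y)

/-- Backward induction bounds the value of every randomized policy, which also makes the supremum a
bounded one, and the greedy policy attains the bound. -/
theorem optValue_eq_dp {h : ℕ} (hh : h ≤ mdp.H) (x : S) :
    mdp.optValue h x = mdp.dp (mdp.H - h) x := by
  have key : ∀ pol, mdp.value pol h x ≤ mdp.dp (mdp.H - h) x := fun pol => by
    have := mdp.value_le_dp pol (mdp.H - h) (by omega) x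
    rwa [show mdp.H - (mdp.H - h) = h by omega] at this
  obtain ⟨pol, hpol⟩ := mdp.exists_value_eq_dp
  have : mdp.value pol h x = mdp.dp (mdp.H - h) x := by
    rw [← hpol (mdp.H - h) (by omega), show mdp.H - (mdp.H - h) = h by omega]
  have _ : Nonempty (ℕ → S → PMF A) := ⟨pol⟩
  refine le_antisymm (ciSup_le key) ?_
  rw [← this]
  exact le_ciSup (f := fun pol => mdp.value pol h x) ⟨_, by rintro _ ⟨p, rfl⟩; exact key p⟩ pol

theorem optValue_of_le {h : ℕ} (hh : mdp.H ≤ h) (x : S) : mdp.optValue h x = 0 := by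
  have : Nonempty (ℕ → S → PMF A) := ⟨fun _ _ => PMF.pure (Classical.arbitrary A)⟩
  simp [optValue, value_of_le _ _ hh]

theorem value_le_optValue (pol : ℕ → S → PMF A) (h : ℕ) (x : S) :
    mdp.value pol h x ≤ mdp.optValue h x := by
  rcases le_total mdp.H h with hh | hh
  · rw [value_of_le _ _ hh, optValue_of_le _ hh]
  · rw [optValue_eq_dp _ hh]
    have := mdp.value_le_dp pol (mdp.H - h) (by omega) x
    rwa [show mdp.H - (mdp.H - h) = h by omega] at this

theorem optValue_succ {h : ℕ} (hh : h < mdp.H) :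
    mdp.optValue (h + 1) = mdp.dp (mdp.H - (h + 1)) :=
  funext fun y => mdp.optValue_eq_dp hh y

theorem lookahead_le_optValue {h : ℕ} (hh : h < mdp.H) (x : S) (a : A) :
    mdp.lookahead (mdp.optValue (h + 1)) h x a ≤ mdp.optValue h x := by
  have := mdp.lookahead_le_dp (mdp.H - (h + 1)) x a
  rw [show mdp.H - (mdp.H - (h + 1) + 1) = h by omega,
    show mdp.H - (h + 1) + 1 = mdp.H - h by omega] at this
  rwa [optValue_succ _ hh, optValue_eq_dp _ hh.le]

theorem exists_optValue_eq {h : ℕ} (hh : h < mdp.H) (x : S) :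
    ∃ a, mdp.optValue h x = mdp.lookahead (mdp.optValue (h + 1)) h x a := by
  obtain ⟨a, ha⟩ := mdp.exists_dp_succ (mdp.H - (h + 1)) x
  rw [show mdp.H - (mdp.H - (h + 1) + 1) = h by omega,
    show mdp.H - (h + 1) + 1 = mdp.H - h by omega] at ha
  exact ⟨a, by rw [optValue_succ _ hh, optValue_eq_dp _ hh.le, ha]⟩

theorem optValue_nonneg (h : ℕ) (x : S) : 0 ≤ mdp.optValue h x := by
  rcases le_total mdp.H h with hh | hh
  · rw [optValue_of_le _ hh]
  · rw [optValue_eq_dp _ hh]; exact (mdp.dp_mem _ x).1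

theorem optValue_le (h : ℕ) (x : S) : mdp.optValue h x ≤ mdp.H := by
  rcases le_total mdp.H h with hh | hh
  · rw [optValue_of_le _ hh]; positivity
  · rw [optValue_eq_dp _ hh]
    exact (mdp.dp_mem _ x).2.trans (by exact_mod_cast Nat.sub_le _ _)

theorem value_nonneg (pol : ℕ → S → PMF A) (h : ℕ) (x : S) : 0 ≤ mdp.value pol h x := by
  unfold value
  refine Finset.sum_nonneg fun i _ => Finset.sum_nonneg fun y _ => Finset.sum_nonneg fun a _ => ?_
  have := mdp.r_nonneg (h + i) y a
  positivity

theorem value_detPolicy (pol : ℕ → S → A) {h : ℕ} (hh : h < mdp.H) (x : S) :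
    mdp.value (detPolicy pol) h x
      = mdp.lookahead (mdp.value (detPolicy pol) (h + 1)) h x (pol h x) := by
  classical
  rw [value_bellman _ _ hh]
  exact pmf_sum_pure (pol h x) _

end MDP

end

end FedQ

namespace FedQ

noncomputable section

/-! ### Learning rates, sample weights and deterministic telescoping estimates. -/

section Rates

/-- The weight that the updates with the visit numbers `s + 1, …, t` leave to earlier values. -/
def keep (H s t : ℕ) : ℝ := ∏ l ∈ Finset.Ioc s t, (1 - lrate H l)

variable {H : ℕ}

theorem one_sub_lrate (H : ℕ) {t : ℕ} (ht : 1 ≤ t) : 1 - lrate H t = ((t : ℝ) - 1) / (H + t) := by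
  have : (0 : ℝ) < H + t := by positivity
  unfold lrate; field_simp; ring

theorem lrate_pos (H t : ℕ) (hH : 0 < H) : 0 < lrate H t := by unfold lrate; positivity

theorem one_sub_lrate_nonneg (H : ℕ) {t : ℕ} (ht : 1 ≤ t) : 0 ≤ 1 - lrate H t := by
  rw [one_sub_lrate H ht]
  have : (1 : ℝ) ≤ t := by exact_mod_cast ht
  exact div_nonneg (by linarith) (by positivity)

theorem keep_self (H s : ℕ) : keep H s s = 1 := by simp [keep]

theorem keep_succ (H : ℕ) {s t : ℕ} (hst : s ≤ t) :
    keep H s (t + 1) = keep H s t * (1 - lrate H (t + 1)) :=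
  Finset.prod_Ioc_succ_top hst _

theorem keep_mul_keep (H : ℕ) {s t u : ℕ} (hst : s ≤ t) (htu : t ≤ u) :
    keep H s t * keep H t u = keep H s u :=
  Finset.prod_Ioc_consecutive _ hst htu

theorem keep_nonneg (H s t : ℕ) : 0 ≤ keep H s t :=
  Finset.prod_nonneg fun l hl => one_sub_lrate_nonneg H (by simp at hl; omega)

theorem keep_le_one (s t : ℕ) (hH : 0 < H) : keep H s t ≤ 1 :=
  Finset.prod_le_one (fun l hl => one_sub_lrate_nonneg H (by simp at hl; omega))
    fun l _ => by linarith [lrate_pos H l hH]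

/-- Since `α_1 = 1`, the first update erases the initial value. -/
theorem keep_zero_left (H t : ℕ) : keep H 0 t = if t = 0 then 1 else 0 := by
  split_ifs with h
  · subst h; exact keep_self _ _
  · refine Finset.prod_eq_zero (i := 1) (by simp; omega) ?_
    rw [one_sub_lrate H le_rfl]; simp

theorem weight_eq (H t i : ℕ) : weight H t i = lrate H i * keep H i t := rfl

theorem weight_nonneg (t i : ℕ) (hH : 0 < H) : 0 ≤ weight H t i :=
  mul_nonneg (lrate_pos H i hH).le (keep_nonneg _ _ _)

theorem weight_mul_keep (H : ℕ) {i t u : ℕ} (hit : i ≤ t) (htu : t ≤ u) :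
    weight H t i * keep H t u = weight H u i := by
  rw [weight_eq, weight_eq, mul_assoc, keep_mul_keep H hit htu]

/-- After cancelling common factors this is `α_i (1 - α_{i+1}) ≤ α_{i+1}`: later samples count more.
The Abel summation rests on this monotonicity. -/
theorem weight_le_succ {t i : ℕ} (hH : 0 < H) (hit : i < t) :
    weight H t i ≤ weight H t (i + 1) := by
  have h1 : keep H i t = (1 - lrate H (i + 1)) * keep H (i + 1) t := by
    rw [← keep_mul_keep H (show i ≤ i + 1 by omega) hit, keep_succ H le_rfl, keep_self, one_mul]
  rw [weight_eq, weight_eq, h1, ← mul_assoc]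
  refine mul_le_mul_of_nonneg_right ?_ (keep_nonneg _ _ _)
  rw [one_sub_lrate H (by omega)]
  have hH' : (0 : ℝ) < H := by exact_mod_cast hH
  unfold lrate
  push_cast
  rw [div_mul_div_comm, div_le_div_iff₀ (by positivity) (by positivity)]
  have : (0 : ℝ) ≤ i := by positivity
  have h2 : 0 ≤ ((H : ℝ) + 1) * (H + (i + 1)) * H := by positivity
  linarith

theorem weight_mono {t i j : ℕ} (hH : 0 < H) (hij : i ≤ j) (hjt : j ≤ t) :
    weight H t i ≤ weight H t j := by
  induction j, hij using Nat.le_induction with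
  | base => exact le_rfl
  | succ j hij ih => exact (ih (by omega)).trans (weight_le_succ hH (by omega))

theorem weight_self (H t : ℕ) : weight H t t = lrate H t := by
  rw [weight_eq, keep_self, mul_one]

theorem weight_le_lrate {t i : ℕ} (hH : 0 < H) (hit : i ≤ t) : weight H t i ≤ lrate H t := by
  rw [← weight_self]; exact weight_mono hH hit le_rfl

theorem weight_succ (H : ℕ) {t i : ℕ} (hit : i ≤ t) :
    weight H (t + 1) i = (1 - lrate H (t + 1)) * weight H t i := by
  rw [weight_eq, weight_eq, keep_succ H hit]; ring

theorem sum_weight (H : ℕ) {s t : ℕ} (hst : s ≤ t) :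
    ∑ i ∈ Finset.Ioc s t, weight H t i = 1 - keep H s t := by
  induction t, hst using Nat.le_induction with
  | base => simp [keep_self]
  | succ t hst ih =>
    rw [← Finset.insert_Ioc_right_eq_Ioc_add_one hst, Finset.sum_insert (by simp), weight_self,
      Finset.sum_congr rfl fun i hi => weight_succ H (by simp at hi; omega), ← Finset.mul_sum, ih,
      keep_succ H hst]
    ring

/-- Induction on `t`: the weighted sum obeys the same recursion as the updates, so it suffices that
one update preserves the bound `2 / √t`. -/
theorem sum_weight_div_sqrt_le (t : ℕ) (hH : 0 < H) :
    ∑ i ∈ Finset.Ioc 0 t, weight H t i * (1 / Real.sqrt i) ≤ 2 * (1 / Real.sqrt t) := by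
  induction t with
  | zero => simp
  | succ t ih =>
    rw [← Finset.insert_Ioc_right_eq_Ioc_add_one (by omega), Finset.sum_insert (by simp),
      weight_self, Finset.sum_congr rfl fun i hi => by
        rw [weight_succ H (show i ≤ t by simp at hi; omega), mul_assoc], ← Finset.mul_sum]
    have h1 := mul_le_mul_of_nonneg_left ih (one_sub_lrate_nonneg H (show 1 ≤ t + 1 by omega))
    refine (add_le_add_right h1 _).trans ?_
    rw [one_sub_lrate H (by omega), lrate]
    have hH' : (0 : ℝ) < H := by exact_mod_cast hH
    have ht1 : (0 : ℝ) < t + 1 := by positivity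
    push_cast
    set s := Real.sqrt t
    set u := Real.sqrt ((t : ℝ) + 1)
    have hu : 0 < u := Real.sqrt_pos.2 ht1
    have hs : 0 ≤ s := Real.sqrt_nonneg _
    have hu2 : u * u = t + 1 := Real.mul_self_sqrt ht1.le
    have hs2 : s * s = t := Real.mul_self_sqrt (by positivity)
    -- For `t = 0` both sides vanish, because division by zero gives zero.
    have e : ((t : ℝ) + 1 - 1) / (H + (t + 1)) * (2 * (1 / s)) = 2 * s / (H + (t + 1)) := by
      rcases hs.eq_or_lt with h0 | h0
      · rw [← h0] at hs2 ⊢; simp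
      · rw [← hs2]; field_simp; ring
    rw [e]
    have hD : (0 : ℝ) < H + (t + 1) := by positivity
    have : ((H : ℝ) + 1) / (H + (t + 1)) * (1 / u) + 2 * s / (H + (t + 1))
        = (H + 1 + 2 * s * u) / (H + (t + 1)) * (1 / u) := by field_simp
    rw [this]
    refine mul_le_mul_of_nonneg_right ?_ (by positivity)
    rw [div_le_iff₀ hD]
    -- What remains is `2 s u ≤ s² + u² = 2 t + 1`.
    nlinarith [sq_nonneg (s - u)]

/-- The weights have total mass one and `1 / √i ≥ 1 / √t`. This is the lower bound on the bonus that
has to beat the noise. -/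
theorem div_sqrt_le_sum_weight (t : ℕ) (hH : 0 < H) (ht : 1 ≤ t) :
    1 / Real.sqrt t ≤ ∑ i ∈ Finset.Ioc 0 t, weight H t i * (1 / Real.sqrt i) := by
  have h1 : ∑ i ∈ Finset.Ioc 0 t, weight H t i = 1 := by
    rw [sum_weight H (by omega), keep_zero_left, if_neg (by omega), sub_zero]
  calc 1 / Real.sqrt t = ∑ i ∈ Finset.Ioc 0 t, weight H t i * (1 / Real.sqrt t) := by
        rw [← Finset.sum_mul, h1, one_mul]
    _ ≤ _ := by
        refine Finset.sum_le_sum fun i hi => mul_le_mul_of_nonneg_left ?_ (weight_nonneg _ _ hH)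
        simp only [Finset.mem_Ioc] at hi
        have : (0 : ℝ) < i := by exact_mod_cast hi.1
        exact one_div_le_one_div_of_le (Real.sqrt_pos.2 this)
          (Real.sqrt_le_sqrt (by exact_mod_cast hi.2))

/-- The total weight `1 + (1 - α_{N + 1}) + (1 - α_{N + 1}) (1 - α_{N + 2}) + …`. -/
def tailWeight (H N : ℕ) : ℝ := ((H : ℝ) + N) / H

theorem tailWeight_nonneg (H N : ℕ) : 0 ≤ tailWeight H N := by unfold tailWeight; positivity

theorem lrate_mul_tailWeight (N : ℕ) (hH : 0 < H) : lrate H N * tailWeight H N = 1 + 1 / H := by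
  have hH' : (0 : ℝ) < H := by exact_mod_cast hH
  unfold lrate tailWeight; field_simp

theorem tailWeight_eq (N : ℕ) (hH : 0 < H) :
    tailWeight H N = 1 + (1 - lrate H (N + 1)) * tailWeight H (N + 1) := by
  have hH' : (0 : ℝ) < H := by exact_mod_cast hH
  rw [one_sub_lrate H (by omega), tailWeight, tailWeight]; push_cast; field_simp; ring

/-- Over the next `n` visits the potential loses exactly the sum of the survival factors `keep`;
iterate `tailWeight_eq`. -/
theorem tailWeight_sub (N n : ℕ) (hH : 0 < H) :
    tailWeight H N - keep H N (N + n) * tailWeight H (N + n)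
      = ∑ i ∈ Finset.range n, keep H N (N + i) := by
  induction n with
  | zero => simp [keep_self]
  | succ n ih =>
    rw [Finset.sum_range_succ, ← ih, tailWeight_eq (N + n) hH, ← add_assoc,
      keep_succ H (show N ≤ N + n by omega)]
    ring

theorem keep_ge (N n : ℕ) (hH : 0 < H) :
    1 - n * (((H : ℝ) + 1) / (H + N)) ≤ keep H N (N + n) := by
  have hH' : (0 : ℝ) < H := by exact_mod_cast hH
  induction n with
  | zero => simp [keep_self]
  | succ n ih =>
    rw [← add_assoc, keep_succ H (by omega)]
    have h1 : lrate H (N + n + 1) ≤ ((H : ℝ) + 1) / (H + N) := by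
      unfold lrate; push_cast
      gcongr
      linarith [show (0 : ℝ) ≤ n by positivity]
    have h2 := keep_le_one N (N + n) hH
    have h3 := keep_nonneg H N (N + n)
    have h4 := lrate_pos H (N + n + 1) hH
    push_cast
    nlinarith

theorem tailWeight_sub_nonneg (N n : ℕ) (hH : 0 < H) :
    0 ≤ tailWeight H N - keep H N (N + n) * tailWeight H (N + n) := by
  rw [tailWeight_sub N n hH]; exact Finset.sum_nonneg fun _ _ => keep_nonneg _ _ _

/-- In a short round the survival factors are nearly one: their sum is at least `n (1 - 1 / (2 H))`,
by the Bernoulli-type bound `keep_ge`, and `(1 + 1 / H) (1 - 1 / (2 H)) ≥ 1`. Hence the drop of the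
potential pays for all `n` visits of the round. -/
theorem le_tailWeight_sub {N n : ℕ} (hH : 0 < H) (h : n ≤ 1 ∨ n * (H * (H + 1)) ≤ N) :
    (n : ℝ) ≤ (1 + 1 / H) * (tailWeight H N - keep H N (N + n) * tailWeight H (N + n)) := by
  have hH' : (1 : ℝ) ≤ H := by exact_mod_cast hH
  rw [tailWeight_sub N n hH]
  by_cases hn : n ≤ 1
  · interval_cases n
    · simp
    · simp [keep_self]
  push Not at hn
  have h' : (n : ℝ) * (H * (H + 1)) ≤ N := by
    rcases h with h | h
    · omega
    · exact_mod_cast h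
  have h1 : ∑ i ∈ Finset.range n, (1 - (i : ℝ) * (((H : ℝ) + 1) / (H + N)))
      = n - (n : ℝ) * (n - 1) / 2 * ((H + 1) / (H + N)) := by
    rw [Finset.sum_sub_distrib, ← Finset.sum_mul]
    have : ∑ i ∈ Finset.range n, (i : ℝ) = (n : ℝ) * (n - 1) / 2 := by
      have := Finset.sum_range_id_mul_two n
      have h2 : (((∑ i ∈ Finset.range n, i) * 2 : ℕ) : ℝ) = ((n * (n - 1) : ℕ) : ℝ) := by rw [this]
      push_cast [Nat.cast_sub hn.le] at h2
      linarith
    rw [this]; simp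
  have h2 : ∑ i ∈ Finset.range n, (1 - (i : ℝ) * (((H : ℝ) + 1) / (H + N)))
      ≤ ∑ i ∈ Finset.range n, keep H N (N + i) := Finset.sum_le_sum fun i _ => keep_ge N i hH
  rw [h1] at h2
  have hn' : (1 : ℝ) < n := by exact_mod_cast hn
  have h3 : ((n : ℝ) - 1) * ((H + 1) / (H + N)) ≤ 1 / H := by
    rw [mul_div_assoc', div_le_div_iff₀ (by positivity) (by positivity)]
    nlinarith
  have h4 : (n : ℝ) * (1 - 1 / (2 * H)) ≤ ∑ i ∈ Finset.range n, keep H N (N + i) := by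
    refine le_trans ?_ h2
    have e : (n : ℝ) * (1 - 1 / (2 * H)) = n - n / 2 * (1 / H) := by field_simp
    have := mul_le_mul_of_nonneg_left h3 (show (0 : ℝ) ≤ n / 2 by positivity)
    rw [e]; linarith
  have h5 : (1 : ℝ) ≤ (1 + 1 / H) * (1 - 1 / (2 * H)) := by
    have e : (1 + 1 / (H : ℝ)) * (1 - 1 / (2 * H)) = 1 + (H - 1) / (2 * H ^ 2) := by
      field_simp; ring
    rw [e]
    have : (0 : ℝ) ≤ (H - 1) / (2 * H ^ 2) := div_nonneg (by linarith) (by positivity)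
    linarith
  calc (n : ℝ) ≤ n * ((1 + 1 / H) * (1 - 1 / (2 * H))) := by nlinarith
    _ = (1 + 1 / H) * (n * (1 - 1 / (2 * H))) := by ring
    _ ≤ _ := mul_le_mul_of_nonneg_left h4 (by positivity)

/-- The increments of `W` are nonnegative, so the bound on `S` can be inserted termwise. Linearizing
the square root leaves two sums that telescope: `∑ (ΔW) (N - i) = ∑ W ≤ 1` and `∑ ΔW = W N ≤ α_N`.
-/
theorem abs_abel_sum_le {N : ℕ} {W S : ℕ → ℝ} {L : ℝ} (hH : 0 < H) (hN : 0 < N) (hL : 0 ≤ L)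
    (hW0 : W 0 = 0) (hW : ∀ i < N, W i ≤ W (i + 1)) (hWN : W N ≤ lrate H N)
    (hsum : ∑ i ∈ Finset.Ioc 0 N, W i ≤ 1)
    (hS : ∀ i < N, |S i| ≤ L * Real.sqrt ((N : ℝ) - i)) :
    |∑ i ∈ Finset.range N, (W (i + 1) - W i) * S i| ≤ 3 / 2 * L * Real.sqrt (H / N) := by
  have hH' : (1 : ℝ) ≤ H := by exact_mod_cast hH
  have hN' : (0 : ℝ) < N := by exact_mod_cast hN
  have habel : ∀ n ≤ N, ∑ i ∈ Finset.range n, (W (i + 1) - W i) * ((N : ℝ) - i)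
      = ∑ i ∈ Finset.Ioc 0 n, W i + W n * (N - n) := by
    intro n
    induction n with
    | zero => simp [hW0]
    | succ n ih =>
      intro hn
      rw [Finset.sum_range_succ, ih (by omega), ← Finset.insert_Ioc_right_eq_Ioc_add_one (by omega),
        Finset.sum_insert (by simp)]
      push_cast; ring
  have htel : ∑ i ∈ Finset.range N, (W (i + 1) - W i) = W N := by
    rw [Finset.sum_range_sub, hW0, sub_zero]
  set q := Real.sqrt ((H : ℝ) / N)
  have hq : 0 < q := Real.sqrt_pos.2 (by positivity)
  have hq2 : q * q = H / N := Real.mul_self_sqrt (by positivity)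
  -- AM-GM; the scale `q = √(H / N)` balances the two sums, whose bounds are `1` and about `H / N`.
  have hsq : ∀ i < N, Real.sqrt ((N : ℝ) - i) ≤ (((N : ℝ) - i) * q + 1 / q) / 2 := by
    intro i hi
    have hpos : (0 : ℝ) ≤ (N : ℝ) - i := by
      have : (i : ℝ) < N := by exact_mod_cast hi
      linarith
    set s := Real.sqrt ((N : ℝ) - i)
    have hs : s * s = (N : ℝ) - i := Real.mul_self_sqrt hpos
    rw [← hs]
    have : (s * s * q + 1 / q) / 2 - s = (s * q - 1) ^ 2 / (2 * q) := by field_simp; ring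
    have h2 : 0 ≤ (s * q - 1) ^ 2 / (2 * q) := by positivity
    linarith
  calc |∑ i ∈ Finset.range N, (W (i + 1) - W i) * S i|
      ≤ ∑ i ∈ Finset.range N, |(W (i + 1) - W i) * S i| := Finset.abs_sum_le_sum_abs _ _
    _ ≤ ∑ i ∈ Finset.range N, (W (i + 1) - W i) * (L * ((((N : ℝ) - i) * q + 1 / q) / 2)) := by
        refine Finset.sum_le_sum fun i hi => ?_
        have hi' := Finset.mem_range.1 hi
        have h0 : 0 ≤ W (i + 1) - W i := by linarith [hW i hi']
        rw [abs_mul, abs_of_nonneg h0]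
        refine mul_le_mul_of_nonneg_left ((hS i hi').trans ?_) h0
        exact mul_le_mul_of_nonneg_left (hsq i hi') hL
    _ = L / 2 * (q * ∑ i ∈ Finset.range N, (W (i + 1) - W i) * ((N : ℝ) - i)
          + 1 / q * ∑ i ∈ Finset.range N, (W (i + 1) - W i)) := by
        rw [Finset.mul_sum, Finset.mul_sum, ← Finset.sum_add_distrib, Finset.mul_sum]
        refine Finset.sum_congr rfl fun i _ => ?_
        ring
    _ ≤ L / 2 * (q * 1 + 2 * q) := by
        rw [habel N le_rfl, htel, sub_self, mul_zero, add_zero]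
        refine mul_le_mul_of_nonneg_left (add_le_add (mul_le_mul_of_nonneg_left hsum hq.le) ?_)
          (by positivity)
        -- `α_N ≤ 2 H / N`, by `H ≥ 1`.
        have h3 : lrate H N ≤ 2 * (q * q) := by
          rw [hq2, lrate, mul_div_assoc', div_le_div_iff₀ (by positivity) hN']
          nlinarith
        rw [one_div, inv_mul_le_iff₀ hq]
        linarith
    _ = 3 / 2 * L * q := by ring

/-- If `n ≤ N`, the increment of `√N` pays for the round. Otherwise the count more than doubles, so
`1 / √N` drops by a fixed fraction, and `n ≤ M ≤ 2 (M - 1)` lets this drop pay. -/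
theorem div_sqrt_le_telescope {M N n : ℕ} (hM : 0 < M) (hN : 0 < N) (h : n ≤ N ∨ (n ≤ M ∧ 2 ≤ M)) :
    (n : ℝ) * (1 / Real.sqrt N) ≤ 5 / 2 * (Real.sqrt ((N + n : ℕ) : ℝ) - Real.sqrt N)
      + 7 * ((M : ℝ) - 1) * (1 / Real.sqrt N - 1 / Real.sqrt ((N + n : ℕ) : ℝ)) := by
  have hN' : (0 : ℝ) < N := by exact_mod_cast hN
  have hM' : (1 : ℝ) ≤ M := by exact_mod_cast hM
  set s := Real.sqrt N
  set u := Real.sqrt ((N + n : ℕ) : ℝ)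
  have hs : 0 < s := Real.sqrt_pos.2 hN'
  have hs2 : s * s = N := Real.mul_self_sqrt hN'.le
  have hu2 : u * u = N + n := by
    have := Real.mul_self_sqrt (show (0 : ℝ) ≤ ((N + n : ℕ) : ℝ) by positivity)
    push_cast at this; simpa [u] using this
  have hsu : s ≤ u := Real.sqrt_le_sqrt (by push_cast; linarith [show (0 : ℝ) ≤ n by positivity])
  have hu : 0 < u := by linarith
  have hd : 0 ≤ 1 / s - 1 / u := sub_nonneg.2 (one_div_le_one_div_of_le hs hsu)
  have hn : (n : ℝ) = u * u - s * s := by linarith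
  by_cases hc : n ≤ N
  · have hc' : (n : ℝ) ≤ N := by exact_mod_cast hc
    have h1 : u ≤ 3 / 2 * s := by nlinarith
    have h2 : (n : ℝ) * (1 / s) ≤ 5 / 2 * (u - s) := by
      rw [mul_one_div, div_le_iff₀ hs, hn]; nlinarith
    have h3 : 0 ≤ 7 * ((M : ℝ) - 1) * (1 / s - 1 / u) := mul_nonneg (by linarith) hd
    linarith
  · have hc' : (N : ℝ) < n := by exact_mod_cast not_le.1 hc
    obtain ⟨h1, h2⟩ := h.resolve_left hc
    have h1' : (n : ℝ) ≤ M := by exact_mod_cast h1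
    have h2' : (2 : ℝ) ≤ M := by exact_mod_cast h2
    -- `N + n > 2 N`, and `(7 / 5)² < 2`.
    have h3 : 7 / 5 * s ≤ u := by
      by_contra hh; push Not at hh; nlinarith
    have h4 : 2 / 7 * (1 / s) ≤ 1 / s - 1 / u := by
      have : 1 / u ≤ 1 / (7 / 5 * s) := one_div_le_one_div_of_le (by positivity) h3
      have e : 1 / (7 / 5 * s) = 5 / 7 * (1 / s) := by field_simp
      linarith
    have h5 : (n : ℝ) * (1 / s) ≤ 7 * ((M : ℝ) - 1) * (2 / 7 * (1 / s)) := by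
      have : 0 < 1 / s := by positivity
      nlinarith
    have h6 := mul_le_mul_of_nonneg_left h4 (show 0 ≤ 7 * ((M : ℝ) - 1) by linarith)
    linarith

end Rates

end

end FedQ

/-! ### The visits within one round and the end of the round. -/

namespace FedQ

noncomputable section

/-- The ranks of the elements of `s` run once through `1, …, card s`. -/
theorem sum_rank {ι R : Type*} [LinearOrder ι] [AddCommMonoid R] (f : ℕ → R) (c : ℕ) (s : Finset ι) :
    ∑ m ∈ s, f (c + (s.filter (· ≤ m)).card) = ∑ i ∈ Finset.Ioc c (c + s.card), f i := by
  induction s using Finset.induction_on_max with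
  | empty => simp
  | insert a s hs ih =>
    have ha : a ∉ s := fun h => lt_irrefl _ (hs a h)
    rw [Finset.sum_insert ha, Finset.card_insert_of_notMem ha, ← add_assoc,
      ← Finset.insert_Ioc_right_eq_Ioc_add_one (by omega), Finset.sum_insert (by simp), ← ih]
    congr 1
    · congr 1
      rw [Finset.filter_true_of_mem, Finset.card_insert_of_notMem ha, add_assoc]
      intro m hm
      rcases Finset.mem_insert.1 hm with rfl | h
      · exact le_rfl
      · exact (hs m h).le
    · refine Finset.sum_congr rfl fun m hm => ?_
      rw [Finset.filter_insert, if_neg (not_le.2 (hs m hm))]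

section Round

variable {S A : Type*} [Fintype S] [Fintype A] [DecidableEq S] [DecidableEq A]
variable (mdp : MDP S A) (inp : Input S A) (b : ℕ → ℝ)
variable (st : Server S A) (w : ℕ → Fin inp.M → ℕ → S)

/-- Agent `m` visits `(h, x, a)` in the `j`-th episode of the round. -/
abbrev Hit (j : ℕ) (m : Fin inp.M) (h : ℕ) (x : S) (a : A) : Prop :=
  w j m h = x ∧ st.policy h (w j m h) = a

theorem visits_zero (m : Fin inp.M) (h : ℕ) (x : S) (a : A) :
    visits inp st w 0 m h x a = 0 := by simp [visits]

theorem visits_succ (j : ℕ) (m : Fin inp.M) (h : ℕ) (x : S) (a : A) :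
    visits inp st w (j + 1) m h x a
      = visits inp st w j m h x a + if Hit inp st w j m h x a then 1 else 0 := by
  unfold visits
  rw [Finset.range_add_one, Finset.filter_insert]
  split_ifs with h1 <;> simp

theorem visits_mono {i j : ℕ} (hij : i ≤ j) (m : Fin inp.M) (h : ℕ) (x : S) (a : A) :
    visits inp st w i m h x a ≤ visits inp st w j m h x a :=
  Finset.card_le_card (Finset.filter_subset_filter _ (Finset.range_subset_range.2 hij))

theorem visits_eq_sum {R : Type*} [AddCommMonoidWithOne R]
    (n : ℕ) (m : Fin inp.M) (h : ℕ) (x : S) (a : A) :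
    (visits inp st w n m h x a : R)
      = ∑ j ∈ Finset.range n, if Hit inp st w j m h x a then (1 : R) else 0 := by
  simp [visits, Finset.sum_boole]

theorem totalVisits_eq_sum (n h : ℕ) (x : S) (a : A) :
    (totalVisits inp st w n h x a : ℝ)
      = ∑ j ∈ Finset.range n, ∑ m, if Hit inp st w j m h x a then (1 : ℝ) else 0 := by
  rw [totalVisits, Nat.cast_sum, Finset.sum_comm]
  exact Finset.sum_congr rfl fun m _ => visits_eq_sum inp st w n m h x a

/-- The number of the visit of `(h, x, a)` by agent `m` in episode `j` of the round, when all
visits of the run are ordered by round, episode and agent. -/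
def position (j : ℕ) (m : Fin inp.M) (h : ℕ) (x : S) (a : A) : ℕ :=
  st.N h x a + totalVisits inp st w j h x a
    + (((Finset.univ : Finset (Fin inp.M)).filter fun m' => Hit inp st w j m' h x a).filter
        (· ≤ m)).card

theorem totalVisits_succ (j h : ℕ) (x : S) (a : A) :
    totalVisits inp st w (j + 1) h x a = totalVisits inp st w j h x a
      + ((Finset.univ : Finset (Fin inp.M)).filter fun m' => Hit inp st w j m' h x a).card := by
  simp only [totalVisits, visits_succ, Finset.sum_add_distrib]
  simp

/-- `position` enumerates the visits of the round without gaps or repetitions, so sums over visits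
of functions of the visit number become sums over an interval. -/
theorem sum_position {R : Type*} [AddCommMonoid R] (f : ℕ → R) (n h : ℕ) (x : S) (a : A) :
    ∑ j ∈ Finset.range n, ∑ m, (if Hit inp st w j m h x a then
        f (position inp st w j m h x a) else 0)
      = ∑ i ∈ Finset.Ioc (st.N h x a) (newN inp st w n h x a), f i := by
  induction n with
  | zero => simp [newN, totalVisits, visits_zero]
  | succ n ih =>
    rw [Finset.sum_range_succ, ih, ← Finset.sum_filter]
    have := sum_rank f (st.N h x a + totalVisits inp st w n h x a)
      ((Finset.univ : Finset (Fin inp.M)).filter fun m' => Hit inp st w n m' h x a)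
    unfold position
    rw [this, newN, newN, totalVisits_succ, ← add_assoc]
    exact Finset.sum_Ioc_consecutive _ (by omega) (by omega)

theorem sum_hit (f : Fin inp.M → ℕ → S → A → ℝ) (j h : ℕ) :
    ∑ x, ∑ a, ∑ m, (if Hit inp st w j m h x a then f m h x a else 0)
      = ∑ m, f m h (w j m h) (st.policy h (w j m h)) := by
  calc _ = ∑ m, ∑ x, ∑ a, (if Hit inp st w j m h x a then f m h x a else 0) := by
        simp_rw [Finset.sum_comm (s := (Finset.univ : Finset A))]
        rw [Finset.sum_comm]
    _ = _ := by
        refine Finset.sum_congr rfl fun m _ => ?_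
        rw [Finset.sum_eq_single (w j m h), Finset.sum_eq_single (st.policy h (w j m h))]
        · simp
        · intro a _ ha; rw [if_neg]; exact fun hc => ha hc.2.symm
        · simp
        · intro x _ hx
          exact Finset.sum_eq_zero fun a _ => by rw [if_neg]; exact fun hc => hx hc.1.symm
        · simp

theorem abort_mono {i j : ℕ} (hij : i ≤ j) (hi : Abort mdp inp st w i) :
    Abort mdp inp st w j := by
  obtain ⟨m, h, x, a, hh, hv⟩ := hi
  exact ⟨m, h, x, a, hh, hv.trans (visits_mono inp st w hij m h x a)⟩

/-- Pigeonhole for one agent at the first step: among `S * T₀` episodes some initial state occurs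
`T₀` times, always with the action of the policy, and the threshold is at most `T₀`. -/
theorem exists_abort [Nonempty S] (hN : ∀ x a, st.N 0 x a ≤ inp.T₀) :
    Abort mdp inp st w (Fintype.card S * inp.T₀) := by
  by_contra hcon
  set m : Fin inp.M := ⟨0, inp.M_pos⟩
  have hlt : ∀ x, visits inp st w (Fintype.card S * inp.T₀) m 0 x (st.policy 0 x) < inp.T₀ := by
    intro x
    by_contra hx
    refine hcon ⟨m, 0, x, _, mdp.H_pos, le_trans (max_le inp.T₀_pos ?_) (not_lt.1 hx)⟩
    exact (Nat.div_le_self _ _).trans (hN _ _)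
  have hsum : ∑ x, visits inp st w (Fintype.card S * inp.T₀) m 0 x (st.policy 0 x)
      = Fintype.card S * inp.T₀ := by
    have e : ∀ x, visits inp st w (Fintype.card S * inp.T₀) m 0 x (st.policy 0 x)
        = ∑ j ∈ Finset.range (Fintype.card S * inp.T₀), if w j m 0 = x then 1 else 0 := by
      intro x
      have := visits_eq_sum (R := ℕ) inp st w (Fintype.card S * inp.T₀) m 0 x (st.policy 0 x)
      rw [Nat.cast_id] at this
      rw [this]
      refine Finset.sum_congr rfl fun j _ => ?_
      congr 1
      simp only [eq_iff_iff, and_iff_left_iff_imp]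
      rintro rfl; rfl
    simp_rw [e]
    rw [Finset.sum_comm]
    simp
  have : ∑ x, visits inp st w (Fintype.card S * inp.T₀) m 0 x (st.policy 0 x)
      < ∑ _x : S, inp.T₀ := Finset.sum_lt_sum_of_nonempty Finset.univ_nonempty fun x _ => hlt x
  rw [hsum] at this
  simp at this

/-- Round `k` is executed. -/
def Executed (k : ℕ) : Prop := mdp.H * (inp.M * st.episodes) < inp.T₀ ∧ k < inp.K₀

theorem roundLength_of_not {k : ℕ} (hk : ¬ Executed mdp inp st k) :
    roundLength mdp inp st w k = 0 := if_neg hk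

/-- The end of a round is a stopping time: whether episode `j` is run is decided by the first `j`
episodes. The hypothesis on the counts guarantees that the set in the `sInf` is nonempty; the
infimum of an empty set would be `0`. -/
theorem lt_roundLength_iff [Nonempty S] {k j : ℕ} (hN : Executed mdp inp st k → ∀ x a, st.N 0 x a ≤ inp.T₀) :
    j < roundLength mdp inp st w k ↔ Executed mdp inp st k ∧ ¬ Abort mdp inp st w j := by
  by_cases hk : Executed mdp inp st k
  · have e : roundLength mdp inp st w k = sInf {j : ℕ | Abort mdp inp st w j} := if_pos hk
    rw [e]
    refine ⟨fun h => ⟨hk, fun hc => (Nat.sInf_le (s := {j : ℕ | Abort mdp inp st w j}) hc).not_gt h⟩,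
      fun h => ?_⟩
    by_contra hc
    have := Nat.sInf_mem (s := {j : ℕ | Abort mdp inp st w j}) ⟨_, exists_abort mdp inp st w (hN hk)⟩
    exact h.2 (abort_mono mdp inp st w (not_lt.1 hc) this)
  · simp [roundLength_of_not mdp inp st w hk, hk]

theorem roundLength_le [Nonempty S] {k : ℕ} (hN : Executed mdp inp st k → ∀ x a, st.N 0 x a ≤ inp.T₀) :
    roundLength mdp inp st w k ≤ Fintype.card S * inp.T₀ := by
  by_contra hc
  have h := (lt_roundLength_iff mdp inp st w hN).1 (not_le.1 hc)
  exact h.2 (exists_abort mdp inp st w (hN h.1))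

/-- Before the last episode the count is strictly below the threshold, and one episode adds at most
one visit per agent. -/
theorem visits_le_threshold [Nonempty S] {k : ℕ}
    (hN : Executed mdp inp st k → ∀ x a, st.N 0 x a ≤ inp.T₀)
    {h : ℕ} (hh : h < mdp.H) (m : Fin inp.M) (x : S) (a : A) :
    visits inp st w (roundLength mdp inp st w k) m h x a ≤ threshold mdp inp st h x a := by
  rcases Nat.eq_zero_or_pos (roundLength mdp inp st w k) with h0 | h0
  · rw [h0, visits_zero]; exact Nat.zero_le _
  · obtain ⟨n, hn⟩ : ∃ n, roundLength mdp inp st w k = n + 1 := ⟨_, (Nat.sub_add_cancel h0).symm⟩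
    have h1 := ((lt_roundLength_iff mdp inp st w (j := n) hN).1 (by omega)).2
    have h2 : visits inp st w n m h x a < threshold mdp inp st h x a := by
      by_contra hc
      exact h1 ⟨m, h, x, a, hh, not_lt.1 hc⟩
    rw [hn, visits_succ]
    split_ifs <;> omega

/-- With threshold one, a first visit ends the round, so visits can occur only in its last episode.
-/
theorem visits_eq_zero [Nonempty S] {k : ℕ}
    (hN : Executed mdp inp st k → ∀ x a, st.N 0 x a ≤ inp.T₀)
    {h : ℕ} (hh : h < mdp.H) {x : S} {a : A} (ht : threshold mdp inp st h x a = 1)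
    {n : ℕ} (hn : n < roundLength mdp inp st w k) (m : Fin inp.M) :
    visits inp st w n m h x a = 0 := by
  have h1 := ((lt_roundLength_iff mdp inp st w hN).1 hn).2
  by_contra hc
  exact h1 ⟨m, h, x, a, hh, by omega⟩

theorem totalVisits_le [Nonempty S] {k : ℕ}
    (hN : Executed mdp inp st k → ∀ x a, st.N 0 x a ≤ inp.T₀)
    {h : ℕ} (hh : h < mdp.H) (x : S) (a : A) :
    totalVisits inp st w (roundLength mdp inp st w k) h x a
      ≤ inp.M * threshold mdp inp st h x a := by
  unfold totalVisits
  refine (Finset.sum_le_sum fun m _ => visits_le_threshold mdp inp st w hN hh m x a).trans ?_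
  simp

theorem threshold_eq_one {h : ℕ} {x : S} {a : A}
    (hs : st.N h x a < 2 * inp.M * mdp.H * (mdp.H + 1)) : threshold mdp inp st h x a = 1 := by
  have : st.N h x a / (inp.M * mdp.H * (mdp.H + 1)) < 2 := by
    rw [Nat.div_lt_iff_lt_mul
      (Nat.mul_pos (Nat.mul_pos inp.M_pos mdp.H_pos) (Nat.succ_pos _)), Nat.succ_eq_add_one]
    calc _ < _ := hs
      _ = _ := by ring
  unfold threshold
  omega

theorem mul_threshold_le {h : ℕ} {x : S} {a : A}
    (ht : threshold mdp inp st h x a ≠ 1) :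
    inp.M * threshold mdp inp st h x a * (mdp.H * (mdp.H + 1)) ≤ st.N h x a := by
  have e : threshold mdp inp st h x a = st.N h x a / (inp.M * mdp.H * (mdp.H + 1)) := by
    unfold threshold at ht ⊢; omega
  rw [e]
  calc _ = st.N h x a / (inp.M * mdp.H * (mdp.H + 1)) * (inp.M * mdp.H * (mdp.H + 1)) := by ring
    _ ≤ _ := Nat.div_mul_le_self _ _

end Round

/-! ### A round depends only on the states at the steps up to `H`. -/

section Congruence

variable {S A : Type*} [Fintype S] [Fintype A] [DecidableEq S] [DecidableEq A]
variable (mdp : MDP S A) (inp : Input S A) (b : ℕ → ℝ)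

/-- The servers agree in everything that concerns the steps of an episode. -/
structure Server.Agree (H : ℕ) (st st' : Server S A) : Prop where
  episodes : st.episodes = st'.episodes
  N : ∀ h < H, st.N h = st'.N h
  Q : ∀ h < H, st.Q h = st'.Q h
  policy : ∀ h < H, st.policy h = st'.policy h
  V : st.V = st'.V

variable {mdp inp b} {st st' : Server S A} {w w' : ℕ → Fin inp.M → ℕ → S}

theorem Server.Agree.hit (hst : st.Agree mdp.H st') {h : ℕ} (hh : h < mdp.H) {j : ℕ}
    {m : Fin inp.M} (hw : w j m h = w' j m h) (x : S) (a : A) :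
    Hit inp st w j m h x a ↔ Hit inp st' w' j m h x a := by
  unfold Hit; rw [hw, hst.policy h hh]

theorem Server.Agree.visits (hst : st.Agree mdp.H st') {h : ℕ} (hh : h < mdp.H) {n : ℕ}
    {m : Fin inp.M} (hw : ∀ j < n, w j m h = w' j m h) (x : S) (a : A) :
    visits inp st w n m h x a = FedQ.visits inp st' w' n m h x a := by
  unfold FedQ.visits
  congr 1
  refine Finset.filter_congr fun j hj => hst.hit hh (hw j (Finset.mem_range.1 hj)) x a

theorem Server.Agree.totalVisits (hst : st.Agree mdp.H st') {h : ℕ} (hh : h < mdp.H) {n : ℕ}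
    (hw : ∀ j < n, ∀ m, w j m h = w' j m h) (x : S) (a : A) :
    totalVisits inp st w n h x a = FedQ.totalVisits inp st' w' n h x a :=
  Finset.sum_congr rfl fun m _ => hst.visits hh (fun j hj => hw j hj m) x a

theorem Server.Agree.newN (hst : st.Agree mdp.H st') {h : ℕ} (hh : h < mdp.H) {n : ℕ}
    (hw : ∀ j < n, ∀ m, w j m h = w' j m h) (x : S) (a : A) :
    newN inp st w n h x a = FedQ.newN inp st' w' n h x a := by
  unfold FedQ.newN; rw [hst.N h hh, hst.totalVisits hh hw]

theorem Server.Agree.position (hst : st.Agree mdp.H st') {h : ℕ} (hh : h < mdp.H) {n : ℕ}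
    (hw : ∀ j ≤ n, ∀ m, w j m h = w' j m h) (m : Fin inp.M) (x : S) (a : A) :
    position inp st w n m h x a = FedQ.position inp st' w' n m h x a := by
  unfold FedQ.position
  rw [hst.N h hh, hst.totalVisits hh fun j hj => hw j hj.le]
  congr 3
  exact Finset.filter_congr fun m' _ => hst.hit hh (hw n le_rfl m') x a

theorem Server.Agree.localReturn (hst : st.Agree mdp.H st') {h : ℕ} (hh : h < mdp.H) {n : ℕ}
    (hw : ∀ j < n, ∀ m, ∀ h ≤ mdp.H, w j m h = w' j m h) (m : Fin inp.M) (x : S) (a : A) :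
    localReturn inp st w n m h x a = FedQ.localReturn inp st' w' n m h x a := by
  unfold FedQ.localReturn
  rw [hst.visits hh fun j hj => hw j hj m h hh.le]
  congr 1
  refine Finset.sum_congr rfl fun j hj => ?_
  have hj := Finset.mem_range.1 hj
  have h1 := hst.hit hh (hw j hj m h hh.le) x a
  unfold Hit at h1
  simp only [h1, hst.V, hw j hj m (h + 1) hh]

theorem Server.Agree.newQ (hst : st.Agree mdp.H st') {h : ℕ} (hh : h < mdp.H) {n : ℕ}
    (hw : ∀ j < n, ∀ m, ∀ h ≤ mdp.H, w j m h = w' j m h) (x : S) (a : A) :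
    newQ mdp inp b st w n h x a = FedQ.newQ mdp inp b st' w' n h x a := by
  have hw1 : ∀ j < n, ∀ m, w j m h = w' j m h := fun j hj m => hw j hj m h hh.le
  have e1 := hst.totalVisits (inp := inp) hh hw1 x a
  have e2 := hst.newN (inp := inp) hh hw1 x a
  have e3 : ∀ m, FedQ.visits inp st w n m h x a = FedQ.visits inp st' w' n m h x a :=
    fun m => hst.visits hh (fun j hj => hw1 j hj m) x a
  have e4 : ∀ m, FedQ.localReturn inp st w n m h x a = FedQ.localReturn inp st' w' n m h x a :=
    fun m => hst.localReturn hh hw m x a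
  have e5 : ∀ m, agentRank inp st w n m h x a = agentRank inp st' w' n m h x a := by
    intro m; unfold agentRank; simp only [e3]
  unfold FedQ.newQ aggRate aggBonus globalReturn
  simp only [e1, e2, e3, e4, e5, hst.N h hh, hst.Q h hh, hst.policy h hh]

theorem Server.Agree.next (hst : st.Agree mdp.H st') {n : ℕ}
    (hw : ∀ j < n, ∀ m, ∀ h ≤ mdp.H, w j m h = w' j m h) (k : ℕ) :
    (Server.next mdp inp b st w n k).Agree mdp.H (Server.next mdp inp b st' w' n k) where
  episodes := by simp [Server.next, hst.episodes]
  N h hh := by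
    funext x a; exact hst.newN hh (fun j hj m => hw j hj m h hh.le) x a
  Q h hh := by funext x a; exact hst.newQ hh hw x a
  policy h hh := by
    funext x
    have : FedQ.newQ mdp inp b st w n h x = FedQ.newQ mdp inp b st' w' n h x :=
      funext fun a => hst.newQ hh hw x a
    simp only [Server.next, this]
  V := by
    funext h x
    simp only [Server.next]
    split_ifs with hh
    · have : FedQ.newQ mdp inp b st w n h x = FedQ.newQ mdp inp b st' w' n h x :=
        funext fun a => hst.newQ hh hw x a
      simp only [this]
    · rfl

theorem Server.Agree.abort (hst : st.Agree mdp.H st') {n : ℕ}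
    (hw : ∀ j < n, ∀ m, ∀ h < mdp.H, w j m h = w' j m h) :
    Abort mdp inp st w n ↔ Abort mdp inp st' w' n := by
  unfold Abort
  refine exists_congr fun m => exists_congr fun h => exists_congr fun x => exists_congr fun a =>
    and_congr_right fun hh => ?_
  rw [hst.visits hh fun j hj => hw j hj m h hh, threshold, threshold, hst.N h hh]

theorem Server.Agree.executed (hst : st.Agree mdp.H st') (k : ℕ) :
    Executed mdp inp st k ↔ Executed mdp inp st' k := by
  unfold Executed; rw [hst.episodes]

theorem Server.Agree.lt_roundLength [Nonempty S] (hst : st.Agree mdp.H st') {k j : ℕ}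
    (hN : Executed mdp inp st k → ∀ x a, st.N 0 x a ≤ inp.T₀)
    (hw : ∀ i < j, ∀ m, ∀ h < mdp.H, w i m h = w' i m h) :
    j < roundLength mdp inp st w k ↔ j < roundLength mdp inp st' w' k := by
  have hN' : Executed mdp inp st' k → ∀ x a, st'.N 0 x a ≤ inp.T₀ := by
    rw [← hst.executed, ← hst.N 0 mdp.H_pos]; exact hN
  rw [lt_roundLength_iff _ _ _ _ hN, lt_roundLength_iff _ _ _ _ hN', hst.executed, hst.abort hw]

/-- The stopping criterion transfers between the two runs, and is tested at each of the two lengths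
to exclude both strict inequalities. -/
theorem Server.Agree.roundLength [Nonempty S] (hst : st.Agree mdp.H st') {k : ℕ}
    (hN : Executed mdp inp st k → ∀ x a, st.N 0 x a ≤ inp.T₀)
    (hw : ∀ i < roundLength mdp inp st w k, ∀ m, ∀ h < mdp.H, w i m h = w' i m h) :
    roundLength mdp inp st w k = FedQ.roundLength mdp inp st' w' k := by
  refine le_antisymm (Nat.le_of_not_lt fun hc => ?_) (Nat.le_of_not_lt fun hc => ?_)
  · have := (hst.lt_roundLength hN (j := FedQ.roundLength mdp inp st' w' k)
      fun i hi => hw i (hi.trans hc)).1 hc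
    exact lt_irrefl _ this
  · have := (hst.lt_roundLength hN (j := FedQ.roundLength mdp inp st w k) hw).2 hc
    exact lt_irrefl _ this

end Congruence

/-! ### Counts along the run and what the observed history determines. -/

section Run

variable {S A : Type*} [Fintype S] [Fintype A] [DecidableEq S] [DecidableEq A]
variable (mdp : MDP S A) (inp : Input S A) (b : ℕ → ℝ) (w : ℕ → ℕ → Fin inp.M → ℕ → S)

theorem server_succ (k : ℕ) : server mdp inp b w (k + 1) =
    Server.next mdp inp b (server mdp inp b w k) (w k) (length mdp inp b w k) k := rfl

theorem server_succ_N (k : ℕ) : (server mdp inp b w (k + 1)).N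
    = newN inp (server mdp inp b w k) (w k) (length mdp inp b w k) := rfl

theorem episodes_eq (k : ℕ) : (server mdp inp b w k).episodes
    = ∑ k' ∈ Finset.range k, length mdp inp b w k' := by
  induction k with
  | zero => rfl
  | succ k ih => rw [Finset.sum_range_succ, ← ih]; rfl

theorem sum_totalVisits (st : Server S A) (w : ℕ → Fin inp.M → ℕ → S) (n h : ℕ) :
    ∑ x, ∑ a, totalVisits inp st w n h x a = inp.M * n := by
  have : (∑ x, ∑ a, (totalVisits inp st w n h x a : ℝ)) = inp.M * n := by
    calc _ = ∑ j ∈ Finset.range n, ∑ x, ∑ a, ∑ m,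
          (if Hit inp st w j m h x a then (1 : ℝ) else 0) := by
          simp_rw [totalVisits_eq_sum]
          simp_rw [Finset.sum_comm (t := Finset.range n)]
      _ = _ := by
          simp_rw [sum_hit inp st w (fun _ _ _ _ => 1)]
          simp [mul_comm]
  exact_mod_cast this

/-- At a fixed step, each episode of each agent visits exactly one pair. -/
theorem sum_N (k h : ℕ) : ∑ x, ∑ a, (server mdp inp b w k).N h x a
    = inp.M * (server mdp inp b w k).episodes := by
  induction k with
  | zero => simp [server, Server.init]
  | succ k ih =>
    rw [server_succ_N]
    simp only [newN, Finset.sum_add_distrib, ih, sum_totalVisits]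
    rw [server_succ]
    simp only [Server.next]
    ring

theorem N_le_episodes (k h : ℕ) (x : S) (a : A) :
    (server mdp inp b w k).N h x a ≤ inp.M * (server mdp inp b w k).episodes := by
  rw [← sum_N mdp inp b w k h]
  exact (Finset.single_le_sum (f := fun a => (server mdp inp b w k).N h x a)
    (fun _ _ => Nat.zero_le _) (Finset.mem_univ a)).trans
    (Finset.single_le_sum (f := fun x => ∑ a, (server mdp inp b w k).N h x a)
    (fun _ _ => Nat.zero_le _) (Finset.mem_univ x))

theorem N_le_of_executed {k : ℕ} (hk : Executed mdp inp (server mdp inp b w k) k) (h : ℕ) (x : S)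
    (a : A) : (server mdp inp b w k).N h x a ≤ inp.T₀ :=
  (N_le_episodes mdp inp b w k h x a).trans
    ((Nat.le_mul_of_pos_left _ mdp.H_pos).trans hk.1.le)

variable [Nonempty S]

theorem length_le (k : ℕ) : length mdp inp b w k ≤ Fintype.card S * inp.T₀ :=
  roundLength_le mdp inp _ _ fun hk x a => N_le_of_executed mdp inp b w hk 0 x a

/-- All visits of a triple in a round before which there are `N` visits. -/
theorem totalVisits_cases (k : ℕ) {h : ℕ} (hh : h < mdp.H) (x : S) (a : A) :
    totalVisits inp (server mdp inp b w k) (w k) (length mdp inp b w k) h x a ≤ inp.M ∨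
    totalVisits inp (server mdp inp b w k) (w k) (length mdp inp b w k) h x a
      * (mdp.H * (mdp.H + 1)) ≤ (server mdp inp b w k).N h x a := by
  have h1 := totalVisits_le mdp inp (server mdp inp b w k) (w k) (k := k)
    (fun hk x a => N_le_of_executed mdp inp b w hk 0 x a) hh x a
  by_cases ht : threshold mdp inp (server mdp inp b w k) h x a = 1
  · left; rw [ht, mul_one] at h1; exact h1
  · right; exact (Nat.mul_le_mul_right _ h1).trans (mul_threshold_le mdp inp _ ht)

theorem totalVisits_mul_le_of_le (k : ℕ) {h : ℕ} (hh : h < mdp.H) (x : S) (a : A)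
    (hN : 2 * inp.M * mdp.H * (mdp.H + 1) ≤ (server mdp inp b w k).N h x a) :
    totalVisits inp (server mdp inp b w k) (w k) (length mdp inp b w k) h x a
      * (mdp.H * (mdp.H + 1)) ≤ (server mdp inp b w k).N h x a := by
  rcases totalVisits_cases mdp inp b w k hh x a with h1 | h1
  · calc _ ≤ inp.M * (mdp.H * (mdp.H + 1)) := Nat.mul_le_mul_right _ h1
      _ ≤ 2 * (inp.M * (mdp.H * (mdp.H + 1))) := Nat.le_mul_of_pos_left _ (by norm_num)
      _ = 2 * inp.M * mdp.H * (mdp.H + 1) := by ring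
      _ ≤ _ := hN
  · exact h1

theorem totalVisits_le_of_lt (k : ℕ) {h : ℕ} (hh : h < mdp.H) (x : S) (a : A)
    (hN : (server mdp inp b w k).N h x a < 2 * inp.M * mdp.H * (mdp.H + 1)) :
    totalVisits inp (server mdp inp b w k) (w k) (length mdp inp b w k) h x a ≤ inp.M := by
  have h1 := totalVisits_le mdp inp (server mdp inp b w k) (w k) (k := k)
    (fun hk x a => N_le_of_executed mdp inp b w hk 0 x a) hh x a
  rwa [threshold_eq_one mdp inp _ hN, mul_one] at h1

theorem totalVisits_of_not_executed {k : ℕ} (hk : ¬ Executed mdp inp (server mdp inp b w k) k)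
    (h : ℕ) (x : S) (a : A) :
    totalVisits inp (server mdp inp b w k) (w k) (length mdp inp b w k) h x a = 0 := by
  have : length mdp inp b w k = 0 := roundLength_of_not mdp inp _ _ hk
  rw [this]; simp [totalVisits, visits_zero]

/-- An executed round starts with at most `T₀` visits and adds at most `M` visits or at most doubles
the count. This deterministic cap makes the family of windows in the union bound finite. -/
theorem N_le (k : ℕ) {h : ℕ} (hh : h < mdp.H) (x : S) (a : A) :
    (server mdp inp b w k).N h x a ≤ 2 * inp.T₀ + inp.M := by
  induction k with
  | zero => simp [server, Server.init]
  | succ k ih =>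
    rw [server_succ_N, newN]
    by_cases hk : Executed mdp inp (server mdp inp b w k) k
    · have h1 := N_le_of_executed mdp inp b w hk h x a
      rcases totalVisits_cases mdp inp b w k hh x a with h2 | h2
      · omega
      · have h3 : totalVisits inp (server mdp inp b w k) (w k) (length mdp inp b w k) h x a
            ≤ (server mdp inp b w k).N h x a :=
          (Nat.le_mul_of_pos_right _ (Nat.mul_pos mdp.H_pos (Nat.succ_pos _))).trans h2
        omega
    · rw [totalVisits_of_not_executed mdp inp b w hk]; exact ih

/-- A round starts only with at most `T₀` episodes and has at most `S * T₀` of them. The cap is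
crude, but enters only through the number of drift events. -/
theorem episodes_le (k : ℕ) :
    (server mdp inp b w k).episodes ≤ inp.T₀ + Fintype.card S * inp.T₀ := by
  induction k with
  | zero => simp [server, Server.init]
  | succ k ih =>
    rw [server_succ]
    simp only [Server.next]
    by_cases hk : Executed mdp inp (server mdp inp b w k) k
    · have h1 : (server mdp inp b w k).episodes ≤ inp.T₀ :=
        (Nat.le_mul_of_pos_left _ inp.M_pos).trans
          ((Nat.le_mul_of_pos_left _ mdp.H_pos).trans hk.1.le)
      have h2 := length_le mdp inp b w k
      omega
    · have : length mdp inp b w k = 0 := roundLength_of_not mdp inp _ _ hk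
      omega

variable {mdp inp b w} {w' : ℕ → ℕ → Fin inp.M → ℕ → S}

/-- The observed history determines the server. Agreement is claimed only at steps `h < H`: the
definitions also count visits at later steps, which the history does not record. -/
theorem server_agree {k : ℕ}
    (hw : ∀ k' < k, ∀ j < length mdp inp b w k', ∀ m, ∀ h ≤ mdp.H, w' k' j m h = w k' j m h) :
    (server mdp inp b w k).Agree mdp.H (server mdp inp b w' k) ∧
      ∀ k' < k, length mdp inp b w k' = length mdp inp b w' k' := by
  induction k with
  | zero => exact ⟨⟨rfl, fun _ _ => rfl, fun _ _ => rfl, fun _ _ => rfl, rfl⟩, by simp⟩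
  | succ k ih =>
    obtain ⟨h1, h2⟩ := ih fun k' hk' => hw k' (by omega)
    have h3 : length mdp inp b w k = length mdp inp b w' k :=
      h1.roundLength (fun hk x a => N_le_of_executed mdp inp b w hk 0 x a)
        fun i hi m h hh => (hw k (by omega) i hi m h hh.le).symm
    refine ⟨?_, fun k' hk' => ?_⟩
    · rw [server_succ, server_succ, ← h3]
      exact h1.next (fun j hj m h hh => (hw k (by omega) j hj m h hh).symm) k
    · rcases Nat.lt_succ_iff_lt_or_eq.1 hk' with h | rfl
      · exact h2 k' h
      · exact h3

variable (mdp inp b) in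
/-- What is observed up to step `h` of episode `j` of round `k` is the same for `w` and `w'`. -/
def SameHistory (w w' : ℕ → ℕ → Fin inp.M → ℕ → S) (k j h : ℕ) : Prop :=
  (∀ k' < k, ∀ j' < length mdp inp b w k', ∀ m, ∀ h' ≤ mdp.H, w' k' j' m h' = w k' j' m h')
    ∧ (∀ j' < j, ∀ m, ∀ h' ≤ mdp.H, w' k j' m h' = w k j' m h')
    ∧ (∀ m, ∀ h' ≤ h, w' k j m h' = w k j m h')

theorem SameHistory.lt_length {k j h : ℕ} (hs : SameHistory mdp inp b w w' k j h) :
    j < length mdp inp b w k ↔ j < length mdp inp b w' k :=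
  (server_agree hs.1).1.lt_roundLength (fun hk x a => N_le_of_executed mdp inp b w hk 0 x a)
    fun i hi m h hh => (hs.2.1 i hi m h hh.le).symm

theorem SameHistory.symm {k j h : ℕ} (hs : SameHistory mdp inp b w w' k j h) :
    SameHistory mdp inp b w' w k j h := by
  have h1 := (server_agree hs.1).2
  exact ⟨fun k' hk' j' hj' m h' hh' => (hs.1 k' hk' j' (by rwa [h1 k' hk']) m h' hh').symm,
    fun j' hj' m h' hh' => (hs.2.1 j' hj' m h' hh').symm, fun m h' hh' => (hs.2.2 m h' hh').symm⟩

theorem SameHistory.trans {w'' : ℕ → ℕ → Fin inp.M → ℕ → S} {k j h : ℕ}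
    (hs : SameHistory mdp inp b w w' k j h) (hs' : SameHistory mdp inp b w' w'' k j h) :
    SameHistory mdp inp b w w'' k j h := by
  have h1 := (server_agree hs.1).2
  exact ⟨fun k' hk' j' hj' m h' hh' => (hs'.1 k' hk' j' (by rwa [← h1 k' hk']) m h' hh').trans
      (hs.1 k' hk' j' hj' m h' hh'),
    fun j' hj' m h' hh' => (hs'.2.1 j' hj' m h' hh').trans (hs.2.1 j' hj' m h' hh'),
    fun m h' hh' => (hs'.2.2 m h' hh').trans (hs.2.2 m h' hh')⟩

theorem SameHistory.agree {k j h : ℕ} (hs : SameHistory mdp inp b w w' k j h) :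
    (server mdp inp b w k).Agree mdp.H (server mdp inp b w' k) := (server_agree hs.1).1

theorem SameHistory.past {k j h : ℕ} (hs : SameHistory mdp inp b w w' k j h) {k' j' : ℕ}
    (hk : k' < k) (hj : j' < length mdp inp b w k') (h' : ℕ) (hh' : h' ≤ mdp.H) :
    SameHistory mdp inp b w w' k' j' h' :=
  ⟨fun i hi => hs.1 i (by omega), fun i hi => hs.1 k' hk i (by omega),
    fun m i hi => hs.1 k' hk j' hj m i (by omega)⟩

theorem SameHistory.past_episode {k j h : ℕ} (hs : SameHistory mdp inp b w w' k j h) {j' : ℕ}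
    (hj : j' < j) (h' : ℕ) (hh' : h' ≤ mdp.H) : SameHistory mdp inp b w w' k j' h' :=
  ⟨hs.1, fun i hi => hs.2.1 i (by omega), fun m i hi => hs.2.1 j' hj m i (by omega)⟩

end Run

end

end FedQ

/-! ### Exponential supermartingales along the run. -/

namespace FedQ

noncomputable section

open MeasureTheory

theorem lintegral_eq_sum_fibers {Ω γ : Type*} [MeasurableSpace Ω] [Fintype γ] (μ : Measure Ω)
    (c : Ω → γ) (hc : ∀ v, MeasurableSet {ω | c ω = v}) (f : Ω → ENNReal) :
    ∫⁻ ω, f ω ∂μ = ∑ v, ∫⁻ ω in {ω | c ω = v}, f ω ∂μ := by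
  have hu : (⋃ v, {ω | c ω = v}) = Set.univ := by ext ω; simp
  rw [← tsum_fintype (L := .unconditional _), ← lintegral_iUnion hc _ f, hu, Measure.restrict_univ]
  intro v v' hv
  refine Set.disjoint_left.2 fun ω h1 h2 => hv ?_
  rw [← (h1 : c ω = v), ← (h2 : c ω = v')]

theorem setLIntegral_eq_sum_fibers {Ω γ : Type*} [MeasurableSpace Ω] [Fintype γ] (μ : Measure Ω)
    (c : Ω → γ) (hc : ∀ v, MeasurableSet {ω | c ω = v}) (f : Ω → ENNReal) (s : Set Ω) :
    ∫⁻ ω in s, f ω ∂μ = ∑ v, ∫⁻ ω in {ω | c ω = v} ∩ s, f ω ∂μ := by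
  rw [lintegral_eq_sum_fibers _ c hc]
  refine Finset.sum_congr rfl fun v _ => ?_
  rw [Measure.restrict_restrict (hc v)]

/-- Hoeffding's lemma for a probability mass function. -/
theorem pmf_hoeffding {S : Type*} [Fintype S] (p : PMF S) (g : S → ℝ) (B t : ℝ)
    (hg : ∀ s, 0 ≤ g s ∧ g s ≤ B) :
    ∑ s, p s * ENNReal.ofReal (Real.exp
      (t * (g s - ∑ y, (p y).toReal * g y) - t ^ 2 * B ^ 2 / 8)) ≤ 1 := by
  let _ : MeasurableSpace S := ⊤
  have hms : MeasurableSingletonClass S := ⟨fun _ => trivial⟩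
  have h1 := ProbabilityTheory.hasSubgaussianMGF_of_mem_Icc (μ := p.toMeasure) (X := g) (a := 0)
    (b := B) (measurable_from_top.aemeasurable) (Filter.Eventually.of_forall fun s => hg s)
  have h2 := h1.mgf_le t
  rw [ProbabilityTheory.mgf, PMF.integral_eq_sum, PMF.integral_eq_sum] at h2
  simp only [smul_eq_mul] at h2
  set m := ∑ y, (p y).toReal * g y
  have e : ∀ s, p s * ENNReal.ofReal (Real.exp (t * (g s - m) - t ^ 2 * B ^ 2 / 8))
      = ENNReal.ofReal ((p s).toReal * Real.exp (t * (g s - m)) * Real.exp (-(t ^ 2 * B ^ 2 / 8))) := by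
    intro s
    rw [mul_assoc, ← Real.exp_add, ← sub_eq_add_neg, ENNReal.ofReal_mul ENNReal.toReal_nonneg,
      ENNReal.ofReal_toReal (p.apply_ne_top s)]
  simp_rw [e]
  rw [← ENNReal.ofReal_sum_of_nonneg (fun s _ => by positivity), ← Finset.sum_mul]
  rw [ENNReal.ofReal_le_one]
  have h3 : (∑ s, (p s).toReal * Real.exp (t * (g s - m))) ≤ Real.exp (t ^ 2 * B ^ 2 / 8) := by
    refine h2.trans (Real.exp_le_exp.2 (le_of_eq ?_))
    simp only [NNReal.coe_pow, NNReal.coe_div, coe_nnnorm, Real.norm_eq_abs, sub_zero]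
    rw [div_pow, sq_abs]; push_cast; ring
  calc _ ≤ Real.exp (t ^ 2 * B ^ 2 / 8) * Real.exp (-(t ^ 2 * B ^ 2 / 8)) :=
        mul_le_mul_of_nonneg_right h3 (Real.exp_pos _).le
    _ = 1 := by rw [← Real.exp_add, add_neg_cancel, Real.exp_zero]

variable {S A : Type*} [Fintype S] [Fintype A] [DecidableEq S] [DecidableEq A] [Nonempty S]
variable {mdp : MDP S A} {inp : Input S A} {b : ℕ → ℝ}

section Measurability

variable {Ω : Type*} [MeasurableSpace Ω] {X : Ω → ℕ → ℕ → Fin inp.M → ℕ → S}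

theorem measurableSet_sameHistory (hX : ∀ k j m h s, MeasurableSet {ω | X ω k j m h = s})
    (w : ℕ → ℕ → Fin inp.M → ℕ → S) (k j h : ℕ) :
    MeasurableSet {ω | SameHistory mdp inp b w (X ω) k j h} := by
  have : {ω | SameHistory mdp inp b w (X ω) k j h}
      = (⋂ k', ⋂ (_ : k' < k), ⋂ j', ⋂ (_ : j' < length mdp inp b w k'), ⋂ m, ⋂ h',
          ⋂ (_ : h' ≤ mdp.H), {ω | X ω k' j' m h' = w k' j' m h'})
        ∩ ((⋂ j', ⋂ (_ : j' < j), ⋂ m, ⋂ h', ⋂ (_ : h' ≤ mdp.H), {ω | X ω k j' m h' = w k j' m h'})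
        ∩ (⋂ m, ⋂ h', ⋂ (_ : h' ≤ h), {ω | X ω k j m h' = w k j m h'})) := by
    ext ω
    simp only [Set.mem_inter_iff, Set.mem_iInter]
    rfl
  rw [this]
  refine .inter ?_ (.inter ?_ ?_)
  · exact .iInter fun _ => .iInter fun _ => .iInter fun _ => .iInter fun _ => .iInter fun _ =>
      .iInter fun _ => .iInter fun _ => hX _ _ _ _ _
  · exact .iInter fun _ => .iInter fun _ => .iInter fun _ => .iInter fun _ =>
      .iInter fun _ => hX _ _ _ _ _
  · exact .iInter fun _ => .iInter fun _ => .iInter fun _ => hX _ _ _ _ _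

/-- The histories up to step `h` of episode `j` of round `k` take finitely many values. -/
abbrev HistoryCode (S A : Type*) [Fintype S] (mdp : MDP S A) (inp : Input S A) (k : ℕ) : Type _ :=
  (Fin k → Fin (Fintype.card S * inp.T₀ + 1)) ×
    (Fin (k + 1) → Fin (Fintype.card S * inp.T₀) → Fin inp.M → Fin (mdp.H + 1) → S)

variable (mdp inp b) in
open Classical in
/-- An encoding of what is observed up to step `h` of episode `j` of round `k`. -/
def historyCode (w : ℕ → ℕ → Fin inp.M → ℕ → S) (k j h : ℕ) : HistoryCode S A mdp inp k :=
  (fun k' => ⟨length mdp inp b w k', Nat.lt_succ_of_le (length_le mdp inp b w k')⟩,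
    fun k' j' m h' =>
      if (k'.1 < k ∧ j'.1 < length mdp inp b w k') ∨ (k'.1 = k ∧ (j'.1 < j ∨ j'.1 = j ∧ h'.1 ≤ h))
      then w k' j' m h' else Classical.arbitrary S)

/-- The bounds on `j` and `h` make the observed entries fit into the finite box. Unobserved entries
are masked, and the recorded lengths tell which entries of earlier rounds are observed. -/
theorem historyCode_eq_iff {w w' : ℕ → ℕ → Fin inp.M → ℕ → S} {k j h : ℕ}
    (hj : j < Fintype.card S * inp.T₀) (hh : h ≤ mdp.H) :
    historyCode mdp inp b w k j h = historyCode mdp inp b w' k j h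
      ↔ SameHistory mdp inp b w w' k j h := by
  constructor
  · intro he
    have h1 : ∀ k' < k, length mdp inp b w k' = length mdp inp b w' k' := fun k' hk' =>
      Fin.mk.inj_iff.1 (congrFun (congrArg Prod.fst he) ⟨k', hk'⟩)
    have h2 := fun k' j' m h' => congrFun (congrFun (congrFun (congrFun
      (congrArg Prod.snd he) k') j') m) h'
    simp only [historyCode] at h2
    refine ⟨fun k' hk' j' hj' m h' hh' => ?_, fun j' hj' m h' hh' => ?_, fun m h' hh' => ?_⟩
    · have := h2 ⟨k', by omega⟩ ⟨j', hj'.trans_le (length_le mdp inp b w k')⟩ m ⟨h', by omega⟩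
      rw [if_pos (Or.inl ⟨hk', hj'⟩), if_pos (Or.inl ⟨hk', by rwa [← h1 k' hk']⟩)] at this
      exact this.symm
    · have := h2 ⟨k, by omega⟩ ⟨j', by omega⟩ m ⟨h', by omega⟩
      rw [if_pos (Or.inr ⟨rfl, Or.inl hj'⟩), if_pos (Or.inr ⟨rfl, Or.inl hj'⟩)] at this
      exact this.symm
    · have := h2 ⟨k, by omega⟩ ⟨j, by omega⟩ m ⟨h', by omega⟩
      rw [if_pos (Or.inr ⟨rfl, Or.inr ⟨rfl, hh'⟩⟩), if_pos (Or.inr ⟨rfl, Or.inr ⟨rfl, hh'⟩⟩)] at this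
      exact this.symm
  · intro hs
    have h1 := (server_agree hs.1).2
    refine Prod.ext (funext fun k' => Fin.ext (h1 k' k'.2)) ?_
    funext k' j' m h'
    simp only [historyCode]
    by_cases hk : k'.1 < k
    · rw [h1 k' hk]
      have hk2 : k'.1 ≠ k := hk.ne
      by_cases hl : j'.1 < length mdp inp b w' k'
      · rw [if_pos (Or.inl ⟨hk, hl⟩), if_pos (Or.inl ⟨hk, hl⟩)]
        exact (hs.1 k' hk j' (by rwa [h1 k' hk]) m h' (by omega)).symm
      · rw [if_neg (by tauto), if_neg (by tauto)]
    · have hk2 : k'.1 = k := by omega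
      by_cases hc : j'.1 < j ∨ j'.1 = j ∧ h'.1 ≤ h
      · rw [if_pos (Or.inr ⟨hk2, hc⟩), if_pos (Or.inr ⟨hk2, hc⟩), hk2]
        rcases hc with hc | ⟨hc, hc'⟩
        · exact (hs.2.1 j' hc m h' (by omega)).symm
        · rw [hc]; exact (hs.2.2 m h' hc').symm
      · rw [if_neg (by tauto), if_neg (by tauto)]

theorem measurableSet_historyCode (hX : ∀ k j m h s, MeasurableSet {ω | X ω k j m h = s})
    {k j h : ℕ} (hj : j < Fintype.card S * inp.T₀) (hh : h ≤ mdp.H)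
    (v : HistoryCode S A mdp inp k) :
    MeasurableSet {ω | historyCode mdp inp b (X ω) k j h = v} := by
  by_cases hv : ∃ w : ℕ → ℕ → Fin inp.M → ℕ → S, historyCode mdp inp b w k j h = v
  · obtain ⟨w, rfl⟩ := hv
    have : {ω | historyCode mdp inp b (X ω) k j h = historyCode mdp inp b w k j h}
        = {ω | SameHistory mdp inp b w (X ω) k j h} := by
      ext ω
      exact eq_comm.trans (historyCode_eq_iff hj hh)
    rw [this]
    exact measurableSet_sameHistory hX w k j h
  · convert MeasurableSet.empty
    ext ω
    simp only [Set.mem_ofPred_eq, Set.mem_empty_iff_false, iff_false]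
    exact fun hc => hv ⟨_, hc⟩

/-- Such an event is a finite union of history atoms. -/
theorem measurableSet_of_sameHistory (hX : ∀ k j m h s, MeasurableSet {ω | X ω k j m h = s})
    (P : (ℕ → ℕ → Fin inp.M → ℕ → S) → Prop) (K : ℕ)
    (hP : ∀ w w', SameHistory mdp inp b w w' K 0 0 → P w → P w') :
    MeasurableSet {ω | P (X ω)} := by
  have hpos : 0 < Fintype.card S * inp.T₀ := Nat.mul_pos Fintype.card_pos inp.T₀_pos
  have : {ω | P (X ω)} = ⋃ v : HistoryCode S A mdp inp K,
      ⋃ _ : ∃ w, P w ∧ historyCode mdp inp b w K 0 0 = v,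
        {ω | historyCode mdp inp b (X ω) K 0 0 = v} := by
    ext ω
    simp only [Set.mem_ofPred_eq, Set.mem_iUnion, exists_prop]
    constructor
    · intro h
      exact ⟨_, ⟨X ω, h, rfl⟩, rfl⟩
    · rintro ⟨_, ⟨w, hw, rfl⟩, h⟩
      exact hP w _ ((historyCode_eq_iff hpos (Nat.zero_le _)).1 h.symm) hw
  rw [this]
  exact .iUnion fun v => .iUnion fun _ => measurableSet_historyCode hX hpos (Nat.zero_le _) v

end Measurability

variable (mdp inp b) in
/-- The increments `f w k j m` of a process that is revealed at the transitions from step `h` to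
step `h + 1`: they are determined by the history, and their exponentials have mean at most `1`. -/
structure IsExpSupermartingale (h : ℕ)
    (f : (ℕ → ℕ → Fin inp.M → ℕ → S) → ℕ → ℕ → Fin inp.M → S → ℝ) : Prop where
  adapted : ∀ w w' k j, j < length mdp inp b w k → SameHistory mdp inp b w w' k j h →
    f w k j = f w' k j
  exp_le : ∀ w k j m, j < length mdp inp b w k →
    ∑ s, mdp.P h (w k j m h) ((server mdp inp b w k).policy h (w k j m h)) s
      * ENNReal.ofReal (Real.exp (f w k j m s)) ≤ 1

variable (mdp inp b) in
/-- The sum of the increments in the first `k` rounds and in `j` episodes of round `k`. -/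
def partialSum (h : ℕ) (f : (ℕ → ℕ → Fin inp.M → ℕ → S) → ℕ → ℕ → Fin inp.M → S → ℝ)
    (w : ℕ → ℕ → Fin inp.M → ℕ → S) (k j : ℕ) : ℝ :=
  ∑ k' ∈ Finset.range k, ∑ j' ∈ Finset.range (length mdp inp b w k'), ∑ m,
      f w k' j' m (w k' j' m (h + 1))
    + ∑ j' ∈ Finset.range (min j (length mdp inp b w k)), ∑ m, f w k j' m (w k j' m (h + 1))

variable {h : ℕ} {f : (ℕ → ℕ → Fin inp.M → ℕ → S) → ℕ → ℕ → Fin inp.M → S → ℝ}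

/-- The summands concern completed episodes only, whose transitions are part of the history; the
step `i` reached in the current episode is irrelevant. -/
theorem partialSum_congr (hh : h < mdp.H) (hf : IsExpSupermartingale mdp inp b h f)
    {w w' : ℕ → ℕ → Fin inp.M → ℕ → S} {k j i : ℕ} (hs : SameHistory mdp inp b w w' k j i) :
    partialSum mdp inp b h f w k j = partialSum mdp inp b h f w' k j := by
  unfold partialSum
  have h1 := (server_agree hs.1).2
  congr 1
  · refine Finset.sum_congr rfl fun k' hk' => ?_
    have hk' := Finset.mem_range.1 hk'
    rw [h1 k' hk']
    refine Finset.sum_congr rfl fun j' hj' => Finset.sum_congr rfl fun m _ => ?_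
    have hj' : j' < length mdp inp b w k' := by rw [h1 k' hk']; exact Finset.mem_range.1 hj'
    rw [hf.adapted w w' k' j' hj' (hs.past hk' hj' h hh.le), hs.1 k' hk' j' hj' m (h + 1) hh]
  -- The length of the current round may differ between `w` and `w'`, but only beyond `j`, because
  -- the first `j` episodes decide up to `j` whether the round has ended.
  · have hmin : min j (length mdp inp b w k) = min j (length mdp inp b w' k) := by
      have key : ∀ j' ≤ j, (j' < length mdp inp b w k ↔ j' < length mdp inp b w' k) := by
        intro j' hj'
        exact (hs.agree).lt_roundLength (fun hk x a => N_le_of_executed mdp inp b w hk 0 x a)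
          fun i hi m h hh => (hs.2.1 i (by omega) m h hh.le).symm
      rcases le_or_gt (length mdp inp b w k) (length mdp inp b w' k) with hc | hc
      · by_contra hne
        have := key (length mdp inp b w k) (by omega)
        omega
      · by_contra hne
        have := key (length mdp inp b w' k) (by omega)
        omega
    rw [← hmin]
    refine Finset.sum_congr rfl fun j' hj' => Finset.sum_congr rfl fun m _ => ?_
    have hj' := Finset.mem_range.1 hj'
    rw [hf.adapted w w' k j' (by omega) (hs.past_episode (by omega) h hh.le),
      hs.2.1 j' (by omega) m (h + 1) hh]

theorem partialSum_succ_of_lt (w : ℕ → ℕ → Fin inp.M → ℕ → S) {k j : ℕ}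
    (hj : j < length mdp inp b w k) :
    partialSum mdp inp b h f w k (j + 1)
      = partialSum mdp inp b h f w k j + ∑ m, f w k j m (w k j m (h + 1)) := by
  unfold partialSum
  rw [min_eq_left hj, min_eq_left hj.le, Finset.sum_range_succ, add_assoc]

theorem partialSum_succ_of_le (w : ℕ → ℕ → Fin inp.M → ℕ → S) {k j : ℕ}
    (hj : length mdp inp b w k ≤ j) :
    partialSum mdp inp b h f w k (j + 1) = partialSum mdp inp b h f w k j := by
  unfold partialSum
  rw [min_eq_right hj, min_eq_right (hj.trans (Nat.le_succ j))]

theorem partialSum_round (w : ℕ → ℕ → Fin inp.M → ℕ → S) (k : ℕ) :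
    partialSum mdp inp b h f w (k + 1) 0
      = partialSum mdp inp b h f w k (Fintype.card S * inp.T₀) := by
  unfold partialSum
  rw [min_eq_right (length_le mdp inp b w k), Finset.sum_range_succ]
  simp

section Integral

variable {Ω : Type*} [MeasurableSpace Ω] {μ : Measure Ω} {X : Ω → ℕ → ℕ → Fin inp.M → ℕ → S}

/-- On a history atom the joint law of the next states is the product of the transition laws, so the
integral of a product over the agents is a product of sums, each at most one. -/
theorem setLIntegral_transition_le (hX : IsRun mdp inp b μ X) (hh : h < mdp.H)
    (w : ℕ → ℕ → Fin inp.M → ℕ → S) {k j : ℕ} (hj : j < length mdp inp b w k)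
    (g : Fin inp.M → S → ENNReal)
    (hg : ∀ m, ∑ s, mdp.P h (w k j m h) ((server mdp inp b w k).policy h (w k j m h)) s * g m s ≤ 1) :
    ∫⁻ ω in {ω | SameHistory mdp inp b w (X ω) k j h}, ∏ m, g m (X ω k j m (h + 1)) ∂μ
      ≤ μ {ω | SameHistory mdp inp b w (X ω) k j h} := by
  set E := {ω | SameHistory mdp inp b w (X ω) k j h}
  have hc : ∀ v : Fin inp.M → S, MeasurableSet {ω | (fun m => X ω k j m (h + 1)) = v} := by
    intro v
    have : {ω | (fun m => X ω k j m (h + 1)) = v} = ⋂ m, {ω | X ω k j m (h + 1) = v m} := by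
      ext ω; simp [funext_iff]
    rw [this]
    exact .iInter fun m => hX.measurable _ _ _ _ _
  rw [setLIntegral_eq_sum_fibers μ (fun ω m => X ω k j m (h + 1)) hc]
  have hpiece : ∀ v : Fin inp.M → S,
      ∫⁻ ω in {ω | (fun m => X ω k j m (h + 1)) = v} ∩ E, ∏ m, g m (X ω k j m (h + 1)) ∂μ
        = μ E * ∏ m, (mdp.P h (w k j m h) ((server mdp inp b w k).policy h (w k j m h)) (v m)
            * g m (v m)) := by
    intro v
    have hE : MeasurableSet E := measurableSet_sameHistory hX.measurable w k j h
    rw [setLIntegral_congr_fun (g := fun _ => ∏ m, g m (v m)) ((hc v).inter hE) (by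
      intro ω hω
      have : ∀ m, X ω k j m (h + 1) = v m := fun m => congrFun hω.1 m
      simp only [this]), setLIntegral_const]
    -- `IsRun.transition` speaks of one prescribed trajectory, so the next states `v` are written
    -- into `w`. The history is unchanged, hence so are the server and the fact that episode `j` is
    -- run.
    set w' : ℕ → ℕ → Fin inp.M → ℕ → S := fun k' j' m h' =>
      if k' = k ∧ j' = j ∧ h' = h + 1 then v m else w k' j' m h' with hw'
    have hww : SameHistory mdp inp b w w' k j h := by
      refine ⟨fun k' hk' j' hj' m h' hh' => ?_, fun j' hj' m h' hh' => ?_, fun m h' hh' => ?_⟩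
      all_goals exact if_neg (by omega)
    have hj' : j < length mdp inp b w' k := hww.lt_length.1 hj
    have htr := hX.transition w' k j h hj' hh
    have e1 : historyEvent mdp inp b w' X k j h = E := by
      ext ω
      exact ⟨fun hω => hww.trans hω, fun hω => hww.symm.trans hω⟩
    have e2 : historyEvent mdp inp b w' X k j (h + 1)
        = {ω | (fun m => X ω k j m (h + 1)) = v} ∩ E := by
      ext ω
      have hv : ∀ m, w' k j m (h + 1) = v m := fun m => if_pos ⟨rfl, rfl, rfl⟩
      constructor
      · intro hω
        refine ⟨funext fun m => ?_, ?_⟩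
        · rw [← hv m]; exact hω.2.2 m (h + 1) le_rfl
        · rw [← e1]
          exact ⟨hω.1, hω.2.1, fun m h' hh' => hω.2.2 m h' (by omega)⟩
      · rintro ⟨h1, h2⟩
        rw [← e1] at h2
        refine ⟨h2.1, h2.2.1, fun m h' hh' => ?_⟩
        rcases Nat.lt_or_ge h' (h + 1) with hc | hc
        · exact h2.2.2 m h' (by omega)
        · obtain rfl : h' = h + 1 := by omega
          rw [hv m]; exact congrFun h1 m
    rw [e1, e2] at htr
    rw [htr, Finset.prod_mul_distrib, mul_comm, mul_assoc]
    congr 2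
    refine Finset.prod_congr rfl fun m _ => ?_
    have e3 : w' k j m h = w k j m h := if_neg (by omega)
    have e4 : w' k j m (h + 1) = v m := if_pos ⟨rfl, rfl, rfl⟩
    rw [e3, e4, hww.agree.policy h hh]
  simp_rw [hpiece]
  -- Independence of the agents: the sum over all joint next states factorizes.
  have hprod := Fintype.prod_sum (fun m s =>
    mdp.P h (w k j m h) ((server mdp inp b w k).policy h (w k j m h)) s * g m s)
  rw [← Finset.mul_sum, ← hprod]
  calc _ ≤ μ E * 1 := by
        refine mul_le_mul_right ?_ _
        exact Finset.prod_le_one' fun m _ => hg m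
    _ = μ E := mul_one _

/-- Split into the finitely many history atoms before the transition. On an atom the past sum is
constant; if the episode is run, the new factor has mean at most one, and otherwise nothing changes.
-/
theorem lintegral_partialSum_succ_le (hX : IsRun mdp inp b μ X) (hh : h < mdp.H)
    (hf : IsExpSupermartingale mdp inp b h f) (k j : ℕ) :
    ∫⁻ ω, ENNReal.ofReal (Real.exp (partialSum mdp inp b h f (X ω) k (j + 1))) ∂μ
      ≤ ∫⁻ ω, ENNReal.ofReal (Real.exp (partialSum mdp inp b h f (X ω) k j)) ∂μ := by
  rcases Nat.lt_or_ge j (Fintype.card S * inp.T₀) with hj | hj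
  swap
  · refine lintegral_mono fun ω => ?_
    rw [partialSum_succ_of_le _ ((length_le mdp inp b _ k).trans hj)]
  have hmeas := measurableSet_historyCode (b := b) (k := k) (h := h) hX.measurable hj hh.le
  rw [lintegral_eq_sum_fibers μ (fun ω => historyCode mdp inp b (X ω) k j h) hmeas,
    lintegral_eq_sum_fibers μ (fun ω => historyCode mdp inp b (X ω) k j h) hmeas]
  refine Finset.sum_le_sum fun v _ => ?_
  by_cases hv : ∃ w : ℕ → ℕ → Fin inp.M → ℕ → S, historyCode mdp inp b w k j h = v
  swap
  · have : {ω | historyCode mdp inp b (X ω) k j h = v} = ∅ := by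
      ext ω
      simp only [Set.mem_ofPred_eq, Set.mem_empty_iff_false, iff_false]
      exact fun hc => hv ⟨_, hc⟩
    simp [this]
  obtain ⟨w, rfl⟩ := hv
  have hE : {ω | historyCode mdp inp b (X ω) k j h = historyCode mdp inp b w k j h}
      = {ω | SameHistory mdp inp b w (X ω) k j h} := by
    ext ω
    exact eq_comm.trans (historyCode_eq_iff hj hh.le)
  have hEm := measurableSet_sameHistory (b := b) (mdp := mdp) hX.measurable w k j h
  rw [hE]
  by_cases hlt : j < length mdp inp b w k
  · set z := ENNReal.ofReal (Real.exp (partialSum mdp inp b h f w k j)) with hz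
    have e1 : ∫⁻ ω in {ω | SameHistory mdp inp b w (X ω) k j h},
        ENNReal.ofReal (Real.exp (partialSum mdp inp b h f (X ω) k j)) ∂μ
        = z * μ {ω | SameHistory mdp inp b w (X ω) k j h} := by
      rw [← setLIntegral_const]
      refine setLIntegral_congr_fun hEm fun ω hω => ?_
      simp only [hz, partialSum_congr hh hf hω]
    have e2 : ∫⁻ ω in {ω | SameHistory mdp inp b w (X ω) k j h},
        ENNReal.ofReal (Real.exp (partialSum mdp inp b h f (X ω) k (j + 1))) ∂μ
        = z * ∫⁻ ω in {ω | SameHistory mdp inp b w (X ω) k j h},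
          ∏ m, ENNReal.ofReal (Real.exp (f w k j m (X ω k j m (h + 1)))) ∂μ := by
      rw [← lintegral_const_mul' _ _ ENNReal.ofReal_ne_top]
      refine setLIntegral_congr_fun hEm fun ω hω => ?_
      have hω' : SameHistory mdp inp b w (X ω) k j h := hω
      rw [partialSum_succ_of_lt _ (hω'.lt_length.1 hlt), ← partialSum_congr hh hf hω',
        Real.exp_add, ENNReal.ofReal_mul (Real.exp_pos _).le, Real.exp_sum,
        ENNReal.ofReal_prod_of_nonneg (fun _ _ => (Real.exp_pos _).le),
        hf.adapted w (X ω) k j hlt hω']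
    rw [e1, e2]
    exact mul_le_mul_right (setLIntegral_transition_le hX hh w hlt
      (fun m s => ENNReal.ofReal (Real.exp (f w k j m s))) fun m => hf.exp_le w k j m hlt) _
  · refine setLIntegral_mono' hEm fun ω hω => ?_
    have hω' : SameHistory mdp inp b w (X ω) k j h := hω
    rw [partialSum_succ_of_le]
    exact not_lt.1 fun hc => hlt (hω'.lt_length.2 hc)

/-- Episodes inside rounds: the start of round `k + 1` is round `k` after `S * T₀` episodes, when it
has certainly ended. -/
theorem lintegral_partialSum_le [IsProbabilityMeasure μ] (hX : IsRun mdp inp b μ X) (hh : h < mdp.H)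
    (hf : IsExpSupermartingale mdp inp b h f) (k j : ℕ) :
    ∫⁻ ω, ENNReal.ofReal (Real.exp (partialSum mdp inp b h f (X ω) k j)) ∂μ ≤ 1 := by
  induction k generalizing j with
  | zero =>
    induction j with
    | zero => simp [partialSum]
    | succ j ih => exact (lintegral_partialSum_succ_le hX hh hf _ j).trans ih
  | succ k ih =>
    induction j with
    | zero => simp_rw [partialSum_round]; exact ih _
    | succ j ih' => exact (lintegral_partialSum_succ_le hX hh hf _ j).trans ih'

/-- Markov's inequality for an exponential supermartingale. -/
theorem measure_le_partialSum_le [IsProbabilityMeasure μ] (hX : IsRun mdp inp b μ X)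
    (hh : h < mdp.H) (hf : IsExpSupermartingale mdp inp b h f) (K : ℕ) (u : ℝ) :
    μ {ω | u ≤ partialSum mdp inp b h f (X ω) K 0} ≤ ENNReal.ofReal (Real.exp (-u)) := by
  have hm : MeasurableSet {ω | u ≤ partialSum mdp inp b h f (X ω) K 0} :=
    measurableSet_of_sameHistory (mdp := mdp) (b := b) hX.measurable
      (fun w => u ≤ partialSum mdp inp b h f w K 0) K fun w w' hs hw => by
        rwa [← partialSum_congr hh hf hs]
  have h1 : ENNReal.ofReal (Real.exp u) * μ {ω | u ≤ partialSum mdp inp b h f (X ω) K 0} ≤ 1 := by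
    rw [← setLIntegral_const]
    refine le_trans (setLIntegral_mono' hm fun ω hω => ?_)
      ((setLIntegral_le_lintegral _ _).trans (lintegral_partialSum_le hX hh hf K 0))
    exact ENNReal.ofReal_le_ofReal (Real.exp_le_exp.2 hω)
  have h2 : ENNReal.ofReal (Real.exp (-u)) * ENNReal.ofReal (Real.exp u) = 1 := by
    rw [← ENNReal.ofReal_mul (Real.exp_pos _).le, ← Real.exp_add]; simp
  calc _ = ENNReal.ofReal (Real.exp (-u)) * (ENNReal.ofReal (Real.exp u)
        * μ {ω | u ≤ partialSum mdp inp b h f (X ω) K 0}) := by rw [← mul_assoc, h2, one_mul]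
    _ ≤ ENNReal.ofReal (Real.exp (-u)) * 1 := mul_le_mul_right h1 _
    _ = _ := mul_one _

end Integral

end

end FedQ

/-! ### Unrolling the updates into weighted sums over visits. -/

namespace FedQ

noncomputable section

variable {S A : Type*} [Fintype S] [Fintype A] [DecidableEq S] [DecidableEq A]

section Round

variable (mdp : MDP S A) (inp : Input S A) (b : ℕ → ℝ)
variable (st : Server S A) (w : ℕ → Fin inp.M → ℕ → S)

theorem lt_position {j : ℕ} {m : Fin inp.M} {h : ℕ} {x : S} {a : A}
    (hit : Hit inp st w j m h x a) : st.N h x a < position inp st w j m h x a := by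
  have : 0 < (((Finset.univ : Finset (Fin inp.M)).filter fun m' => Hit inp st w j m' h x a).filter
      (· ≤ m)).card := Finset.card_pos.2 ⟨m, Finset.mem_filter.2
      ⟨Finset.mem_filter.2 ⟨Finset.mem_univ m, hit⟩, le_rfl⟩⟩
  unfold position; omega

theorem position_le {j n : ℕ} (hj : j < n) (m : Fin inp.M) (h : ℕ) (x : S) (a : A) :
    position inp st w j m h x a ≤ newN inp st w n h x a := by
  have h1 : (((Finset.univ : Finset (Fin inp.M)).filter fun m' => Hit inp st w j m' h x a).filter
      (· ≤ m)).card ≤ ((Finset.univ : Finset (Fin inp.M)).filter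
        fun m' => Hit inp st w j m' h x a).card := Finset.card_filter_le _ _
  have h2 := totalVisits_succ inp st w j h x a
  have h3 : totalVisits inp st w (j + 1) h x a ≤ totalVisits inp st w n h x a :=
    Finset.sum_le_sum fun m _ => visits_mono inp st w hj m h x a
  unfold position newN; omega

theorem not_hit_of_visits_eq_zero {n : ℕ} {m : Fin inp.M} {h : ℕ} {x : S} {a : A}
    (hv : visits inp st w n m h x a = 0) {j : ℕ} (hj : j < n) : ¬ Hit inp st w j m h x a := by
  intro hc
  rw [visits, Finset.card_eq_zero] at hv
  have : j ∈ (∅ : Finset ℕ) := by rw [← hv]; exact Finset.mem_filter.2 ⟨Finset.mem_range.2 hj, hc⟩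
  simp at this

theorem not_hit_of_totalVisits_eq_zero {n h : ℕ} {x : S} {a : A}
    (hv : totalVisits inp st w n h x a = 0) {j : ℕ} (hj : j < n) (m : Fin inp.M) :
    ¬ Hit inp st w j m h x a :=
  not_hit_of_visits_eq_zero inp st w (Finset.sum_eq_zero_iff.1 hv m (Finset.mem_univ m)) hj

theorem totalVisits_eq_zero_of_ne {n h : ℕ} {x : S} {a : A} (ha : a ≠ st.policy h x) :
    totalVisits inp st w n h x a = 0 := by
  refine Finset.sum_eq_zero fun m _ => ?_
  rw [visits, Finset.card_eq_zero, Finset.filter_eq_empty_iff]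
  rintro j - ⟨rfl, h2⟩
  exact ha h2.symm

/-- The sum of `g j m` over the visits of `(h, x, a)` in the first `n` episodes of the round. -/
def roundSum (n h : ℕ) (x : S) (a : A) (g : ℕ → Fin inp.M → ℝ) : ℝ :=
  ∑ j ∈ Finset.range n, ∑ m, if Hit inp st w j m h x a then g j m else 0

variable {mdp inp b st w}

theorem roundSum_congr {n h : ℕ} {x : S} {a : A} {g g' : ℕ → Fin inp.M → ℝ}
    (hg : ∀ j < n, ∀ m, Hit inp st w j m h x a → g j m = g' j m) :
    roundSum inp st w n h x a g = roundSum inp st w n h x a g' := by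
  refine Finset.sum_congr rfl fun j hj => Finset.sum_congr rfl fun m _ => ?_
  split_ifs with hh
  · exact hg j (Finset.mem_range.1 hj) m hh
  · rfl

theorem roundSum_mono {n h : ℕ} {x : S} {a : A} {g g' : ℕ → Fin inp.M → ℝ}
    (hg : ∀ j < n, ∀ m, Hit inp st w j m h x a → g j m ≤ g' j m) :
    roundSum inp st w n h x a g ≤ roundSum inp st w n h x a g' := by
  refine Finset.sum_le_sum fun j hj => Finset.sum_le_sum fun m _ => ?_
  split_ifs with hh
  · exact hg j (Finset.mem_range.1 hj) m hh
  · exact le_rfl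

theorem roundSum_add {n h : ℕ} {x : S} {a : A} (g g' : ℕ → Fin inp.M → ℝ) :
    roundSum inp st w n h x a (fun j m => g j m + g' j m)
      = roundSum inp st w n h x a g + roundSum inp st w n h x a g' := by
  unfold roundSum
  simp only [← Finset.sum_add_distrib]
  refine Finset.sum_congr rfl fun j hj => Finset.sum_congr rfl fun m _ => ?_
  split_ifs <;> simp

theorem roundSum_mul_left {n h : ℕ} {x : S} {a : A} (c : ℝ) (g : ℕ → Fin inp.M → ℝ) :
    roundSum inp st w n h x a (fun j m => c * g j m) = c * roundSum inp st w n h x a g := by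
  unfold roundSum
  simp only [Finset.mul_sum, mul_ite, mul_zero]

theorem roundSum_sum {ι : Type*} (s : Finset ι) {n h : ℕ} {x : S} {a : A}
    (g : ι → ℕ → Fin inp.M → ℝ) :
    roundSum inp st w n h x a (fun j m => ∑ i ∈ s, g i j m)
      = ∑ i ∈ s, roundSum inp st w n h x a (g i) := by
  unfold roundSum
  rw [Finset.sum_comm (s := s)]
  refine Finset.sum_congr rfl fun j _ => ?_
  rw [Finset.sum_comm (s := s)]
  refine Finset.sum_congr rfl fun m _ => ?_
  split_ifs <;> simp

theorem roundSum_one (n h : ℕ) (x : S) (a : A) :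
    roundSum inp st w n h x a (fun _ _ => 1) = totalVisits inp st w n h x a :=
  (totalVisits_eq_sum inp st w n h x a).symm

theorem roundSum_of_totalVisits_eq_zero {n h : ℕ} {x : S} {a : A}
    (hv : totalVisits inp st w n h x a = 0) (g : ℕ → Fin inp.M → ℝ) :
    roundSum inp st w n h x a g = 0 :=
  Finset.sum_eq_zero fun _ hj => Finset.sum_eq_zero fun m _ =>
    if_neg (not_hit_of_totalVisits_eq_zero inp st w hv (Finset.mem_range.1 hj) m)

theorem roundSum_position (f : ℕ → ℝ) (n h : ℕ) (x : S) (a : A) :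
    roundSum inp st w n h x a (fun j m => f (position inp st w j m h x a))
      = ∑ i ∈ Finset.Ioc (st.N h x a) (newN inp st w n h x a), f i :=
  sum_position inp st w f n h x a

theorem roundSum_div_totalVisits (n h : ℕ) (x : S) (a : A) :
    roundSum inp st w n h x a (fun j m => st.V (h + 1) (w j m (h + 1)))
      / totalVisits inp st w n h x a = globalReturn inp st w n h x a := by
  unfold globalReturn roundSum
  congr 1
  rw [Finset.sum_comm]
  refine Finset.sum_congr rfl fun m _ => ?_
  unfold localReturn
  rcases Nat.eq_zero_or_pos (visits inp st w n m h x a) with h0 | h0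
  · rw [h0]
    simp only [Nat.cast_zero, mul_zero]
    exact Finset.sum_eq_zero fun j hj =>
      if_neg (not_hit_of_visits_eq_zero inp st w h0 (Finset.mem_range.1 hj))
  · have : (visits inp st w n m h x a : ℝ) ≠ 0 := by positivity
    rw [div_mul_cancel₀ _ this]

/-- If all visits take place in the last episode of the round, then every agent contributes at most
one sample. -/
theorem roundSum_weight_of_last {n h : ℕ} {x : S} {a : A}
    (hv : ∀ m, visits inp st w n m h x a = 0) (f : ℕ → ℝ) :
    roundSum inp st w (n + 1) h x a
        (fun j m => f (position inp st w j m h x a) * st.V (h + 1) (w j m (h + 1)))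
      = ∑ m ∈ (Finset.univ : Finset (Fin inp.M)).filter
            (fun m => 0 < visits inp st w (n + 1) m h x a),
          f (st.N h x a + agentRank inp st w (n + 1) m h x a)
            * localReturn inp st w (n + 1) m h x a := by
  have hno : ∀ j < n, ∀ m, ¬ Hit inp st w j m h x a := fun j hj m =>
    not_hit_of_visits_eq_zero inp st w (hv m) hj
  have hvis : ∀ m, visits inp st w (n + 1) m h x a = if Hit inp st w n m h x a then 1 else 0 := by
    intro m; rw [visits_succ, hv m, zero_add]
  have hpos : ∀ m, 0 < visits inp st w (n + 1) m h x a ↔ Hit inp st w n m h x a := by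
    intro m; rw [hvis]
    split_ifs with hc
    · exact iff_of_true Nat.one_pos hc
    · exact iff_of_false (lt_irrefl 0) hc
  unfold roundSum
  rw [Finset.sum_range_succ, Finset.sum_eq_zero, zero_add, Finset.sum_filter]
  · refine Finset.sum_congr rfl fun m _ => ?_
    simp only [hpos]
    split_ifs with hm
    · congr 1
      · unfold position agentRank totalVisits
        simp only [hpos, hv, Finset.sum_const_zero, add_zero, Finset.filter_filter]
        congr 3
        ext m'
        simp [and_comm]
      · unfold localReturn
        rw [hvis, if_pos hm, Finset.sum_range_succ, Finset.sum_eq_zero, zero_add]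
        · simp only [Nat.cast_one, div_one]
          exact (if_pos hm).symm
        · exact fun j hj => if_neg (hno j (Finset.mem_range.1 hj) m)
    · rfl
  · exact fun j hj => Finset.sum_eq_zero fun m _ => if_neg (hno j (Finset.mem_range.1 hj) m)

end Round

section Run

variable (mdp : MDP S A) (inp : Input S A) (b : ℕ → ℝ) (w : ℕ → ℕ → Fin inp.M → ℕ → S)

/-- The sum of `g k j m` over the visits of `(h, x, a)` in round `k`. -/
def visitSum (h : ℕ) (x : S) (a : A) (g : ℕ → ℕ → Fin inp.M → ℝ) (k : ℕ) : ℝ :=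
  roundSum inp (server mdp inp b w k) (w k) (length mdp inp b w k) h x a (g k)

/-- The visit count of `(h, x, a)` before round `k`. -/
abbrev count (h : ℕ) (x : S) (a : A) (k : ℕ) : ℕ := (server mdp inp b w k).N h x a

/-- The number of visits of `(h, x, a)` in round `k`. -/
abbrev roundCount (h : ℕ) (x : S) (a : A) (k : ℕ) : ℕ :=
  totalVisits inp (server mdp inp b w k) (w k) (length mdp inp b w k) h x a

/-- The number of the visit of `(h, x, a)` by agent `m` in episode `j` of round `k`. -/
abbrev pos (h : ℕ) (x : S) (a : A) (k j : ℕ) (m : Fin inp.M) : ℕ :=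
  position inp (server mdp inp b w k) (w k) j m h x a

theorem count_succ (h : ℕ) (x : S) (a : A) (k : ℕ) :
    count mdp inp b w h x a (k + 1) = count mdp inp b w h x a k + roundCount mdp inp b w h x a k :=
  rfl

theorem count_le_succ (h : ℕ) (x : S) (a : A) (k : ℕ) :
    count mdp inp b w h x a k ≤ count mdp inp b w h x a (k + 1) := by rw [count_succ]; omega

theorem count_mono (h : ℕ) (x : S) (a : A) : Monotone (count mdp inp b w h x a) :=
  monotone_nat_of_le_succ (count_le_succ mdp inp b w h x a)

theorem count_zero (h : ℕ) (x : S) (a : A) : count mdp inp b w h x a 0 = 0 := rfl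

/-- The weight of the `i`-th sample right after round `k`, if it is collected in round `k`. -/
def roundWeight (h : ℕ) (x : S) (a : A) (k i : ℕ) : ℝ :=
  if count mdp inp b w h x a k < 2 * inp.M * mdp.H * (mdp.H + 1) then
    weight mdp.H (count mdp inp b w h x a (k + 1)) i
  else (1 - keep mdp.H (count mdp inp b w h x a k) (count mdp inp b w h x a (k + 1)))
    / roundCount mdp inp b w h x a k

/-- The weighted average of `g` over the visits before round `k` that the updates produce. -/
def aggregate (h : ℕ) (x : S) (a : A) (g : ℕ → ℕ → Fin inp.M → ℝ) : ℕ → ℝ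
  | 0 => 0
  | k + 1 => keep mdp.H (count mdp inp b w h x a k) (count mdp inp b w h x a (k + 1))
        * aggregate h x a g k
      + visitSum mdp inp b w h x a
          (fun k j m => roundWeight mdp inp b w h x a k (pos mdp inp b w h x a k j m) * g k j m) k

variable {mdp inp b w} {h : ℕ} {x : S} {a : A}

theorem lt_pos {k j : ℕ} {m : Fin inp.M} (hit : Hit inp (server mdp inp b w k) (w k) j m h x a) :
    count mdp inp b w h x a k < pos mdp inp b w h x a k j m :=
  lt_position _ _ _ hit

theorem pos_le {k j : ℕ} (hj : j < length mdp inp b w k) (m : Fin inp.M) :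
    pos mdp inp b w h x a k j m ≤ count mdp inp b w h x a (k + 1) :=
  position_le _ _ _ hj m h x a

/-- Averaging the increasing weights over a round keeps them above the weight of the last visit
before the round. This joins consecutive rounds monotonically. -/
theorem weight_le_roundWeight {k i : ℕ}
    (h1 : count mdp inp b w h x a k < i) (h2 : i ≤ count mdp inp b w h x a (k + 1)) :
    weight mdp.H (count mdp inp b w h x a (k + 1)) (count mdp inp b w h x a k)
      ≤ roundWeight mdp inp b w h x a k i := by
  have hH := mdp.H_pos
  unfold roundWeight
  split_ifs with hc
  · exact weight_mono hH h1.le h2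
  · have hn : (0 : ℝ) < roundCount mdp inp b w h x a k := by
      have := count_succ mdp inp b w h x a k
      exact_mod_cast (show 0 < roundCount mdp inp b w h x a k by omega)
    rw [le_div_iff₀ hn, ← sum_weight mdp.H (count_le_succ mdp inp b w h x a k)]
    have : ∑ _i ∈ Finset.Ioc (count mdp inp b w h x a k) (count mdp inp b w h x a (k + 1)),
        weight mdp.H (count mdp inp b w h x a (k + 1)) (count mdp inp b w h x a k)
        = weight mdp.H (count mdp inp b w h x a (k + 1)) (count mdp inp b w h x a k)
          * roundCount mdp inp b w h x a k := by
      rw [Finset.sum_const, Nat.card_Ioc, count_succ, Nat.add_sub_cancel_left, nsmul_eq_mul,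
        mul_comm]
    rw [← this]
    refine Finset.sum_le_sum fun i hi => ?_
    have hi := Finset.mem_Ioc.1 hi
    exact weight_mono hH hi.1.le hi.2

theorem roundWeight_nonneg (k i : ℕ) : 0 ≤ roundWeight mdp inp b w h x a k i := by
  unfold roundWeight
  split_ifs
  · exact weight_nonneg _ _ mdp.H_pos
  · exact div_nonneg (sub_nonneg.2 (keep_le_one _ _ mdp.H_pos)) (Nat.cast_nonneg _)

theorem roundWeight_le_lrate {k i : ℕ} (h2 : i ≤ count mdp inp b w h x a (k + 1)) :
    roundWeight mdp inp b w h x a k i ≤ lrate mdp.H (count mdp inp b w h x a (k + 1)) := by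
  have hH := mdp.H_pos
  unfold roundWeight
  split_ifs with hc
  · exact weight_le_lrate hH h2
  · rcases Nat.eq_zero_or_pos (roundCount mdp inp b w h x a k) with h0 | h0
    · rw [h0]; simpa using (lrate_pos _ _ hH).le
    have hn : (0 : ℝ) < roundCount mdp inp b w h x a k := by exact_mod_cast h0
    rw [div_le_iff₀ hn, ← sum_weight mdp.H (count_le_succ mdp inp b w h x a k)]
    have : ∑ _i ∈ Finset.Ioc (count mdp inp b w h x a k) (count mdp inp b w h x a (k + 1)),
        lrate mdp.H (count mdp inp b w h x a (k + 1))
        = lrate mdp.H (count mdp inp b w h x a (k + 1)) * roundCount mdp inp b w h x a k := by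
      rw [Finset.sum_const, Nat.card_Ioc, count_succ, Nat.add_sub_cancel_left, nsmul_eq_mul,
        mul_comm]
    rw [← this]
    exact Finset.sum_le_sum fun i hi => weight_le_lrate hH (Finset.mem_Ioc.1 hi).2

theorem roundWeight_le_succ {k i : ℕ} (h2 : i < count mdp inp b w h x a (k + 1)) :
    roundWeight mdp inp b w h x a k i ≤ roundWeight mdp inp b w h x a k (i + 1) := by
  unfold roundWeight
  split_ifs with hc
  · exact weight_le_succ mdp.H_pos h2
  · exact le_rfl

theorem sum_roundWeight (k : ℕ) :
    ∑ i ∈ Finset.Ioc (count mdp inp b w h x a k) (count mdp inp b w h x a (k + 1)),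
      roundWeight mdp inp b w h x a k i
      = 1 - keep mdp.H (count mdp inp b w h x a k) (count mdp inp b w h x a (k + 1)) := by
  unfold roundWeight
  split_ifs with hc
  · exact sum_weight mdp.H (count_le_succ mdp inp b w h x a k)
  · rw [Finset.sum_const, Nat.card_Ioc, nsmul_eq_mul, count_succ, Nat.add_sub_cancel_left]
    rcases Nat.eq_zero_or_pos (roundCount mdp inp b w h x a k) with h0 | h0
    · rw [h0]; simp [keep_self]
    · have hn : (roundCount mdp inp b w h x a k : ℝ) ≠ 0 := by
        exact_mod_cast h0.ne'
      rw [mul_div_cancel₀ _ hn]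

theorem visitSum_roundWeight (k : ℕ) :
    visitSum mdp inp b w h x a
      (fun k j m => roundWeight mdp inp b w h x a k (pos mdp inp b w h x a k j m)) k
      = 1 - keep mdp.H (count mdp inp b w h x a k) (count mdp inp b w h x a (k + 1)) := by
  rw [← sum_roundWeight]
  exact roundSum_position _ _ _ _ _

theorem visitSum_add (g g' : ℕ → ℕ → Fin inp.M → ℝ) (k : ℕ) :
    visitSum mdp inp b w h x a (fun k j m => g k j m + g' k j m) k
      = visitSum mdp inp b w h x a g k + visitSum mdp inp b w h x a g' k :=
  roundSum_add _ _

theorem visitSum_mul_left (c : ℝ) (g : ℕ → ℕ → Fin inp.M → ℝ) (k : ℕ) :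
    visitSum mdp inp b w h x a (fun k j m => c * g k j m) k
      = c * visitSum mdp inp b w h x a g k :=
  roundSum_mul_left _ _

theorem aggregate_add (g g' : ℕ → ℕ → Fin inp.M → ℝ) (k : ℕ) :
    aggregate mdp inp b w h x a (fun k j m => g k j m + g' k j m) k
      = aggregate mdp inp b w h x a g k + aggregate mdp inp b w h x a g' k := by
  induction k with
  | zero => simp [aggregate]
  | succ k ih =>
    simp only [aggregate, ih, mul_add, visitSum_add]
    ring

/-- The aggregate and the surviving initial value together have total weight one. -/
theorem aggregate_const (c : ℝ) (k : ℕ) :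
    aggregate mdp inp b w h x a (fun _ _ _ => c) k
      = c * (1 - keep mdp.H 0 (count mdp inp b w h x a k)) := by
  induction k with
  | zero => simp [aggregate, count_zero, keep_self]
  | succ k ih =>
    rw [aggregate, ih]
    have e : visitSum mdp inp b w h x a (fun k j m =>
        roundWeight mdp inp b w h x a k (pos mdp inp b w h x a k j m) * c) k
        = c * (1 - keep mdp.H (count mdp inp b w h x a k) (count mdp inp b w h x a (k + 1))) := by
      rw [← visitSum_roundWeight, ← visitSum_mul_left]
      simp only [mul_comm]
    rw [e, ← keep_mul_keep mdp.H (Nat.zero_le _) (count_le_succ mdp inp b w h x a k)]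
    ring

theorem aggregate_mono {g g' : ℕ → ℕ → Fin inp.M → ℝ} {k : ℕ}
    (hg : ∀ k' < k, ∀ j m, g k' j m ≤ g' k' j m) :
    aggregate mdp inp b w h x a g k ≤ aggregate mdp inp b w h x a g' k := by
  induction k with
  | zero => simp [aggregate]
  | succ k ih =>
    rw [aggregate, aggregate]
    refine add_le_add (mul_le_mul_of_nonneg_left (ih fun k' hk' => hg k' (by omega))
      (keep_nonneg _ _ _)) (roundSum_mono fun j _ m _ =>
        mul_le_mul_of_nonneg_left (hg k (by omega) j m) (roundWeight_nonneg _ _))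

theorem aggregate_nonneg {g : ℕ → ℕ → Fin inp.M → ℝ} {k : ℕ}
    (hg : ∀ k' < k, ∀ j m, 0 ≤ g k' j m) : 0 ≤ aggregate mdp inp b w h x a g k := by
  have := aggregate_mono (mdp := mdp) (b := b) (w := w) (h := h) (x := x) (a := a)
    (g := fun _ _ _ => 0) hg
  rwa [aggregate_const, zero_mul] at this

theorem aggregate_le {g : ℕ → ℕ → Fin inp.M → ℝ} {k : ℕ} {c : ℝ} (hc : 0 ≤ c)
    (hg : ∀ k' < k, ∀ j m, g k' j m ≤ c) : aggregate mdp inp b w h x a g k ≤ c := by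
  have := aggregate_mono (mdp := mdp) (b := b) (w := w) (h := h) (x := x) (a := a)
    (g' := fun _ _ _ => c) hg
  rw [aggregate_const] at this
  nlinarith [keep_nonneg mdp.H 0 (count mdp inp b w h x a k)]

theorem sum_visitSum_pos (f : ℕ → ℝ) (K : ℕ) :
    ∑ k ∈ Finset.range K, visitSum mdp inp b w h x a
        (fun k j m => f (pos mdp inp b w h x a k j m)) k
      = ∑ i ∈ Finset.Ioc 0 (count mdp inp b w h x a K), f i := by
  induction K with
  | zero => simp [count_zero]
  | succ K ih =>
    rw [Finset.sum_range_succ, ih]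
    refine Eq.trans ?_ (Finset.sum_Ioc_consecutive f (Nat.zero_le _)
      (count_le_succ mdp inp b w h x a K))
    congr 1
    exact roundSum_position _ _ _ _ _

/-- The aggregation is a weighted sum with weights that depend on the visit numbers only. -/
theorem exists_aggregate_eq (k : ℕ) : ∃ W : ℕ → ℝ, W 0 = 0
    ∧ (∀ i < count mdp inp b w h x a k, W i ≤ W (i + 1))
    ∧ W (count mdp inp b w h x a k) ≤ lrate mdp.H (count mdp inp b w h x a k)
    ∧ ∑ i ∈ Finset.Ioc 0 (count mdp inp b w h x a k), W i ≤ 1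
    ∧ ∀ g, aggregate mdp inp b w h x a g k = ∑ k' ∈ Finset.range k,
      visitSum mdp inp b w h x a (fun k' j m => W (pos mdp inp b w h x a k' j m) * g k' j m) k' := by
  have hH := mdp.H_pos
  induction k with
  | zero =>
    refine ⟨fun _ => 0, rfl, fun _ _ => le_rfl, (lrate_pos _ _ hH).le, by simp, fun g => ?_⟩
    simp [aggregate]
  | succ k ih =>
    obtain ⟨W, hW0, hWm, hWN, hWs, hWg⟩ := ih
    set N := count mdp inp b w h x a k with hN
    set N' := count mdp inp b w h x a (k + 1) with hN'
    have hNN : N ≤ N' := count_le_succ mdp inp b w h x a k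
    have hk0 := keep_nonneg mdp.H N N'
    -- An update scales the old weights by `keep` and appends those of the new round.
    refine ⟨fun i => if i ≤ N then keep mdp.H N N' * W i else roundWeight mdp inp b w h x a k i,
      by simp [hW0], fun i hi => ?_, ?_, ?_, fun g => ?_⟩
    · beta_reduce
      rcases lt_trichotomy i N with hc | hc | hc
      · rw [if_pos hc.le, if_pos (show i + 1 ≤ N from hc)]
        exact mul_le_mul_of_nonneg_left (hWm i hc) hk0
      · subst hc
        rw [if_pos le_rfl, if_neg (by omega)]
        -- At the junction, the invariant `W N ≤ α_N` turns the scaled old weight into at most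
        -- `θ_{N'}^N`.
        refine le_trans ?_ (weight_le_roundWeight (Nat.lt_succ_self _) hi)
        rw [weight_eq, mul_comm]
        exact mul_le_mul_of_nonneg_right hWN hk0
      · rw [if_neg (by omega), if_neg (by omega)]
        exact roundWeight_le_succ hi
    · beta_reduce
      rcases hNN.eq_or_lt with hc | hc
      · rw [if_pos hc.ge, ← hc, keep_self, one_mul]; exact hWN
      · rw [if_neg (by omega)]; exact roundWeight_le_lrate le_rfl
    · rw [← Finset.sum_Ioc_consecutive _ (Nat.zero_le N) hNN]
      have e1 : ∑ i ∈ Finset.Ioc 0 N, (if i ≤ N then keep mdp.H N N' * W i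
          else roundWeight mdp inp b w h x a k i) = keep mdp.H N N' * ∑ i ∈ Finset.Ioc 0 N, W i := by
        rw [Finset.mul_sum]
        exact Finset.sum_congr rfl fun i hi => if_pos (Finset.mem_Ioc.1 hi).2
      have e2 : ∑ i ∈ Finset.Ioc N N', (if i ≤ N then keep mdp.H N N' * W i
          else roundWeight mdp inp b w h x a k i) = 1 - keep mdp.H N N' := by
        rw [← sum_roundWeight]
        exact Finset.sum_congr rfl fun i hi => if_neg (by have := Finset.mem_Ioc.1 hi; omega)
      rw [e1, e2]
      nlinarith
    · rw [aggregate, hWg, Finset.sum_range_succ, Finset.mul_sum]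
      congr 1
      · refine Finset.sum_congr rfl fun k' hk' => ?_
        rw [← visitSum_mul_left]
        refine roundSum_congr fun j hj m hit => ?_
        have h1 : pos mdp inp b w h x a k' j m ≤ N :=
          (pos_le hj m).trans (count_mono mdp inp b w h x a (Finset.mem_range.1 hk'))
        beta_reduce
        rw [if_pos h1, mul_assoc]
      · refine roundSum_congr fun j hj m hit => ?_
        have h1 : N < pos mdp inp b w h x a k j m := lt_pos hit
        beta_reduce
        rw [if_neg (by omega)]

variable (mdp inp b w) in
/-- The sum of `g` over the visits with numbers in `(i, n]` in the first `K` rounds. -/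
def windowSum (h : ℕ) (x : S) (a : A) (g : ℕ → ℕ → Fin inp.M → ℝ) (i n K : ℕ) : ℝ :=
  ∑ k ∈ Finset.range K, visitSum mdp inp b w h x a (fun k j m =>
    if i < pos mdp inp b w h x a k j m ∧ pos mdp inp b w h x a k j m ≤ n then g k j m else 0) k

/-- Later rounds have visit numbers beyond the window. Thus the concentration events need to be
stated only for the final round `K`. -/
theorem windowSum_eq (g : ℕ → ℕ → Fin inp.M → ℝ) (i : ℕ) {k K : ℕ} (hk : k ≤ K) :
    windowSum mdp inp b w h x a g i (count mdp inp b w h x a k) K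
      = windowSum mdp inp b w h x a g i (count mdp inp b w h x a k) k := by
  unfold windowSum
  symm
  refine Finset.sum_subset (Finset.range_subset_range.2 hk) fun k' _ hk' => ?_
  have hk' : k ≤ k' := by simpa using hk'
  unfold visitSum roundSum
  refine Finset.sum_eq_zero fun j _ => Finset.sum_eq_zero fun m _ => ?_
  by_cases h1 : Hit inp (server mdp inp b w k') (w k') j m h x a
  · have h3 := lt_pos h1
    have h4 := count_mono mdp inp b w h x a hk'
    rw [if_pos h1]
    exact if_neg (by omega)
  · exact if_neg h1

theorem windowSum_one {i n K : ℕ} (hi : i ≤ n) (hn : n ≤ count mdp inp b w h x a K) :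
    windowSum mdp inp b w h x a (fun _ _ _ => 1) i n K = (n : ℝ) - i := by
  unfold windowSum
  rw [sum_visitSum_pos (fun q => if i < q ∧ q ≤ n then (1 : ℝ) else 0), Finset.sum_boole]
  have : (Finset.Ioc 0 (count mdp inp b w h x a K)).filter (fun q => i < q ∧ q ≤ n)
      = Finset.Ioc i n := by
    ext q; simp only [Finset.mem_filter, Finset.mem_Ioc]; omega
  rw [this, Nat.card_Ioc, Nat.cast_sub hi]

/-- Writing `W q` as the sum of its increments and exchanging sums turns the weighted sum into a
combination of window sums, to which `abs_abel_sum_le` applies. -/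
theorem abs_aggregate_le {g : ℕ → ℕ → Fin inp.M → ℝ} {k K : ℕ} {L : ℝ} (hL : 0 ≤ L) (hk : k ≤ K)
    (hpos : 0 < count mdp inp b w h x a k)
    (hg : ∀ i < count mdp inp b w h x a k,
      |windowSum mdp inp b w h x a g i (count mdp inp b w h x a k) K|
        ≤ L * Real.sqrt ((count mdp inp b w h x a k : ℝ) - i)) :
    |aggregate mdp inp b w h x a g k|
      ≤ 3 / 2 * L * Real.sqrt (mdp.H / count mdp inp b w h x a k) := by
  obtain ⟨W, hW0, hWm, hWN, hWs, hWg⟩ := exists_aggregate_eq (mdp := mdp) (b := b) (w := w)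
    (h := h) (x := x) (a := a) k
  set N := count mdp inp b w h x a k with hN
  have key : aggregate mdp inp b w h x a g k
      = ∑ i ∈ Finset.range N, (W (i + 1) - W i) * windowSum mdp inp b w h x a g i N K := by
    rw [hWg]
    simp_rw [hN, windowSum_eq g _ hk, ← hN]
    unfold windowSum
    simp_rw [Finset.mul_sum]
    rw [Finset.sum_comm]
    refine Finset.sum_congr rfl fun k' hk' => ?_
    simp_rw [← visitSum_mul_left]
    unfold visitSum
    rw [← roundSum_sum]
    refine roundSum_congr fun j hj m hit => ?_
    have h1 : pos mdp inp b w h x a k' j m ≤ N :=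
      (pos_le hj m).trans (count_mono mdp inp b w h x a (Finset.mem_range.1 hk'))
    set q := pos mdp inp b w h x a k' j m
    have h2 : ∀ q ≤ N, ∑ i ∈ Finset.range N, (if i < q then W (i + 1) - W i else 0) = W q := by
      intro q hq
      rw [← Finset.sum_filter]
      have : (Finset.range N).filter (fun i => i < q) = Finset.range q := by
        ext i; simp only [Finset.mem_filter, Finset.mem_range]; omega
      rw [this, Finset.sum_range_sub, hW0, sub_zero]
    beta_reduce
    rw [show pos mdp inp b w h x a k' j m = q from rfl, ← h2 q h1, Finset.sum_mul]
    refine Finset.sum_congr rfl fun i _ => ?_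
    simp only [h1, and_true]
    split_ifs <;> simp
  rw [key]
  exact abs_abel_sum_le mdp.H_pos hpos hL hW0 hWm hWN hWs hg

variable (mdp inp b w) in
/-- The accumulated bonus. -/
def bonusSum (h : ℕ) (x : S) (a : A) (k : ℕ) : ℝ :=
  ∑ i ∈ Finset.Ioc 0 (count mdp inp b w h x a k), weight mdp.H (count mdp inp b w h x a k) i * b i

theorem bonusSum_succ (k : ℕ) : bonusSum mdp inp b w h x a (k + 1)
    = keep mdp.H (count mdp inp b w h x a k) (count mdp inp b w h x a (k + 1))
        * bonusSum mdp inp b w h x a k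
      + aggBonus mdp inp b (server mdp inp b w k) (w k) (length mdp inp b w k) h x a / 2 := by
  have hNN := count_le_succ mdp inp b w h x a k
  unfold bonusSum aggBonus
  rw [← Finset.sum_Ioc_consecutive _ (Nat.zero_le _) hNN, mul_div_cancel_left₀ _ two_ne_zero,
    Finset.mul_sum]
  congr 1
  refine Finset.sum_congr rfl fun i hi => ?_
  rw [← weight_mul_keep mdp.H (Finset.mem_Ioc.1 hi).2 hNN]
  ring

/-- Induction over the rounds. Both update rules fit one recursion because `roundWeight` switches
between individual weights and equal weights at the same count as the algorithm. -/
theorem Q_eq [Nonempty S] (hh : h < mdp.H) (k : ℕ) :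
    (server mdp inp b w k).Q h x a = keep mdp.H 0 (count mdp inp b w h x a k) * mdp.H
      + aggregate mdp inp b w h x a (fun k j m =>
          mdp.r h x a + (server mdp inp b w k).V (h + 1) (w k j m (h + 1))) k
      + bonusSum mdp inp b w h x a k := by
  induction k with
  | zero => simp [count_zero, keep_self, aggregate, bonusSum, server, Server.init]
  | succ k ih =>
    have hNN := count_le_succ mdp inp b w h x a k
    rw [bonusSum_succ, aggregate, ← keep_mul_keep mdp.H (Nat.zero_le _) hNN]
    have hQ : (server mdp inp b w (k + 1)).Q h x a
        = newQ mdp inp b (server mdp inp b w k) (w k) (length mdp inp b w k) h x a := rfl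
    have hagg : aggRate mdp inp (server mdp inp b w k) (w k) (length mdp inp b w k) h x a
        = 1 - keep mdp.H (count mdp inp b w h x a k) (count mdp inp b w h x a (k + 1)) := rfl
    have hsplit : visitSum mdp inp b w h x a (fun k j m =>
        roundWeight mdp inp b w h x a k (pos mdp inp b w h x a k j m) *
          (mdp.r h x a + (server mdp inp b w k).V (h + 1) (w k j m (h + 1)))) k
        = (1 - keep mdp.H (count mdp inp b w h x a k) (count mdp inp b w h x a (k + 1)))
            * mdp.r h x a
          + visitSum mdp inp b w h x a (fun k j m =>
            roundWeight mdp inp b w h x a k (pos mdp inp b w h x a k j m) *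
              (server mdp inp b w k).V (h + 1) (w k j m (h + 1))) k := by
      rw [← visitSum_roundWeight, mul_comm, ← visitSum_mul_left, ← visitSum_add]
      refine roundSum_congr fun j _ m _ => ?_
      ring
    rw [hQ, hsplit]
    by_cases h0 : roundCount mdp inp b w h x a k = 0
    · have hN0 : count mdp inp b w h x a (k + 1) = count mdp inp b w h x a k := by
        rw [count_succ, h0, add_zero]
      have e0 : aggBonus mdp inp b (server mdp inp b w k) (w k) (length mdp inp b w k) h x a = 0 := by
        unfold aggBonus
        have : newN inp (server mdp inp b w k) (w k) (length mdp inp b w k) h x a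
          = (server mdp inp b w k).N h x a := hN0
        rw [this]; simp
      have e1 : newQ mdp inp b (server mdp inp b w k) (w k) (length mdp inp b w k) h x a
          = (server mdp inp b w k).Q h x a := by
        unfold newQ
        exact if_pos (Or.inr h0)
      have e2 := roundSum_of_totalVisits_eq_zero h0 (fun j m =>
        roundWeight mdp inp b w h x a k (pos mdp inp b w h x a k j m) *
              (server mdp inp b w k).V (h + 1) (w k j m (h + 1)))
      unfold visitSum
      rw [e0, e1, e2, hN0, keep_self, ih]
      ring
    · have ha : a = (server mdp inp b w k).policy h x := by
        by_contra hc
        exact h0 (totalVisits_eq_zero_of_ne inp _ _ hc)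
      unfold newQ
      rw [if_neg (by push Not; exact ⟨ha, h0⟩)]
      -- Below `i₀` the threshold is one, so all visits lie in the last episode and each local
      -- average is a single sample. Above `i₀` the equal weights produce the global average.
      have hbr : visitSum mdp inp b w h x a (fun k j m =>
            roundWeight mdp inp b w h x a k (pos mdp inp b w h x a k j m) *
              (server mdp inp b w k).V (h + 1) (w k j m (h + 1))) k
          = if (server mdp inp b w k).N h x a < 2 * inp.M * mdp.H * (mdp.H + 1) then
              (∑ m ∈ (Finset.univ : Finset (Fin inp.M)).filter
                (fun m => 0 < visits inp (server mdp inp b w k) (w k)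
                  (length mdp inp b w k) m h x a),
              weight mdp.H (newN inp (server mdp inp b w k) (w k) (length mdp inp b w k) h x a)
                ((server mdp inp b w k).N h x a
                  + agentRank inp (server mdp inp b w k) (w k) (length mdp inp b w k) m h x a)
              * localReturn inp (server mdp inp b w k) (w k) (length mdp inp b w k) m h x a)
            else aggRate mdp inp (server mdp inp b w k) (w k) (length mdp inp b w k) h x a
              * globalReturn inp (server mdp inp b w k) (w k) (length mdp inp b w k) h x a := by
        unfold roundWeight
        split_ifs with hc
        · have hlen : length mdp inp b w k ≠ 0 := by
            intro hl
            apply h0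
            unfold roundCount
            rw [hl]; simp [totalVisits, visits_zero]
          obtain ⟨n, hn⟩ := Nat.exists_eq_succ_of_ne_zero hlen
          have hv := visits_eq_zero mdp inp (server mdp inp b w k) (w k) (k := k)
            (fun hk x a => N_le_of_executed mdp inp b w hk 0 x a) hh
            (threshold_eq_one mdp inp _ hc) (n := n)
            (show n < length mdp inp b w k by omega)
          have := roundSum_weight_of_last hv (weight mdp.H (count mdp inp b w h x a (k + 1)))
          rw [← Nat.succ_eq_add_one n, ← hn] at this
          refine Eq.trans (roundSum_congr fun j _ m _ => ?_) this
          beta_reduce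
          rw [if_pos hc]
        · rw [hagg, ← roundSum_div_totalVisits, mul_div_assoc', ← roundSum_mul_left, div_eq_inv_mul,
            ← roundSum_mul_left]
          refine roundSum_congr fun j _ m _ => ?_
          beta_reduce
          rw [if_neg hc, div_eq_inv_mul]; ring
      rw [hbr]
      split_ifs with hc
      · rw [hagg, ih]; ring
      · rw [hagg, ih]; ring

/-- The excess of the estimated over the true optimal values at the next state. -/
def excess (mdp : MDP S A) (inp : Input S A) (b : ℕ → ℝ) (w : ℕ → ℕ → Fin inp.M → ℕ → S)
    (h k j : ℕ) (m : Fin inp.M) : ℝ :=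
  (server mdp inp b w k).V h (w k j m h) - mdp.optValue h (w k j m h)

/-- The deviation of the optimal value at the next state from its mean. -/
def noise (mdp : MDP S A) (inp : Input S A) (w : ℕ → ℕ → Fin inp.M → ℕ → S)
    (h : ℕ) (x : S) (a : A) (k j : ℕ) (m : Fin inp.M) : ℝ :=
  mdp.optValue (h + 1) (w k j m (h + 1))
    - ∑ y, (mdp.P h x a y).toReal * mdp.optValue (h + 1) y

/-- Each sample is the optimal one-step return plus `excess` plus `noise`; the constant part
combines with the initial value by `aggregate_const`. -/
theorem Q_sub_eq [Nonempty S] (hh : h < mdp.H) (k : ℕ) :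
    (server mdp inp b w k).Q h x a - mdp.lookahead (mdp.optValue (h + 1)) h x a
      = keep mdp.H 0 (count mdp inp b w h x a k)
          * (mdp.H - mdp.lookahead (mdp.optValue (h + 1)) h x a)
        + aggregate mdp inp b w h x a (excess mdp inp b w (h + 1)) k
        + aggregate mdp inp b w h x a (noise mdp inp w h x a) k
        + bonusSum mdp inp b w h x a k := by
  have e : aggregate mdp inp b w h x a (fun k j m =>
          mdp.r h x a + (server mdp inp b w k).V (h + 1) (w k j m (h + 1))) k
      = aggregate mdp inp b w h x a (fun _ _ _ => mdp.lookahead (mdp.optValue (h + 1)) h x a) k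
        + (aggregate mdp inp b w h x a (excess mdp inp b w (h + 1)) k
        + aggregate mdp inp b w h x a (noise mdp inp w h x a) k) := by
    rw [← aggregate_add, ← aggregate_add]
    congr 1
    funext k j m
    unfold MDP.lookahead excess noise
    ring
  rw [Q_eq hh, e, aggregate_const]
  ring

end Run

end

end FedQ

/-! ### Optimism and the regret decomposition. -/

namespace FedQ

noncomputable section

variable {S A : Type*} [Fintype S] [Fintype A] [DecidableEq S] [DecidableEq A]
variable {mdp : MDP S A} {inp : Input S A} {b : ℕ → ℝ} {w : ℕ → ℕ → Fin inp.M → ℕ → S}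

section Values

variable [Nonempty A]

theorem V_of_le {h : ℕ} (hh : mdp.H ≤ h) (k : ℕ) (x : S) : (server mdp inp b w k).V h x = 0 := by
  cases k with
  | zero => exact if_neg (by omega)
  | succ k => exact if_neg (by omega)

theorem V_le (h k : ℕ) (x : S) : (server mdp inp b w k).V h x ≤ mdp.H := by
  rcases Nat.lt_or_ge h mdp.H with hh | hh
  · cases k with
    | zero => exact (if_pos hh).le
    | succ k => exact (if_pos hh).le.trans (min_le_left _ _)
  · rw [V_of_le hh]; positivity

/-- In the first round `V` and `Q` both equal `H`, so the initial policy may be arbitrary. -/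
theorem V_le_Q {h : ℕ} (hh : h < mdp.H) (k : ℕ) (x : S) :
    (server mdp inp b w k).V h x
      ≤ (server mdp inp b w k).Q h x ((server mdp inp b w k).policy h x) := by
  cases k with
  | zero => exact (if_pos hh).le
  | succ k =>
    refine (if_pos hh).le.trans ((min_le_right _ _).trans (ciSup_le fun a => ?_))
    exact inp.argmax_spec (k + 1) h x _ a

theorem min_Q_le_V {h : ℕ} (hh : h < mdp.H) (k : ℕ) (x : S) (a : A) :
    min (mdp.H : ℝ) ((server mdp inp b w k).Q h x a) ≤ (server mdp inp b w k).V h x := by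
  cases k with
  | zero => exact (min_le_left _ _).trans (if_pos hh).ge
  | succ k =>
    refine le_trans ?_ (if_pos hh).ge
    exact min_le_min le_rfl (le_ciSup (f := fun a => (server mdp inp b w (k + 1)).Q h x a)
      (Set.finite_range _).bddAbove a)

end Values

section Optimism

variable [Nonempty S] [Nonempty A] {K : ℕ}

theorem aggregate_eq_zero {h : ℕ} {x : S} {a : A} (g : ℕ → ℕ → Fin inp.M → ℝ) {k : ℕ}
    (hk : count mdp inp b w h x a k = 0) : aggregate mdp inp b w h x a g k = 0 := by
  induction k with
  | zero => rfl
  | succ k ih =>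
    have h1 := count_succ mdp inp b w h x a k
    rw [aggregate, ih (by omega), mul_zero, zero_add]
    exact roundSum_of_totalVisits_eq_zero (show roundCount mdp inp b w h x a k = 0 by omega) _

theorem optValue_le_of_Q {k : ℕ} (hQ : ∀ h < mdp.H, ∀ x a,
    mdp.lookahead (mdp.optValue (h + 1)) h x a ≤ (server mdp inp b w k).Q h x a) (h : ℕ) (x : S) :
    mdp.optValue h x ≤ (server mdp inp b w k).V h x := by
  rcases Nat.lt_or_ge h mdp.H with hh | hh
  · obtain ⟨a, ha⟩ := mdp.exists_optValue_eq hh x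
    refine le_trans (le_min (mdp.optValue_le h x) ?_) (min_Q_le_V hh k x a)
    rw [ha]
    exact hQ h hh x a
  · rw [V_of_le hh, mdp.optValue_of_le hh]

/-- Induction over the rounds alone suffices: the aggregated excess involves only earlier rounds,
where it is nonnegative at every step, and the bonus absorbs the noise. -/
theorem lookahead_le_Q
    (hdev : ∀ k ≤ K, ∀ h < mdp.H, ∀ x a,
      |aggregate mdp inp b w h x a (noise mdp inp w h x a) k| ≤ bonusSum mdp inp b w h x a k)
    {k : ℕ} (hk : k ≤ K) : ∀ h < mdp.H, ∀ x a,
      mdp.lookahead (mdp.optValue (h + 1)) h x a ≤ (server mdp inp b w k).Q h x a := by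
  induction k using Nat.strong_induction_on with
  | _ k ih =>
    intro h hh x a
    have h1 := Q_sub_eq (b := b) (w := w) (x := x) (a := a) hh k
    have h2 : 0 ≤ aggregate mdp inp b w h x a (excess mdp inp b w (h + 1)) k :=
      aggregate_nonneg fun k' hk' j m =>
        sub_nonneg.2 (optValue_le_of_Q (ih k' hk' (by omega)) (h + 1) _)
    have h3 := (abs_le.1 (hdev k hk h hh x a)).1
    have h4 : 0 ≤ keep mdp.H 0 (count mdp inp b w h x a k)
        * (mdp.H - mdp.lookahead (mdp.optValue (h + 1)) h x a) :=
      mul_nonneg (keep_nonneg _ _ _) (sub_nonneg.2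
        ((mdp.lookahead_le_optValue hh x a).trans (mdp.optValue_le h x)))
    linarith

theorem optValue_le_V
    (hdev : ∀ k ≤ K, ∀ h < mdp.H, ∀ x a,
      |aggregate mdp inp b w h x a (noise mdp inp w h x a) k| ≤ bonusSum mdp inp b w h x a k)
    {k : ℕ} (hk : k ≤ K) (h : ℕ) (x : S) : mdp.optValue h x ≤ (server mdp inp b w k).V h x :=
  optValue_le_of_Q (lookahead_le_Q hdev hk) h x

end Optimism

/-! ### The error of the estimates summed over the visits of one triple. -/

section Triple

variable [Nonempty S] [Nonempty A] {K : ℕ} {h : ℕ}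

/-- The initial value survives only while the count is zero, and the first round with a visit has at
most `M` visits; `min N M` records this in telescoping form. -/
theorem roundCount_mul_keep_le (hh : h < mdp.H) (x : S) (a : A) (k : ℕ) :
    (roundCount mdp inp b w h x a k : ℝ) * keep mdp.H 0 (count mdp inp b w h x a k)
      ≤ ((min (count mdp inp b w h x a (k + 1)) inp.M : ℕ) : ℝ)
        - ((min (count mdp inp b w h x a k) inp.M : ℕ) : ℝ) := by
  rw [keep_zero_left]
  split_ifs with hc
  · have h1 := totalVisits_le_of_lt mdp inp b w k hh x a (by
      change count mdp inp b w h x a k < _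
      rw [hc]
      exact Nat.mul_pos (Nat.mul_pos (Nat.mul_pos two_pos inp.M_pos) mdp.H_pos) (Nat.succ_pos _))
    rw [count_succ, hc, zero_add, min_eq_left h1]
    simp
  · rw [mul_zero, sub_nonneg]
    exact_mod_cast min_le_min_right _ (count_le_succ mdp inp b w h x a k)

/-- A new sample has weight at most `α_{N'}`, and `α_{N'}` times the remaining total weight is `1 +
1 / H`. -/
theorem aggregate_potential_le {φ : ℕ → ℕ → Fin inp.M → ℝ} (x : S) (a : A) {k : ℕ}
    (hφ : ∀ j m, 0 ≤ φ k j m) :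
    tailWeight mdp.H (count mdp inp b w h x a (k + 1)) * aggregate mdp inp b w h x a φ (k + 1)
      ≤ tailWeight mdp.H (count mdp inp b w h x a (k + 1))
          * keep mdp.H (count mdp inp b w h x a k) (count mdp inp b w h x a (k + 1))
          * aggregate mdp inp b w h x a φ k
        + (1 + 1 / mdp.H) * visitSum mdp inp b w h x a φ k := by
  have hH := mdp.H_pos
  rw [aggregate, mul_add, ← mul_assoc, ← visitSum_mul_left (1 + 1 / (mdp.H : ℝ)),
    ← visitSum_mul_left (tailWeight _ _)]
  refine add_le_add_right (roundSum_mono fun j hj m hit => ?_) _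
  beta_reduce
  rw [← mul_assoc]
  refine mul_le_mul_of_nonneg_right ?_ (hφ j m)
  rw [← lrate_mul_tailWeight (count mdp inp b w h x a (k + 1)) hH, mul_comm]
  exact mul_le_mul_of_nonneg_right (roundWeight_le_lrate (pos_le hj m)) (tailWeight_nonneg _ _)

/-- The number of visits in a round, if the round may be large compared with the past. -/
def crudeCount (mdp : MDP S A) (inp : Input S A) (N n : ℕ) : ℝ :=
  if 2 ≤ inp.M then ((min (N + n) (2 * inp.M * mdp.H * (mdp.H + 1) + inp.M) : ℕ) : ℝ)
    - ((min N (2 * inp.M * mdp.H * (mdp.H + 1) + inp.M) : ℕ) : ℝ) else 0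

theorem crudeCount_nonneg (N n : ℕ) : 0 ≤ crudeCount mdp inp N n := by
  unfold crudeCount
  split_ifs
  · rw [sub_nonneg]; exact_mod_cast min_le_min_right _ (Nat.le_add_right N n)
  · exact le_rfl

/-- In a short round the drop of the potential pays for the visits, up to what the new samples add
to it. Otherwise `M ≥ 2` and the count is below `i₀`; then the aggregate is bounded by `H`, and
`crudeCount` keeps track of these visits. -/
theorem roundCount_mul_aggregate_le (hh : h < mdp.H) (x : S) (a : A)
    {φ : ℕ → ℕ → Fin inp.M → ℝ} {k : ℕ}
    (hφ : ∀ k' ≤ k, ∀ j m, 0 ≤ φ k' j m) (hφH : ∀ k' < k, ∀ j m, φ k' j m ≤ mdp.H) :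
    (roundCount mdp inp b w h x a k : ℝ) * aggregate mdp inp b w h x a φ k
      ≤ (1 + 1 / mdp.H) * (tailWeight mdp.H (count mdp inp b w h x a k)
            * aggregate mdp inp b w h x a φ k
          - tailWeight mdp.H (count mdp inp b w h x a (k + 1))
            * aggregate mdp inp b w h x a φ (k + 1))
        + (1 + 1 / mdp.H) ^ 2 * visitSum mdp inp b w h x a φ k
        + mdp.H * crudeCount mdp inp (count mdp inp b w h x a k) (roundCount mdp inp b w h x a k) := by
  have hH := mdp.H_pos
  have hH' : (0 : ℝ) < mdp.H := by exact_mod_cast hH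
  set N := count mdp inp b w h x a k with hN
  set n := roundCount mdp inp b w h x a k with hn
  set Y := aggregate mdp inp b w h x a φ k
  have hY0 : 0 ≤ Y := aggregate_nonneg fun k' hk' => hφ k' hk'.le
  have hYH : Y ≤ mdp.H := aggregate_le hH'.le hφH
  have hpot := aggregate_potential_le (mdp := mdp) (b := b) (w := w) (h := h) x a (hφ k le_rfl)
  rw [count_succ mdp inp b w h x a k, ← hN, ← hn] at hpot ⊢
  have hρ : 0 ≤ 1 + 1 / (mdp.H : ℝ) := by positivity
  have hpot' := mul_le_mul_of_nonneg_left hpot hρ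
  have hcr := mul_nonneg hH'.le (crudeCount_nonneg (mdp := mdp) (inp := inp) N n)
  have hsub := mul_nonneg (tailWeight_sub_nonneg N n hH) hY0
  by_cases hc : 2 * inp.M * mdp.H * (mdp.H + 1) ≤ N ∨ inp.M = 1
  · have hn1 : n ≤ 1 ∨ n * (mdp.H * (mdp.H + 1)) ≤ N := by
      by_cases hc1 : 2 * inp.M * mdp.H * (mdp.H + 1) ≤ N
      · exact Or.inr (totalVisits_mul_le_of_le mdp inp b w k hh x a hc1)
      · left
        have := totalVisits_le_of_lt mdp inp b w k hh x a (not_le.1 hc1)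
        rwa [hc.resolve_left hc1] at this
    have hcoef := mul_le_mul_of_nonneg_right (le_tailWeight_sub (N := N) (n := n) hH hn1) hY0
    nlinarith
  · push Not at hc
    have hM : 2 ≤ inp.M := by have := inp.M_pos; omega
    have hle := totalVisits_le_of_lt mdp inp b w k hh x a hc.1
    have e : crudeCount mdp inp N n = n := by
      unfold crudeCount
      rw [if_pos hM, min_eq_left, min_eq_left]
      · push_cast; ring
      · omega
      · have : n ≤ inp.M := hle
        omega
    rw [e]
    have h1 : (n : ℝ) * Y ≤ mdp.H * n := by
      rw [mul_comm]; exact mul_le_mul_of_nonneg_right hYH (Nat.cast_nonneg _)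
    have h2 := mul_nonneg hρ hsub
    nlinarith

/-- A potential for the sum of the inverse square roots of the visit counts. -/
def invSqrtPotential (N : ℕ) : ℝ := if N = 0 then 1 else 1 / Real.sqrt N

theorem invSqrtPotential_nonneg (N : ℕ) : 0 ≤ invSqrtPotential N := by
  unfold invSqrtPotential; split_ifs <;> positivity

theorem invSqrtPotential_anti {N N' : ℕ} (hN : N ≤ N') :
    invSqrtPotential N' ≤ invSqrtPotential N := by
  unfold invSqrtPotential
  split_ifs with h1 h2 h2
  · exact le_rfl
  · omega
  · rw [div_le_one (Real.sqrt_pos.2 (by positivity))]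
    exact Real.one_le_sqrt.2 (by exact_mod_cast Nat.one_le_iff_ne_zero.2 h1)
  · exact one_div_le_one_div_of_le (Real.sqrt_pos.2 (by positivity))
      (Real.sqrt_le_sqrt (by exact_mod_cast hN))

/-- At count zero the left side vanishes, because `1 / √0 = 0`; the value `1` of the potential there
keeps it monotone. -/
theorem roundCount_div_sqrt_le (hh : h < mdp.H) (x : S) (a : A) (k : ℕ) :
    (roundCount mdp inp b w h x a k : ℝ) * (1 / Real.sqrt (count mdp inp b w h x a k))
      ≤ 5 / 2 * (Real.sqrt (count mdp inp b w h x a (k + 1))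
          - Real.sqrt (count mdp inp b w h x a k))
        + 7 * ((inp.M : ℝ) - 1) * (invSqrtPotential (count mdp inp b w h x a k)
          - invSqrtPotential (count mdp inp b w h x a (k + 1))) := by
  have hM : (1 : ℝ) ≤ inp.M := by exact_mod_cast inp.M_pos
  have hNN := count_le_succ mdp inp b w h x a k
  rcases Nat.eq_zero_or_pos (count mdp inp b w h x a k) with h0 | h0
  · have h1 : 0 ≤ 7 * ((inp.M : ℝ) - 1) * (invSqrtPotential (count mdp inp b w h x a k)
          - invSqrtPotential (count mdp inp b w h x a (k + 1))) :=
      mul_nonneg (by linarith) (sub_nonneg.2 (invSqrtPotential_anti hNN))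
    have h2 : Real.sqrt (count mdp inp b w h x a k)
        ≤ Real.sqrt (count mdp inp b w h x a (k + 1)) :=
      Real.sqrt_le_sqrt (by exact_mod_cast hNN)
    have h3 : (roundCount mdp inp b w h x a k : ℝ) * (1 / Real.sqrt (count mdp inp b w h x a k)) = 0 := by
      rw [h0]; simp
    linarith
  · unfold invSqrtPotential
    rw [if_neg h0.ne', if_neg (by omega)]
    refine div_sqrt_le_telescope inp.M_pos h0 ?_
    rcases totalVisits_cases mdp inp b w k hh x a with h1 | h1
    · by_cases h2 : 2 ≤ inp.M
      · exact Or.inr ⟨h1, h2⟩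
      · left
        have : roundCount mdp inp b w h x a k ≤ inp.M := h1
        omega
    · exact Or.inl ((Nat.le_mul_of_pos_right _
        (Nat.mul_pos mdp.H_pos (Nat.succ_pos _))).trans h1)

theorem excess_nonneg
    (hdev : ∀ k ≤ K, ∀ h < mdp.H, ∀ x a,
      |aggregate mdp inp b w h x a (noise mdp inp w h x a) k| ≤ bonusSum mdp inp b w h x a k)
    {k : ℕ} (hk : k ≤ K) (h j : ℕ) (m : Fin inp.M) : 0 ≤ excess mdp inp b w h k j m :=
  sub_nonneg.2 (optValue_le_V hdev hk _ _)

theorem excess_le (h k j : ℕ) (m : Fin inp.M) : excess mdp inp b w h k j m ≤ mdp.H := by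
  unfold excess
  linarith [V_le (mdp := mdp) (inp := inp) (b := b) (w := w) h k (w k j m h),
    mdp.optValue_nonneg h (w k j m h)]

/-- All error terms telescope. The factor `12 D` counts the bonus twice, once for itself and once
for the noise that it dominates. -/
theorem sum_roundCount_mul_le {D : ℝ} (hD : 0 ≤ D)
    (hdev : ∀ k ≤ K, ∀ h < mdp.H, ∀ x a,
      |aggregate mdp inp b w h x a (noise mdp inp w h x a) k| ≤ bonusSum mdp inp b w h x a k)
    (hbonus : ∀ k ≤ K, ∀ h < mdp.H, ∀ x a, bonusSum mdp inp b w h x a k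
      ≤ 6 * D * (1 / Real.sqrt (count mdp inp b w h x a k)))
    (hh : h < mdp.H) (x : S) (a : A) :
    ∑ k ∈ Finset.range K, (roundCount mdp inp b w h x a k : ℝ)
        * ((server mdp inp b w k).Q h x a - mdp.lookahead (mdp.optValue (h + 1)) h x a)
      ≤ mdp.H * inp.M
        + (1 + 1 / mdp.H) ^ 2 * ∑ k ∈ Finset.range K,
            visitSum mdp inp b w h x a (excess mdp inp b w (h + 1)) k
        + 10 * ((inp.M : ℝ) - 1) * (mdp.H : ℝ) ^ 3
        + 12 * D * (5 / 2 * Real.sqrt (count mdp inp b w h x a K) + 7 * ((inp.M : ℝ) - 1)) := by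
  have hH' : (1 : ℝ) ≤ mdp.H := by exact_mod_cast mdp.H_pos
  have hM : (1 : ℝ) ≤ inp.M := by exact_mod_cast inp.M_pos
  have hQ0 : 0 ≤ mdp.lookahead (mdp.optValue (h + 1)) h x a :=
    add_nonneg (mdp.r_nonneg _ _ _) (pmf_sum_mul_nonneg _ fun y => mdp.optValue_nonneg _ y)
  set φ := excess mdp inp b w (h + 1)
  set N := count mdp inp b w h x a
  set n := roundCount mdp inp b w h x a
  set Y := aggregate mdp inp b w h x a φ
  set Z := visitSum mdp inp b w h x a φ
  have hterm : ∀ k ∈ Finset.range K, (n k : ℝ)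
        * ((server mdp inp b w k).Q h x a - mdp.lookahead (mdp.optValue (h + 1)) h x a)
      ≤ mdp.H * (((min (N (k + 1)) inp.M : ℕ) : ℝ) - ((min (N k) inp.M : ℕ) : ℝ))
        + ((1 + 1 / mdp.H) * (tailWeight mdp.H (N k) * Y k - tailWeight mdp.H (N (k + 1)) * Y (k + 1))
          + (1 + 1 / mdp.H) ^ 2 * Z k + mdp.H * crudeCount mdp inp (N k) (n k))
        + 12 * D * (5 / 2 * (Real.sqrt (N (k + 1)) - Real.sqrt (N k))
          + 7 * ((inp.M : ℝ) - 1) * (invSqrtPotential (N k) - invSqrtPotential (N (k + 1)))) := by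
    intro k hk
    have hk : k ≤ K := (Finset.mem_range.1 hk).le
    rw [Q_sub_eq hh k]
    have h1 := roundCount_mul_keep_le (mdp := mdp) (inp := inp) (b := b) (w := w) hh x a k
    have h2 := roundCount_mul_aggregate_le (mdp := mdp) (inp := inp) (b := b) (w := w) hh x a
      (φ := φ) (k := k) (fun k' hk' j m => excess_nonneg hdev (hk'.trans hk) _ j m)
      (fun k' _ j m => excess_le _ k' j m)
    have h3 := roundCount_div_sqrt_le (mdp := mdp) (inp := inp) (b := b) (w := w) hh x a k
    have h4 := (abs_le.1 (hdev k hk h hh x a)).2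
    have h5 := hbonus k hk h hh x a
    have hn0 : (0 : ℝ) ≤ n k := Nat.cast_nonneg _
    have hk0 := keep_nonneg mdp.H 0 (N k)
    have h6 : (n k : ℝ) * (keep mdp.H 0 (N k)
          * (mdp.H - mdp.lookahead (mdp.optValue (h + 1)) h x a))
        ≤ mdp.H * (((min (N (k + 1)) inp.M : ℕ) : ℝ) - ((min (N k) inp.M : ℕ) : ℝ)) := by
      have : (n k : ℝ) * (keep mdp.H 0 (N k)
          * (mdp.H - mdp.lookahead (mdp.optValue (h + 1)) h x a))
          ≤ mdp.H * ((n k : ℝ) * keep mdp.H 0 (N k)) := by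
        have := mul_nonneg (mul_nonneg hn0 hk0) hQ0
        linarith
      exact this.trans (mul_le_mul_of_nonneg_left h1 (by linarith))
    have h7 : (n k : ℝ) * (aggregate mdp inp b w h x a (noise mdp inp w h x a) k
          + bonusSum mdp inp b w h x a k)
        ≤ 12 * D * ((n k : ℝ) * (1 / Real.sqrt (N k))) := by
      have := mul_le_mul_of_nonneg_left (show aggregate mdp inp b w h x a
          (noise mdp inp w h x a) k + bonusSum mdp inp b w h x a k
          ≤ 12 * D * (1 / Real.sqrt (N k)) by linarith) hn0
      linarith
    have h8 := mul_le_mul_of_nonneg_left h3 (show 0 ≤ 12 * D by positivity)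
    have e : ∀ p q r s : ℝ, (n k : ℝ) * (p + q + r + s)
        = (n k : ℝ) * p + (n k : ℝ) * q + (n k : ℝ) * (r + s) := by intros; ring
    rw [e]
    exact add_le_add (add_le_add h6 h2) (h7.trans h8)
  refine (Finset.sum_le_sum hterm).trans ?_
  simp only [Finset.sum_add_distrib, ← Finset.mul_sum]
  have t1 : ∑ k ∈ Finset.range K, (((min (N (k + 1)) inp.M : ℕ) : ℝ) - ((min (N k) inp.M : ℕ) : ℝ))
      ≤ inp.M := by
    rw [Finset.sum_range_sub (fun k => ((min (N k) inp.M : ℕ) : ℝ))]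
    have h1 : ((min (N K) inp.M : ℕ) : ℝ) ≤ inp.M := by exact_mod_cast min_le_right _ _
    have h2 : (0 : ℝ) ≤ ((min (N 0) inp.M : ℕ) : ℝ) := Nat.cast_nonneg _
    linarith
  have t2 : ∑ k ∈ Finset.range K,
      (tailWeight mdp.H (N k) * Y k - tailWeight mdp.H (N (k + 1)) * Y (k + 1)) ≤ 0 := by
    rw [Finset.sum_range_sub' (fun k => tailWeight mdp.H (N k) * Y k)]
    have h1 : Y 0 = 0 := rfl
    have h2 : 0 ≤ tailWeight mdp.H (N K) * Y K := mul_nonneg (tailWeight_nonneg _ _)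
      (aggregate_nonneg fun k' hk' j m => excess_nonneg hdev hk'.le _ j m)
    rw [h1, mul_zero]
    linarith
  -- The crude visits number at most `i₀ + M ≤ 5 M H²`, and `M ≤ 2 (M - 1)` when there are at least
  -- two agents.
  have t3 : ∑ k ∈ Finset.range K, crudeCount mdp inp (N k) (n k)
      ≤ 10 * ((inp.M : ℝ) - 1) * (mdp.H : ℝ) ^ 2 := by
    unfold crudeCount
    split_ifs with hc
    · have hc' : (2 : ℝ) ≤ inp.M := by exact_mod_cast hc
      have e : ∀ k, N k + n k = N (k + 1) := fun k => rfl
      simp only [e]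
      rw [Finset.sum_range_sub
        (fun k => ((min (N k) (2 * inp.M * mdp.H * (mdp.H + 1) + inp.M) : ℕ) : ℝ))]
      have h1 : ((min (N K) (2 * inp.M * mdp.H * (mdp.H + 1) + inp.M) : ℕ) : ℝ)
          ≤ ((2 * inp.M * mdp.H * (mdp.H + 1) + inp.M : ℕ) : ℝ) := by
        exact_mod_cast min_le_right _ _
      have h2 : (0 : ℝ) ≤ ((min (N 0) (2 * inp.M * mdp.H * (mdp.H + 1) + inp.M) : ℕ) : ℝ) :=
        Nat.cast_nonneg _
      push_cast at h1
      have h3 : 2 * (inp.M : ℝ) * mdp.H * (mdp.H + 1) + inp.M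
          ≤ 5 * inp.M * (mdp.H : ℝ) ^ 2 := by nlinarith [mul_nonneg (show (0:ℝ) ≤ inp.M by linarith) (show (0:ℝ) ≤ mdp.H - 1 by linarith)]
      have h4 : 5 * inp.M * (mdp.H : ℝ) ^ 2 ≤ 10 * ((inp.M : ℝ) - 1) * (mdp.H : ℝ) ^ 2 :=
        mul_le_mul_of_nonneg_right (by linarith) (by positivity)
      push_cast at h2 ⊢
      linarith
    · rw [Finset.sum_const_zero]
      exact mul_nonneg (by linarith) (by positivity)
  have t4 : ∑ k ∈ Finset.range K, (Real.sqrt (N (k + 1)) - Real.sqrt (N k))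
      = Real.sqrt (N K) := by
    rw [Finset.sum_range_sub (fun k => Real.sqrt (N k))]
    have : N 0 = 0 := rfl
    rw [this]; simp
  have t5 : ∑ k ∈ Finset.range K, (invSqrtPotential (N k) - invSqrtPotential (N (k + 1))) ≤ 1 := by
    rw [Finset.sum_range_sub' (fun k => invSqrtPotential (N k))]
    have h1 : invSqrtPotential (N 0) = 1 := if_pos rfl
    rw [h1]
    linarith [invSqrtPotential_nonneg (N K)]
  have t1' := mul_le_mul_of_nonneg_left t1 (show (0 : ℝ) ≤ mdp.H by linarith)
  have t2' := mul_le_mul_of_nonneg_left t2 (show 0 ≤ 1 + 1 / (mdp.H : ℝ) by positivity)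
  have t3' := mul_le_mul_of_nonneg_left t3 (show (0 : ℝ) ≤ mdp.H by linarith)
  have t5' := mul_le_mul_of_nonneg_left t5 (show 0 ≤ 7 * ((inp.M : ℝ) - 1) by linarith)
  rw [t4]
  have t6 := mul_le_mul_of_nonneg_left
    (add_le_add_right t5' (5 / 2 * Real.sqrt (N K))) (show 0 ≤ 12 * D by positivity)
  rw [mul_one] at t6
  have e : (mdp.H : ℝ) * (10 * ((inp.M : ℝ) - 1) * (mdp.H : ℝ) ^ 2)
      = 10 * ((inp.M : ℝ) - 1) * (mdp.H : ℝ) ^ 3 := by ring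
  rw [e] at t3'
  linarith

end Triple

/-! ### Summation over all triples and recursion over the steps. -/

section Total

/-- The sum of `g k j m` over all episodes of all agents in the first `K` rounds. -/
def runSum (mdp : MDP S A) (inp : Input S A) (b : ℕ → ℝ) (w : ℕ → ℕ → Fin inp.M → ℕ → S) (K : ℕ)
    (g : ℕ → ℕ → Fin inp.M → ℝ) : ℝ :=
  ∑ k ∈ Finset.range K, ∑ j ∈ Finset.range (length mdp inp b w k), ∑ m, g k j m

variable {K : ℕ}

theorem runSum_mono {g g' : ℕ → ℕ → Fin inp.M → ℝ} (hg : ∀ k < K, ∀ j m, g k j m ≤ g' k j m) :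
    runSum mdp inp b w K g ≤ runSum mdp inp b w K g' :=
  Finset.sum_le_sum fun k hk => Finset.sum_le_sum fun j _ => Finset.sum_le_sum fun m _ =>
    hg k (Finset.mem_range.1 hk) j m

theorem runSum_add (g g' : ℕ → ℕ → Fin inp.M → ℝ) :
    runSum mdp inp b w K (fun k j m => g k j m + g' k j m)
      = runSum mdp inp b w K g + runSum mdp inp b w K g' := by
  simp only [runSum, Finset.sum_add_distrib]

theorem runSum_sub (g g' : ℕ → ℕ → Fin inp.M → ℝ) :
    runSum mdp inp b w K (fun k j m => g k j m - g' k j m)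
      = runSum mdp inp b w K g - runSum mdp inp b w K g' := by
  simp only [runSum, Finset.sum_sub_distrib]

theorem sum_visitSum (h : ℕ) (g : ℕ → ℕ → Fin inp.M → S → A → ℝ) :
    ∑ x, ∑ a, ∑ k ∈ Finset.range K, visitSum mdp inp b w h x a (fun k j m => g k j m x a) k
      = runSum mdp inp b w K (fun k j m =>
          g k j m (w k j m h) ((server mdp inp b w k).policy h (w k j m h))) := by
  unfold runSum
  calc _ = ∑ k ∈ Finset.range K, ∑ j ∈ Finset.range (length mdp inp b w k), ∑ x, ∑ a, ∑ m,
        (if Hit inp (server mdp inp b w k) (w k) j m h x a then g k j m x a else 0) := by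
        simp_rw [Finset.sum_comm (t := Finset.range K)]
        refine Finset.sum_congr rfl fun k _ => ?_
        unfold visitSum roundSum
        simp_rw [Finset.sum_comm (t := Finset.range (length mdp inp b w k))]
    _ = _ := by
        refine Finset.sum_congr rfl fun k _ => Finset.sum_congr rfl fun j _ => ?_
        exact sum_hit inp (server mdp inp b w k) (w k) (fun m _ x a => g k j m x a) j h

theorem sum_roundCount_mul (h : ℕ) (f : ℕ → S → A → ℝ) :
    ∑ x, ∑ a, ∑ k ∈ Finset.range K, (roundCount mdp inp b w h x a k : ℝ) * f k x a
      = runSum mdp inp b w K (fun k j m =>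
          f k (w k j m h) ((server mdp inp b w k).policy h (w k j m h))) := by
  rw [← sum_visitSum h (fun k _ _ x a => f k x a)]
  refine Finset.sum_congr rfl fun x _ => Finset.sum_congr rfl fun a _ =>
    Finset.sum_congr rfl fun k _ => ?_
  rw [mul_comm]
  unfold roundCount
  rw [← roundSum_one, ← roundSum_mul_left]
  simp only [mul_one]
  rfl

/-- Cauchy–Schwarz over the pairs, whose counts add up to the number of episodes of all agents. -/
theorem sum_sqrt_count_le (h : ℕ) :
    ∑ x, ∑ a, Real.sqrt (count mdp inp b w h x a K)
      ≤ Real.sqrt (Fintype.card S * Fintype.card A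
          * (inp.M * (server mdp inp b w K).episodes)) := by
  rw [← Finset.sum_product']
  have h1 := Real.sum_sqrt_mul_sqrt_le (Finset.univ ×ˢ Finset.univ : Finset (S × A))
    (f := fun _ => 1) (g := fun p => (count mdp inp b w h p.1 p.2 K : ℝ))
    (fun _ => zero_le_one) (fun _ => Nat.cast_nonneg _)
  have h2 : ∑ p ∈ (Finset.univ ×ˢ Finset.univ : Finset (S × A)),
      (count mdp inp b w h p.1 p.2 K : ℝ) = inp.M * (server mdp inp b w K).episodes := by
    rw [Finset.sum_product]
    exact_mod_cast sum_N mdp inp b w K h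
  rw [h2] at h1
  simp only [Real.sqrt_one, one_mul, Finset.sum_const, Finset.card_product, Finset.card_univ,
    nsmul_eq_mul, mul_one, Nat.cast_mul] at h1
  rwa [← Real.sqrt_mul (by positivity)] at h1

/-- The advantage of the optimal values over those of the policy of the current round. -/
def advantage (mdp : MDP S A) (st : Server S A) (h : ℕ) (y : S) : ℝ :=
  mdp.optValue h y - mdp.value (detPolicy st.policy) h y

/-- The deviation of the advantage at the next state from its mean, with the opposite sign. -/
def drift (mdp : MDP S A) (inp : Input S A) (b : ℕ → ℝ) (w : ℕ → ℕ → Fin inp.M → ℕ → S)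
    (h k j : ℕ) (m : Fin inp.M) : ℝ :=
  ∑ y, (mdp.P h (w k j m h) ((server mdp inp b w k).policy h (w k j m h)) y).toReal
      * advantage mdp (server mdp inp b w k) (h + 1) y
    - advantage mdp (server mdp inp b w k) (h + 1) (w k j m (h + 1))

/-- The excess of the estimated values over those of the policy of the current round. -/
def gap (mdp : MDP S A) (inp : Input S A) (b : ℕ → ℝ) (w : ℕ → ℕ → Fin inp.M → ℕ → S)
    (h k j : ℕ) (m : Fin inp.M) : ℝ :=
  (server mdp inp b w k).V h (w k j m h)
    - mdp.value (detPolicy (server mdp inp b w k).policy) h (w k j m h)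

variable [Nonempty S] [Nonempty A]

/-- Bound `V` by `Q` at the chosen action, expand the policy value by its Bellman equation, and add
and subtract the optimal value at the next state. -/
theorem gap_le {h : ℕ} (hh : h < mdp.H) (k j : ℕ) (m : Fin inp.M) :
    gap mdp inp b w h k j m
      ≤ ((server mdp inp b w k).Q h (w k j m h) ((server mdp inp b w k).policy h (w k j m h))
          - mdp.lookahead (mdp.optValue (h + 1)) h (w k j m h)
              ((server mdp inp b w k).policy h (w k j m h)))
        + (drift mdp inp b w h k j m + (gap mdp inp b w (h + 1) k j m
          - excess mdp inp b w (h + 1) k j m)) := by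
  have h1 := V_le_Q (mdp := mdp) (inp := inp) (b := b) (w := w) hh k (w k j m h)
  have h2 := mdp.value_detPolicy (server mdp inp b w k).policy hh (w k j m h)
  unfold gap
  rw [h2]
  unfold drift excess advantage MDP.lookahead
  simp only [mul_sub, Finset.sum_sub_distrib]
  linarith

/-- The error of `Q` returns `(1 + 1 / H) ^ 2` times the excess at the next step, of which one copy
cancels; the rest is bounded by the gap. The constants are `84 = 12 * 7` and `30 = 12 * 5 / 2`. -/
theorem runSum_gap_le {D B : ℝ} (hD : 0 ≤ D)
    (hdev : ∀ k ≤ K, ∀ h < mdp.H, ∀ x a,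
      |aggregate mdp inp b w h x a (noise mdp inp w h x a) k| ≤ bonusSum mdp inp b w h x a k)
    (hbonus : ∀ k ≤ K, ∀ h < mdp.H, ∀ x a, bonusSum mdp inp b w h x a k
      ≤ 6 * D * (1 / Real.sqrt (count mdp inp b w h x a k)))
    (hdrift : ∀ h < mdp.H, runSum mdp inp b w K (drift mdp inp b w h) ≤ B)
    {h : ℕ} (hh : h < mdp.H) :
    runSum mdp inp b w K (gap mdp inp b w h)
      ≤ (Fintype.card S * Fintype.card A * (mdp.H * inp.M
            + 10 * ((inp.M : ℝ) - 1) * (mdp.H : ℝ) ^ 3 + 84 * D * ((inp.M : ℝ) - 1))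
          + 30 * D * Real.sqrt (Fintype.card S * Fintype.card A
              * (inp.M * (server mdp inp b w K).episodes)) + B)
        + (1 + 1 / mdp.H) ^ 2 * runSum mdp inp b w K (gap mdp inp b w (h + 1)) := by
  have h1 := runSum_mono (mdp := mdp) (inp := inp) (b := b) (w := w) (K := K)
    (fun k _ j m => gap_le (mdp := mdp) (inp := inp) (b := b) (w := w) hh k j m)
  rw [runSum_add, runSum_add] at h1
  have h2 := sum_roundCount_mul (mdp := mdp) (inp := inp) (b := b) (w := w) (K := K) h
    (fun k x a => (server mdp inp b w k).Q h x a - mdp.lookahead (mdp.optValue (h + 1)) h x a)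
  rw [← h2, runSum_sub] at h1
  have h3 := Finset.sum_le_sum fun x (_ : x ∈ (Finset.univ : Finset S)) =>
    Finset.sum_le_sum fun a (_ : a ∈ (Finset.univ : Finset A)) =>
      sum_roundCount_mul_le hD hdev hbonus hh x a
  have h4 := sum_visitSum (mdp := mdp) (inp := inp) (b := b) (w := w) (K := K) h
    (fun k j m _ _ => excess mdp inp b w (h + 1) k j m)
  have h5 := sum_sqrt_count_le (mdp := mdp) (inp := inp) (b := b) (w := w) (K := K) h
  have h6 := hdrift h hh
  have h7 : runSum mdp inp b w K (excess mdp inp b w (h + 1))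
      ≤ runSum mdp inp b w K (gap mdp inp b w (h + 1)) :=
    runSum_mono fun k _ j m => sub_le_sub_left (mdp.value_le_optValue _ _ _) _
  simp only [Finset.sum_add_distrib, ← Finset.mul_sum, Finset.sum_const, Finset.card_univ,
    nsmul_eq_mul] at h3
  have h4' : ∑ x, ∑ a, ∑ k ∈ Finset.range K,
      visitSum mdp inp b w h x a (excess mdp inp b w (h + 1)) k
      = runSum mdp inp b w K (excess mdp inp b w (h + 1)) := h4
  rw [h4'] at h3
  have hρ : (1 : ℝ) ≤ (1 + 1 / mdp.H) ^ 2 := by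
    have : (0 : ℝ) ≤ 1 / mdp.H := by positivity
    nlinarith
  have h8 := mul_le_mul_of_nonneg_left h7 (sub_nonneg.2 hρ)
  have h9 := mul_le_mul_of_nonneg_left h5 (show 0 ≤ 30 * D by positivity)
  nlinarith

/-- The quantity is the square of `(1 + 1 / H) ^ H ≤ e`. -/
theorem one_add_inv_pow_le (H : ℕ) (hH : 0 < H) : ((1 + 1 / (H : ℝ)) ^ 2) ^ H ≤ 9 := by
  have hH' : (0 : ℝ) < H := by exact_mod_cast hH
  have h1 : 1 + 1 / (H : ℝ) ≤ Real.exp (1 / H) := by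
    have := Real.add_one_le_exp (1 / (H : ℝ)); linarith
  have h2 : (1 + 1 / (H : ℝ)) ^ H ≤ Real.exp 1 := by
    calc (1 + 1 / (H : ℝ)) ^ H ≤ Real.exp (1 / H) ^ H := by gcongr
      _ = Real.exp 1 := by rw [← Real.exp_nat_mul]; congr 1; field_simp
  have h3 : Real.exp 1 ≤ 3 := Real.exp_one_lt_three.le
  rw [← pow_mul, mul_comm, pow_mul]
  have h4 : 0 ≤ (1 + 1 / (H : ℝ)) ^ H := by positivity
  nlinarith

/-- Backward induction over the steps, with no gap left at step `H`; optimism then passes from the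
regret to the gap at step `0`. -/
theorem regret_le {D B : ℝ} (hD : 0 ≤ D) (hB : 0 ≤ B)
    (hdev : ∀ k ≤ K, ∀ h < mdp.H, ∀ x a,
      |aggregate mdp inp b w h x a (noise mdp inp w h x a) k| ≤ bonusSum mdp inp b w h x a k)
    (hbonus : ∀ k ≤ K, ∀ h < mdp.H, ∀ x a, bonusSum mdp inp b w h x a k
      ≤ 6 * D * (1 / Real.sqrt (count mdp inp b w h x a k)))
    (hdrift : ∀ h < mdp.H, runSum mdp inp b w K (drift mdp inp b w h) ≤ B) :
    regret mdp inp b w K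
      ≤ 9 * mdp.H * (Fintype.card S * Fintype.card A * (mdp.H * inp.M
            + 10 * ((inp.M : ℝ) - 1) * (mdp.H : ℝ) ^ 3 + 84 * D * ((inp.M : ℝ) - 1))
          + 30 * D * Real.sqrt (Fintype.card S * Fintype.card A
              * (inp.M * (server mdp inp b w K).episodes)) + B) := by
  have hM : (1 : ℝ) ≤ inp.M := by exact_mod_cast inp.M_pos
  have hM1 : 0 ≤ (inp.M : ℝ) - 1 := by linarith
  set E := (Fintype.card S * Fintype.card A * (mdp.H * inp.M
            + 10 * ((inp.M : ℝ) - 1) * (mdp.H : ℝ) ^ 3 + 84 * D * ((inp.M : ℝ) - 1))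
          + 30 * D * Real.sqrt (Fintype.card S * Fintype.card A
              * (inp.M * (server mdp inp b w K).episodes)) + B) with hE
  have hE0 : 0 ≤ E := by positivity
  set ρ := (1 + 1 / (mdp.H : ℝ)) ^ 2 with hρ
  have hρ1 : 1 ≤ ρ := by
    have : (0 : ℝ) ≤ 1 / mdp.H := by positivity
    rw [hρ]; nlinarith
  have key : ∀ n ≤ mdp.H, runSum mdp inp b w K (gap mdp inp b w (mdp.H - n)) ≤ n * ρ ^ n * E := by
    intro n
    induction n with
    | zero =>
      intro _
      have : runSum mdp inp b w K (gap mdp inp b w (mdp.H - 0)) = 0 := by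
        refine Finset.sum_eq_zero fun k _ => Finset.sum_eq_zero fun j _ =>
          Finset.sum_eq_zero fun m _ => ?_
        unfold gap
        rw [V_of_le (by omega), mdp.value_of_le _ (by omega), sub_zero]
      rw [this]; simp
    | succ n ih =>
      intro hn
      have h1 := runSum_gap_le hD hdev hbonus hdrift (h := mdp.H - (n + 1)) (by omega)
      rw [show mdp.H - (n + 1) + 1 = mdp.H - n by omega, ← hE, ← hρ] at h1
      have h2 := mul_le_mul_of_nonneg_left (ih (by omega)) (show 0 ≤ ρ by linarith)
      have h3 : E ≤ ρ ^ (n + 1) * E := by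
        have := one_le_pow₀ hρ1 (n := n + 1)
        nlinarith
      calc _ ≤ E + ρ * (n * ρ ^ n * E) := h1.trans (add_le_add_right h2 _)
        _ ≤ ρ ^ (n + 1) * E + ρ * (n * ρ ^ n * E) := add_le_add_left h3 _
        _ = _ := by push_cast; ring
  have h1 := key mdp.H le_rfl
  rw [Nat.sub_self] at h1
  have h2 : regret mdp inp b w K ≤ runSum mdp inp b w K (gap mdp inp b w 0) := by
    unfold regret runSum
    rw [Finset.sum_comm]
    refine Finset.sum_le_sum fun k hk => ?_
    rw [Finset.sum_comm]
    refine Finset.sum_le_sum fun j _ => Finset.sum_le_sum fun m _ => ?_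
    exact sub_le_sub_right (optValue_le_V hdev (Finset.mem_range.1 hk).le _ _) _
  have h3 : (mdp.H : ℝ) * ρ ^ mdp.H * E ≤ mdp.H * 9 * E :=
    mul_le_mul_of_nonneg_right (mul_le_mul_of_nonneg_left
      (one_add_inv_pow_le mdp.H mdp.H_pos) (Nat.cast_nonneg _)) hE0
  linarith

end Total

end

end FedQ

/-! ### Concentration of the noise and of the drift. -/

namespace FedQ

noncomputable section

open MeasureTheory

variable {S A : Type*} [Fintype S] [Fintype A] [DecidableEq S] [DecidableEq A]
variable {mdp : MDP S A} {inp : Input S A} {b : ℕ → ℝ} {w : ℕ → ℕ → Fin inp.M → ℕ → S}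

section Increments

theorem pmf_sum_eq_one (p : PMF S) : ∑ s, p s = 1 := by
  rw [← tsum_fintype (L := .unconditional _), p.tsum_coe]

open Classical in
/-- The exponents for the noise at the visits of `(h, x, a)` with numbers in `(i, n]`. -/
def windowIncrement (mdp : MDP S A) (inp : Input S A) (b : ℕ → ℝ) (h : ℕ) (x : S) (a : A)
    (i n : ℕ) (t : ℝ) (w : ℕ → ℕ → Fin inp.M → ℕ → S) (k j : ℕ) (m : Fin inp.M) (s : S) : ℝ :=
  if Hit inp (server mdp inp b w k) (w k) j m h x a
      ∧ (i < pos mdp inp b w h x a k j m ∧ pos mdp inp b w h x a k j m ≤ n) then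
    t * (mdp.optValue (h + 1) s - ∑ y, (mdp.P h x a y).toReal * mdp.optValue (h + 1) y)
      - t ^ 2 * (mdp.H : ℝ) ^ 2 / 8
  else 0

/-- The exponents for the drift. -/
def driftIncrement (mdp : MDP S A) (inp : Input S A) (b : ℕ → ℝ) (h : ℕ) (t : ℝ)
    (w : ℕ → ℕ → Fin inp.M → ℕ → S) (k j : ℕ) (m : Fin inp.M) (s : S) : ℝ :=
  t * (∑ y, (mdp.P h (w k j m h) ((server mdp inp b w k).policy h (w k j m h)) y).toReal
      * advantage mdp (server mdp inp b w k) (h + 1) y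
    - advantage mdp (server mdp inp b w k) (h + 1) s) - t ^ 2 * (mdp.H : ℝ) ^ 2 / 8

variable [Nonempty S] [Nonempty A]

theorem isExpSupermartingale_windowIncrement {h : ℕ} (hh : h < mdp.H) (x : S) (a : A) (i n : ℕ)
    (t : ℝ) : IsExpSupermartingale mdp inp b h (windowIncrement mdp inp b h x a i n t) where
  adapted w w' k j _ hs := by
    funext m s
    unfold windowIncrement
    have h1 : Hit inp (server mdp inp b w k) (w k) j m h x a
        ↔ Hit inp (server mdp inp b w' k) (w' k) j m h x a :=
      hs.agree.hit hh (hs.2.2 m h le_rfl).symm x a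
    have h2 : pos mdp inp b w h x a k j m = pos mdp inp b w' h x a k j m := by
      -- The visit number involves the states of all agents at step `h`, all of which are observed
      -- before the transition.
      refine hs.agree.position hh (fun j' hj' m' => ?_) m x a
      rcases hj'.lt_or_eq with hc | rfl
      · exact (hs.2.1 j' hc m' h hh.le).symm
      · exact (hs.2.2 m' h le_rfl).symm
    simp only [h1, h2]
  exp_le w k j m _ := by
    unfold windowIncrement
    split_ifs with hc
    · obtain ⟨⟨h1, h2⟩, -⟩ := hc
      rw [h2, h1]
      exact pmf_hoeffding _ _ _ _ fun s => ⟨mdp.optValue_nonneg _ _, mdp.optValue_le _ _⟩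
    · simp only [Real.exp_zero, ENNReal.ofReal_one, mul_one]
      exact (pmf_sum_eq_one _).le

/-- Equal histories give equal policies only at the steps `h < H`, which are all that the value
uses. -/
theorem value_congr {pol pol' : ℕ → S → PMF A} (hp : ∀ h < mdp.H, pol h = pol' h) (h : ℕ) (x : S) :
    mdp.value pol h x = mdp.value pol' h x := by
  have hl : ∀ i, h + i ≤ mdp.H → mdp.stateLaw pol h x i = mdp.stateLaw pol' h x i := by
    intro i
    induction i with
    | zero => intro _; rfl
    | succ i ih =>
      intro hi
      rw [MDP.stateLaw, MDP.stateLaw, ih (by omega), hp (h + i) (by omega)]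
  unfold MDP.value
  refine Finset.sum_congr rfl fun i hi => ?_
  have hi := Finset.mem_range.1 hi
  rw [hl i (by omega), hp (h + i) (by omega)]

theorem isExpSupermartingale_driftIncrement {h : ℕ} (hh : h < mdp.H) (t : ℝ) :
    IsExpSupermartingale mdp inp b h (driftIncrement mdp inp b h t) where
  adapted w w' k j _ hs := by
    funext m s
    have h1 : advantage mdp (server mdp inp b w k) (h + 1)
        = advantage mdp (server mdp inp b w' k) (h + 1) := by
      funext y
      unfold advantage
      rw [value_congr (fun h' hh' => ?_)]
      unfold detPolicy
      rw [hs.agree.policy h' hh']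
    unfold driftIncrement
    rw [h1, hs.2.2 m h le_rfl, hs.agree.policy h hh]
  exp_le w k j m _ := by
    -- The tilt is `-t` because `drift` has the sign opposite to the centred advantage.
    have h1 := pmf_hoeffding
      (mdp.P h (w k j m h) ((server mdp inp b w k).policy h (w k j m h)))
      (advantage mdp (server mdp inp b w k) (h + 1)) mdp.H (-t) fun s =>
        ⟨sub_nonneg.2 (mdp.value_le_optValue _ _ _), by
          unfold advantage
          linarith [mdp.optValue_le (h + 1) s,
            mdp.value_nonneg (detPolicy (server mdp inp b w k).policy) (h + 1) s]⟩
    refine le_trans (le_of_eq ?_) h1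
    refine Finset.sum_congr rfl fun s _ => ?_
    unfold driftIncrement
    congr 3
    ring

theorem partialSum_zero {h : ℕ} (f : (ℕ → ℕ → Fin inp.M → ℕ → S) → ℕ → ℕ → Fin inp.M → S → ℝ)
    (w : ℕ → ℕ → Fin inp.M → ℕ → S) (K : ℕ) :
    partialSum mdp inp b h f w K 0
      = runSum mdp inp b w K (fun k j m => f w k j m (w k j m (h + 1))) := by
  simp [partialSum, runSum]

theorem partialSum_windowIncrement (h : ℕ) (x : S) (a : A) (i n : ℕ) (t : ℝ) (K : ℕ) :
    partialSum mdp inp b h (windowIncrement mdp inp b h x a i n t) w K 0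
      = t * windowSum mdp inp b w h x a (noise mdp inp w h x a) i n K
        - t ^ 2 * (mdp.H : ℝ) ^ 2 / 8 * windowSum mdp inp b w h x a (fun _ _ _ => 1) i n K := by
  rw [partialSum_zero]
  unfold runSum windowSum visitSum roundSum
  simp only [Finset.mul_sum, ← Finset.sum_sub_distrib]
  refine Finset.sum_congr rfl fun k _ => Finset.sum_congr rfl fun j _ =>
    Finset.sum_congr rfl fun m _ => ?_
  unfold windowIncrement noise
  by_cases h1 : Hit inp (server mdp inp b w k) (w k) j m h x a
  · by_cases h2 : i < pos mdp inp b w h x a k j m ∧ pos mdp inp b w h x a k j m ≤ n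
    · simp only [if_pos h1, if_pos h2, if_pos (And.intro h1 h2), mul_one]
    · rw [if_neg (fun hc => h2 hc.2), if_pos h1, if_pos h1, if_neg h2, if_neg h2]; ring
  · rw [if_neg (fun hc => h1 hc.1), if_neg h1, if_neg h1]; ring

theorem partialSum_driftIncrement (h : ℕ) (t : ℝ) (K : ℕ) :
    partialSum mdp inp b h (driftIncrement mdp inp b h t) w K 0
      = t * runSum mdp inp b w K (drift mdp inp b w h)
        - t ^ 2 * (mdp.H : ℝ) ^ 2 / 8 * (inp.M * (server mdp inp b w K).episodes) := by
  rw [partialSum_zero]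
  have : (inp.M * (server mdp inp b w K).episodes : ℝ)
      = runSum mdp inp b w K (fun _ _ _ => 1) := by
    rw [episodes_eq]
    simp only [runSum, Finset.sum_const, Finset.card_univ, Fintype.card_fin, Finset.card_range,
      nsmul_eq_mul, mul_one, Nat.cast_sum, Finset.mul_sum]
    exact Finset.sum_congr rfl fun _ _ => mul_comm _ _
  rw [this]
  unfold runSum
  simp only [Finset.mul_sum, ← Finset.sum_sub_distrib, mul_one]
  rfl

end Increments

section Tails

variable [Nonempty S] [Nonempty A]
variable {Ω : Type*} [MeasurableSpace Ω] {μ : Measure Ω} [IsProbabilityMeasure μ]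
  {X : Ω → ℕ → ℕ → Fin inp.M → ℕ → S}

/-- The Chernoff exponent at deviation `H √(3 v d)` for `d` increments of range `H`: the linear term
is `12 v`, the quadratic one `6 v`, leaving a tail `exp (-(6 v))`. -/
theorem exists_tilt {H d v : ℝ} (hH : 0 < H) (hd : 0 < d) (hv : 0 ≤ v) :
    ∃ t : ℝ, 0 ≤ t ∧ t ^ 2 * H ^ 2 / 8 * d = 6 * v ∧ t * (H * Real.sqrt (3 * v * d)) = 12 * v := by
  refine ⟨Real.sqrt (48 * v / d) / H, by positivity, ?_, ?_⟩
  · rw [div_pow, Real.sq_sqrt (by positivity)]; field_simp; ring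
  · have : Real.sqrt (48 * v / d) * Real.sqrt (3 * v * d) = 12 * v := by
      rw [← Real.sqrt_mul (by positivity), show 48 * v / d * (3 * v * d) = (12 * v) ^ 2 by
        field_simp; ring, Real.sqrt_sq (by positivity)]
    calc _ = Real.sqrt (48 * v / d) * Real.sqrt (3 * v * d) := by field_simp
      _ = _ := this

/-- The event that the noise in a window of visits exceeds its bound, on one side. -/
def badWindow (mdp : MDP S A) (inp : Input S A) (b : ℕ → ℝ) (X : Ω → ℕ → ℕ → Fin inp.M → ℕ → S)
    (K : ℕ) (v : ℝ) (h : ℕ) (x : S) (a : A) (i n : ℕ) (sgn : ℝ) : Set Ω :=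
  {ω | i < n ∧ n ≤ count mdp inp b (X ω) h x a K ∧
    mdp.H * Real.sqrt (3 * v * ((n : ℝ) - i))
      < sgn * windowSum mdp inp b (X ω) h x a (noise mdp inp (X ω) h x a) i n K}

/-- The event requires all visits of the window to have occurred, so the quadratic term has exactly
`n - i` summands and the tilt may be deterministic. -/
theorem measure_badWindow_le (hX : IsRun mdp inp b μ X) {K : ℕ} {v : ℝ} (hv : 0 ≤ v) {h : ℕ}
    (hh : h < mdp.H) (x : S) (a : A) (i n : ℕ) {sgn : ℝ} (hs : sgn ^ 2 = 1) :
    μ (badWindow mdp inp b X K v h x a i n sgn) ≤ ENNReal.ofReal (Real.exp (-(6 * v))) := by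
  by_cases hin : i < n
  swap
  · have : badWindow mdp inp b X K v h x a i n sgn = ∅ := by
      ext ω; simp [badWindow, hin]
    rw [this]; simp
  have hd : (0 : ℝ) < (n : ℝ) - i := sub_pos.2 (by exact_mod_cast hin)
  have hH : (0 : ℝ) < mdp.H := by exact_mod_cast mdp.H_pos
  obtain ⟨t, ht0, ht1, ht2⟩ := exists_tilt hH hd hv
  refine (measure_mono fun ω hω => ?_).trans (measure_le_partialSum_le hX hh
    (isExpSupermartingale_windowIncrement hh x a i n (t * sgn)) K (6 * v))
  obtain ⟨-, hn, hlt⟩ := hω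
  change 6 * v ≤ _
  rw [partialSum_windowIncrement, windowSum_one hin.le hn, mul_pow, hs, mul_one, ht1, mul_assoc]
  have := mul_le_mul_of_nonneg_left hlt.le ht0
  linarith

/-- The event that the drift exceeds its bound after `q` episodes of all agents. -/
def badDrift (mdp : MDP S A) (inp : Input S A) (b : ℕ → ℝ) (X : Ω → ℕ → ℕ → Fin inp.M → ℕ → S)
    (K : ℕ) (v : ℝ) (h q : ℕ) : Set Ω :=
  {ω | 0 < q ∧ inp.M * (server mdp inp b (X ω) K).episodes = q ∧
    mdp.H * Real.sqrt (3 * v * q) < runSum mdp inp b (X ω) K (drift mdp inp b (X ω) h)}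

/-- The number of episodes is random. Fixing its value `q` inside the event makes the quadratic term
deterministic; the union bound later runs over `q`. -/
theorem measure_badDrift_le (hX : IsRun mdp inp b μ X) {K : ℕ} {v : ℝ} (hv : 0 ≤ v) {h : ℕ}
    (hh : h < mdp.H) (q : ℕ) :
    μ (badDrift mdp inp b X K v h q) ≤ ENNReal.ofReal (Real.exp (-(6 * v))) := by
  rcases Nat.eq_zero_or_pos q with hq | hq
  · have : badDrift mdp inp b X K v h q = ∅ := by
      ext ω; simp [badDrift, hq]
    rw [this]; simp
  have hd : (0 : ℝ) < q := by exact_mod_cast hq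
  have hH : (0 : ℝ) < mdp.H := by exact_mod_cast mdp.H_pos
  obtain ⟨t, ht0, ht1, ht2⟩ := exists_tilt hH hd hv
  refine (measure_mono fun ω hω => ?_).trans (measure_le_partialSum_le hX hh
    (isExpSupermartingale_driftIncrement hh t) K (6 * v))
  obtain ⟨-, hn, hlt⟩ := hω
  have hn' : (inp.M * (server mdp inp b (X ω) K).episodes : ℝ) = q := by exact_mod_cast hn
  change 6 * v ≤ _
  rw [partialSum_driftIncrement, hn', ht1]
  have := mul_le_mul_of_nonneg_left hlt.le ht0
  linarith

/-- All indices of windows. -/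
abbrev windowIndex (mdp : MDP S A) (inp : Input S A) : Finset (ℕ × S × A × ℕ × ℕ × Bool) :=
  Finset.range mdp.H ×ˢ Finset.univ ×ˢ Finset.univ ×ˢ Finset.range (2 * inp.T₀ + inp.M + 1)
    ×ˢ Finset.range (2 * inp.T₀ + inp.M + 1) ×ˢ Finset.univ

/-- All indices of drift events. -/
abbrev driftIndex (mdp : MDP S A) (inp : Input S A) : Finset (ℕ × ℕ) :=
  Finset.range mdp.H ×ˢ Finset.range (inp.M * (inp.T₀ + Fintype.card S * inp.T₀) + 1)

/-- The event that some noise or drift exceeds its bound. -/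
def badEvent (mdp : MDP S A) (inp : Input S A) (b : ℕ → ℝ) (X : Ω → ℕ → ℕ → Fin inp.M → ℕ → S)
    (K : ℕ) (v : ℝ) : Set Ω :=
  (⋃ q ∈ windowIndex mdp inp, badWindow mdp inp b X K v q.1 q.2.1 q.2.2.1 q.2.2.2.1 q.2.2.2.2.1
      (if q.2.2.2.2.2 then 1 else -1))
    ∪ ⋃ q ∈ driftIndex mdp inp, badDrift mdp inp b X K v q.1 q.2

theorem measure_badEvent_le (hX : IsRun mdp inp b μ X) (K : ℕ) {v : ℝ} (hv : 0 ≤ v) :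
    μ (badEvent mdp inp b X K v)
      ≤ ((windowIndex mdp inp).card + (driftIndex mdp inp).card : ℕ)
        * ENNReal.ofReal (Real.exp (-(6 * v))) := by
  refine (measure_union_le _ _).trans ?_
  rw [Nat.cast_add, add_mul]
  refine add_le_add ?_ ?_
  · refine (measure_biUnion_finset_le _ _).trans ?_
    rw [← nsmul_eq_mul]
    refine Finset.sum_le_card_nsmul _ _ _ fun q hq => ?_
    have hq1 : q.1 < mdp.H := Finset.mem_range.1 (Finset.mem_product.1 hq).1
    exact measure_badWindow_le hX hv hq1 _ _ _ _ (by split_ifs <;> norm_num)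
  · refine (measure_biUnion_finset_le _ _).trans ?_
    rw [← nsmul_eq_mul]
    refine Finset.sum_le_card_nsmul _ _ _ fun q hq => ?_
    exact measure_badDrift_le hX hv (Finset.mem_range.1 (Finset.mem_product.1 hq).1) _

theorem abs_windowSum_le_of_notMem {K : ℕ} {v : ℝ} {ω : Ω}
    (hω : ω ∉ badEvent mdp inp b X K v) {h : ℕ} (hh : h < mdp.H) (x : S) (a : A) {i n : ℕ}
    (hin : i < n) (hn : n ≤ count mdp inp b (X ω) h x a K) :
    |windowSum mdp inp b (X ω) h x a (noise mdp inp (X ω) h x a) i n K|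
      ≤ mdp.H * Real.sqrt (3 * v * ((n : ℝ) - i)) := by
  have hnmax : n ≤ 2 * inp.T₀ + inp.M := hn.trans (N_le mdp inp b (X ω) K hh x a)
  have key : ∀ c : Bool, (if c then (1 : ℝ) else -1)
      * windowSum mdp inp b (X ω) h x a (noise mdp inp (X ω) h x a) i n K
      ≤ mdp.H * Real.sqrt (3 * v * ((n : ℝ) - i)) := by
    intro c
    by_contra hc
    refine hω (Or.inl (Set.mem_biUnion (x := (h, x, a, i, n, c)) ?_ ⟨hin, hn, not_le.1 hc⟩))
    simp only [windowIndex, Finset.coe_product, Set.mem_prod, Finset.mem_coe, Finset.mem_range,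
      Finset.mem_univ, true_and, and_true]
    omega
  have h1 := key true
  have h2 := key false
  simp only [if_true, Bool.false_eq_true, if_false] at h1 h2
  exact abs_le.2 ⟨by linarith, by linarith⟩

theorem runSum_drift_le_of_notMem {K : ℕ} {v : ℝ} {ω : Ω}
    (hω : ω ∉ badEvent mdp inp b X K v) {h : ℕ} (hh : h < mdp.H) :
    runSum mdp inp b (X ω) K (drift mdp inp b (X ω) h)
      ≤ mdp.H * Real.sqrt (3 * v * (inp.M * (server mdp inp b (X ω) K).episodes)) := by
  have hE := episodes_le mdp inp b (X ω) K
  rcases Nat.eq_zero_or_pos (server mdp inp b (X ω) K).episodes with h0 | h0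
  · have hlen := episodes_eq mdp inp b (X ω) K
    rw [h0] at hlen
    have : runSum mdp inp b (X ω) K (drift mdp inp b (X ω) h) = 0 := by
      refine Finset.sum_eq_zero fun k hk => ?_
      rw [Finset.sum_eq_zero_iff.1 hlen.symm k hk]; simp
    rw [this]; positivity
  · by_contra hc
    refine hω (Or.inr (Set.mem_biUnion
      (x := (h, inp.M * (server mdp inp b (X ω) K).episodes)) ?_
      ⟨Nat.mul_pos inp.M_pos h0, rfl, ?_⟩))
    · simp only [driftIndex, Finset.coe_product, Set.mem_prod, Finset.mem_coe, Finset.mem_range]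
      exact ⟨hh, Nat.lt_succ_of_le (Nat.mul_le_mul_left _ hE)⟩
    · push_cast
      exact not_le.1 hc

end Tails

/-! ### The accumulated bonus dominates the noise. -/

section Bonus

variable [Nonempty S] [Nonempty A]

theorem bonusSum_eq (c v : ℝ) (h : ℕ) (x : S) (a : A) (k : ℕ) :
    bonusSum mdp inp (hoeffdingBonus c mdp.H v) w h x a k
      = c * Real.sqrt ((mdp.H : ℝ) ^ 3 * v)
        * ∑ i ∈ Finset.Ioc 0 (count mdp inp (hoeffdingBonus c mdp.H v) w h x a k),
            weight mdp.H (count mdp inp (hoeffdingBonus c mdp.H v) w h x a k) i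
              * (1 / Real.sqrt i) := by
  unfold bonusSum hoeffdingBonus
  rw [Finset.mul_sum]
  refine Finset.sum_congr rfl fun i _ => ?_
  rw [Real.sqrt_div' _ (Nat.cast_nonneg i)]
  ring

theorem bonusSum_le (v : ℝ) (h : ℕ) (x : S) (a : A) (k : ℕ) :
    bonusSum mdp inp (hoeffdingBonus 3 mdp.H v) w h x a k
      ≤ 6 * Real.sqrt ((mdp.H : ℝ) ^ 3 * v)
        * (1 / Real.sqrt (count mdp inp (hoeffdingBonus 3 mdp.H v) w h x a k)) := by
  rw [bonusSum_eq]
  have h1 := mul_le_mul_of_nonneg_left (sum_weight_div_sqrt_le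
    (count mdp inp (hoeffdingBonus 3 mdp.H v) w h x a k) mdp.H_pos)
    (show 0 ≤ 3 * Real.sqrt ((mdp.H : ℝ) ^ 3 * v) by positivity)
  linarith

/-- Abel summation gives at most `(3 / 2) H √(3 ι) √(H / N)`. Since `√3 ≤ 2`, this is at most `3
√(H³ ι / N)`, which the bonus with constant `3` reaches. -/
theorem abs_aggregate_noise_le {v : ℝ} (hv : 0 ≤ v) {h : ℕ} {x : S} {a : A} {k K : ℕ} (hk : k ≤ K)
    (hw : ∀ i n, i < n → n ≤ count mdp inp (hoeffdingBonus 3 mdp.H v) w h x a K →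
      |windowSum mdp inp (hoeffdingBonus 3 mdp.H v) w h x a (noise mdp inp w h x a) i n K|
        ≤ mdp.H * Real.sqrt (3 * v * ((n : ℝ) - i))) :
    |aggregate mdp inp (hoeffdingBonus 3 mdp.H v) w h x a (noise mdp inp w h x a) k|
      ≤ bonusSum mdp inp (hoeffdingBonus 3 mdp.H v) w h x a k := by
  set N := count mdp inp (hoeffdingBonus 3 mdp.H v) w h x a k with hN
  rcases Nat.eq_zero_or_pos N with h0 | h0
  · rw [aggregate_eq_zero _ (hN.symm.trans h0), bonusSum_eq, ← hN, h0]; simp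
  · have h1 := abs_aggregate_le (mdp := mdp) (inp := inp) (b := hoeffdingBonus 3 mdp.H v) (w := w)
      (h := h) (x := x) (a := a) (g := noise mdp inp w h x a) (L := mdp.H * Real.sqrt (3 * v))
      (by positivity) hk h0 (fun i hi => by
        have := hw i N hi (count_mono mdp inp _ w h x a hk)
        rwa [Real.sqrt_mul (by positivity), ← mul_assoc] at this)
    refine h1.trans ?_
    rw [bonusSum_eq, ← hN]
    have h2 := mul_le_mul_of_nonneg_left (div_sqrt_le_sum_weight N mdp.H_pos h0)
      (show 0 ≤ 3 * Real.sqrt ((mdp.H : ℝ) ^ 3 * v) by positivity)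
    refine le_trans ?_ h2
    have hH : (0 : ℝ) ≤ mdp.H := Nat.cast_nonneg _
    have e1 : Real.sqrt ((mdp.H : ℝ) ^ 3 * v) = mdp.H * (Real.sqrt mdp.H * Real.sqrt v) := by
      rw [show (mdp.H : ℝ) ^ 3 * v = (mdp.H : ℝ) ^ 2 * (mdp.H * v) by ring,
        Real.sqrt_mul (by positivity), Real.sqrt_sq hH, Real.sqrt_mul hH]
    have e2 : Real.sqrt (3 * v) ≤ 2 * Real.sqrt v := by
      rw [Real.sqrt_mul (by norm_num)]
      refine mul_le_mul_of_nonneg_right ?_ (Real.sqrt_nonneg _)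
      rw [Real.sqrt_le_left (by norm_num)]; norm_num
    rw [Real.sqrt_div' _ (Nat.cast_nonneg N), e1]
    calc 3 / 2 * (mdp.H * Real.sqrt (3 * v)) * (Real.sqrt mdp.H / Real.sqrt N)
        ≤ 3 / 2 * (mdp.H * (2 * Real.sqrt v)) * (Real.sqrt mdp.H / Real.sqrt N) := by gcongr
      _ = _ := by ring

end Bonus

/-! ### The union bound and the final constants. -/

section Final

/-- With `Z = exp v`, each of the two families has at most `p Z ^ 3` events, and `2 Z ^ 3 ≤ Z ^ 6`
because `Z ≥ 4`. Hence the tail `Z ^ (-6)` leaves total probability at most `p`. -/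
theorem card_indices_mul_exp_le {s a H M T p v : ℝ} (hs : 1 ≤ s) (ha : 1 ≤ a) (hH : 1 ≤ H)
    (hM : 1 ≤ M) (hT : 1 ≤ T) (hp : 0 < p) (hp1 : p < 1)
    (hv : 2 * s * a * (T + H * M) / p ≤ Real.exp v) :
    (H * (s * (a * ((2 * T + M + 1) * ((2 * T + M + 1) * 2)))) + H * (M * (T + s * T) + 1))
      * Real.exp (-(6 * v)) ≤ p := by
  set Z := Real.exp v
  have hZ0 : 0 < Z := Real.exp_pos v
  have hZp : 2 * s * a * (T + H * M) ≤ Z * p := by rwa [div_le_iff₀ hp] at hv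
  have hHM : 1 ≤ H * M := by nlinarith
  have hHM1 : H ≤ H * M := by nlinarith
  have hHM2 : M ≤ H * M := by nlinarith
  have hsa : 1 ≤ s * a := by nlinarith
  have hsa1 : s ≤ s * a := by nlinarith
  have hpZ : Z * p ≤ Z := by nlinarith
  set W := T + H * M with hW
  have hW2 : 2 ≤ W := by linarith
  have h1 : 2 * W ≤ Z := by nlinarith
  have h2 : 2 * T + M + 1 ≤ Z := by linarith
  have h3 : H * (s * a) * 2 ≤ Z * p := by nlinarith
  have h4 : s ≤ Z * p / 4 := by nlinarith
  have hZ4 : 4 ≤ Z := by linarith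
  have f1 : H * (s * (a * ((2 * T + M + 1) * ((2 * T + M + 1) * 2)))) ≤ p * Z ^ 3 := by
    calc _ = H * (s * a) * 2 * ((2 * T + M + 1) * (2 * T + M + 1)) := by ring
      _ ≤ Z * p * (Z * Z) := mul_le_mul h3 (mul_le_mul h2 h2 (by positivity) hZ0.le)
          (by positivity) (by positivity)
      _ = p * Z ^ 3 := by ring
  have f2 : H * (M * (T + s * T) + 1) ≤ p * Z ^ 3 := by
    have g1 : M * (T + s * T) + 1 ≤ 3 * (M * T * s) := by
      have h5 : 1 ≤ M * T := by nlinarith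
      nlinarith
    calc H * (M * (T + s * T) + 1) ≤ H * (3 * (M * T * s)) :=
          mul_le_mul_of_nonneg_left g1 (by linarith)
      _ = 3 * ((H * M) * T * s) := by ring
      _ ≤ 3 * (Z * Z * (Z * p / 4)) := by
          have h6 : H * M ≤ Z := by linarith
          have h7 : T ≤ Z := by linarith
          gcongr
      _ ≤ p * Z ^ 3 := by nlinarith [show 0 ≤ p * Z ^ 3 by positivity]
  have h8 : 2 * (p * Z ^ 3) ≤ p * Z ^ 6 := by
    have : 2 ≤ Z ^ 3 := by nlinarith [sq_nonneg Z, mul_self_nonneg (Z - 1)]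
    nlinarith [show 0 < p * Z ^ 3 by positivity]
  have e : Real.exp (-(6 * v)) = (Z ^ 6)⁻¹ := by
    rw [Real.exp_neg, ← Real.exp_nat_mul]; norm_num
  rw [e, ← div_eq_mul_inv, div_le_iff₀ (by positivity)]
  linarith

/-- The drift contribution is absorbed into the leading term; after squaring this is `3 ≤ 4 H sa`.
-/
theorem sq_mul_sqrt_le {H v M E sa : ℝ} (hH : 1 ≤ H) (hv : 0 ≤ v) (hM : 0 ≤ M) (hE : 0 ≤ E)
    (hsa : 1 ≤ sa) :
    H * (H * Real.sqrt (3 * v * (M * E))) ≤ 2 * Real.sqrt (H ^ 4 * v * M * (H * E) * sa) := by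
  have hH0 : 0 ≤ H := by linarith
  have h4 : Real.sqrt (H ^ 4) = H ^ 2 := by
    rw [show H ^ 4 = (H ^ 2) ^ 2 by ring, Real.sqrt_sq (by positivity)]
  have e : H * (H * Real.sqrt (3 * v * (M * E))) = Real.sqrt (H ^ 4 * (3 * v * (M * E))) := by
    rw [Real.sqrt_mul (show 0 ≤ H ^ 4 by positivity), h4]; ring
  have e2 : 2 * Real.sqrt (H ^ 4 * v * M * (H * E) * sa)
      = Real.sqrt (4 * (H ^ 4 * v * M * (H * E) * sa)) := by
    rw [Real.sqrt_mul (by norm_num : (0 : ℝ) ≤ 4),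
      show Real.sqrt 4 = 2 by rw [show (4 : ℝ) = 2 ^ 2 by norm_num, Real.sqrt_sq (by norm_num)]]
  rw [e, e2]
  refine Real.sqrt_le_sqrt ?_
  have h1 : 1 ≤ H * sa := by nlinarith
  have h2 : 0 ≤ H ^ 4 * v * M * E := by positivity
  nlinarith

theorem mul_sqrt_mul_sqrt {H v M E s a : ℝ} (hH : 0 ≤ H) (hv : 0 ≤ v) :
    H * (Real.sqrt (H ^ 3 * v) * Real.sqrt (s * a * (M * E)))
      = Real.sqrt (H ^ 4 * v * M * (H * E) * s * a) := by
  rw [← Real.sqrt_mul (by positivity)]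
  nth_rw 1 [← Real.sqrt_sq hH]
  rw [← Real.sqrt_mul (by positivity)]
  congr 1; ring

end Final

end

end FedQ

theorem theorem1 :
    ∃ c C : ℝ, 0 < c ∧ 0 < C ∧
      ∀ (S A : Type*) [Fintype S] [Fintype A] [DecidableEq S] [DecidableEq A]
        [Nonempty S] [Nonempty A]
        (mdp : FedQ.MDP S A) (inp : FedQ.Input S A) (K : ℕ) (p : ℝ) (ι : ℝ),
        1 ≤ K → K ≤ inp.K₀ → 0 < p → p < 1 →
        ι = FedQ.logFactor (Fintype.card S) (Fintype.card A) mdp.H inp.M inp.T₀ inp.K₀ p →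
        ∀ (Ω : Type*) [MeasurableSpace Ω] (μ : MeasureTheory.Measure Ω)
          [MeasureTheory.IsProbabilityMeasure μ] (X : Ω → ℕ → ℕ → Fin inp.M → ℕ → S),
          FedQ.IsRun mdp inp (FedQ.hoeffdingBonus c mdp.H ι) μ X →
          1 - p ≤ μ.real {ω |
            FedQ.regret mdp inp (FedQ.hoeffdingBonus c mdp.H ι) (X ω) K ≤
              C * (Real.sqrt ((mdp.H : ℝ) ^ 4 * ι * (inp.M : ℝ)
                      * (FedQ.steps mdp inp (FedQ.hoeffdingBonus c mdp.H ι) (X ω) K : ℝ)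
                      * (Fintype.card S : ℝ) * (Fintype.card A : ℝ))
                + (mdp.H : ℝ) * (Fintype.card S : ℝ) * (Fintype.card A : ℝ) * ((inp.M : ℝ) - 1)
                    * Real.sqrt ((mdp.H : ℝ) ^ 3 * ι)
                + (inp.M : ℝ) * (mdp.H : ℝ) ^ 2 * (Fintype.card S : ℝ) * (Fintype.card A : ℝ)
                + (mdp.H : ℝ) ^ 4 * (Fintype.card S : ℝ) * (Fintype.card A : ℝ)
                    * ((inp.M : ℝ) - 1))} := by
  -- The bonus constant `3` comes from `abs_aggregate_noise_le`. The largest coefficient of the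
  -- final bound is `9 * 84 = 756`; the leading term has `9 * (30 + 2) = 288`.
  refine ⟨3, 1000, by norm_num, by norm_num, ?_⟩
  intro S A _ _ _ _ _ _ mdp inp K p ι _ _ hp0 hp1 hι Ω _ μ _ X hX
  have hs : (1 : ℝ) ≤ Fintype.card S := by exact_mod_cast Fintype.card_pos (α := S)
  have ha : (1 : ℝ) ≤ Fintype.card A := by exact_mod_cast Fintype.card_pos (α := A)
  have hH : (1 : ℝ) ≤ mdp.H := by exact_mod_cast mdp.H_pos
  have hM : (1 : ℝ) ≤ inp.M := by exact_mod_cast inp.M_pos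
  have hT : (1 : ℝ) ≤ inp.T₀ := by exact_mod_cast inp.T₀_pos
  set s := (Fintype.card S : ℝ) with hs_def
  set a := (Fintype.card A : ℝ) with ha_def
  have hexp : 2 * s * a * ((inp.T₀ : ℝ) + mdp.H * inp.M) / p ≤ Real.exp ι := by
    have hC : 0 ≤ FedQ.Ctilde mdp.H := by unfold FedQ.Ctilde; positivity
    have h1 : Real.log (2 * s * a * ((inp.T₀ : ℝ) + mdp.H * inp.M) * (1 + FedQ.Ctilde mdp.H) / p)
        ≤ ι := by rw [hι]; exact le_max_left _ _
    have h2 := (Real.log_le_iff_le_exp (by positivity)).1 h1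
    exact le_trans (div_le_div_of_nonneg_right
      (le_mul_of_one_le_right (by positivity) (by linarith)) hp0.le) h2
  have hι0 : 0 ≤ ι := by
    rw [← Real.one_le_exp_iff]
    refine le_trans ?_ hexp
    rw [le_div_iff₀ hp0]
    have h1 : 1 ≤ s * a := by nlinarith
    have h2 : 1 ≤ (inp.T₀ : ℝ) + mdp.H * inp.M := by nlinarith
    nlinarith
  set b := FedQ.hoeffdingBonus 3 mdp.H ι with hb
  have hbad : μ.real (FedQ.badEvent mdp inp b X K ι) ≤ p := by
    refine ENNReal.toReal_le_of_le_ofReal hp0.le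
      ((FedQ.measure_badEvent_le hX K hι0).trans ?_)
    rw [← ENNReal.ofReal_natCast, ← ENNReal.ofReal_mul (Nat.cast_nonneg _)]
    refine ENNReal.ofReal_le_ofReal (le_trans (le_of_eq ?_)
      (FedQ.card_indices_mul_exp_le hs ha hH hM hT hp0 hp1 hexp))
    congr 1
    simp only [Finset.card_product, Finset.card_range, Finset.card_univ, Fintype.card_bool]
    push_cast
    rfl
  -- The good and bad events cover the whole space. Subadditivity then gives the claim without
  -- measurability of either event.
  have hcover : (1 : ℝ) ≤ μ.real ({ω | FedQ.regret mdp inp b (X ω) K ≤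
              1000 * (Real.sqrt ((mdp.H : ℝ) ^ 4 * ι * (inp.M : ℝ)
                      * (FedQ.steps mdp inp b (X ω) K : ℝ) * s * a)
                + (mdp.H : ℝ) * s * a * ((inp.M : ℝ) - 1) * Real.sqrt ((mdp.H : ℝ) ^ 3 * ι)
                + (inp.M : ℝ) * (mdp.H : ℝ) ^ 2 * s * a
                + (mdp.H : ℝ) ^ 4 * s * a * ((inp.M : ℝ) - 1))}
      ∪ FedQ.badEvent mdp inp b X K ι) := by
    refine (MeasureTheory.probReal_univ (μ := μ)).ge.trans
      (MeasureTheory.measureReal_mono fun ω _ => ?_)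
    by_cases hω : ω ∈ FedQ.badEvent mdp inp b X K ι
    · exact Or.inr hω
    left
    change FedQ.regret mdp inp b (X ω) K ≤ _
    have hreg := FedQ.regret_le (mdp := mdp) (inp := inp) (b := b) (w := X ω) (K := K)
      (D := Real.sqrt ((mdp.H : ℝ) ^ 3 * ι))
      (B := mdp.H * Real.sqrt (3 * ι * (inp.M * (FedQ.server mdp inp b (X ω) K).episodes)))
      (Real.sqrt_nonneg _) (by positivity)
      (fun k hk h hh x a => FedQ.abs_aggregate_noise_le hι0 hk fun i n hin hn =>
        FedQ.abs_windowSum_le_of_notMem hω hh x a hin hn)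
      (fun k _ h _ x a => FedQ.bonusSum_le ι h x a k)
      (fun h hh => FedQ.runSum_drift_le_of_notMem hω hh)
    refine hreg.trans ?_
    set E := ((FedQ.server mdp inp b (X ω) K).episodes : ℝ) with hE
    have hE0 : 0 ≤ E := Nat.cast_nonneg _
    have hsteps : (FedQ.steps mdp inp b (X ω) K : ℝ) = mdp.H * E := by
      rw [hE, FedQ.episodes_eq]; unfold FedQ.steps; push_cast; rfl
    rw [hsteps]
    set D := Real.sqrt ((mdp.H : ℝ) ^ 3 * ι) with hD
    have hD0 : 0 ≤ D := Real.sqrt_nonneg _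
    have hsa : 1 ≤ s * a := by nlinarith
    have h1 := FedQ.sq_mul_sqrt_le hH hι0 (show (0 : ℝ) ≤ inp.M by linarith) hE0 hsa
    have h2 := FedQ.mul_sqrt_mul_sqrt (M := inp.M) (E := E) (s := s) (a := a)
      (show (0 : ℝ) ≤ mdp.H by linarith) hι0
    rw [← mul_assoc _ s a] at h1
    rw [← hD] at h2
    have hM1 : 0 ≤ (inp.M : ℝ) - 1 := by linarith
    have p1 : 0 ≤ (inp.M : ℝ) * (mdp.H : ℝ) ^ 2 * s * a := by positivity
    have p2 : 0 ≤ (mdp.H : ℝ) ^ 4 * s * a * ((inp.M : ℝ) - 1) := by positivity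
    have p3 : 0 ≤ (mdp.H : ℝ) * s * a * ((inp.M : ℝ) - 1) * D := by positivity
    have p4 := Real.sqrt_nonneg ((mdp.H : ℝ) ^ 4 * ι * inp.M * (mdp.H * E) * s * a)
    linarith
  have hun := MeasureTheory.measureReal_union_le (μ := μ) {ω | FedQ.regret mdp inp b (X ω) K ≤
              1000 * (Real.sqrt ((mdp.H : ℝ) ^ 4 * ι * (inp.M : ℝ)
                      * (FedQ.steps mdp inp b (X ω) K : ℝ) * s * a)
                + (mdp.H : ℝ) * s * a * ((inp.M : ℝ) - 1) * Real.sqrt ((mdp.H : ℝ) ^ 3 * ι)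
                + (inp.M : ℝ) * (mdp.H : ℝ) ^ 2 * s * a
                + (mdp.H : ℝ) ^ 4 * s * a * ((inp.M : ℝ) - 1))}
      (FedQ.badEvent mdp inp b X K ι)
  linarith
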